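/- **Conventions.** Composition is written in diagrammatic order. An *additive category* is a category enriched in commutative monoids (no negatives, no biproducts assumed); an *additive symmetric monoidal category* is a symmetric monoidal category $(\mathbb X,\otimes,K,\sigma)$ which is additive and whose tensor product preserves sums and zeros in each variable. A *coalgebra modality* is a comonad $(!,\delta,\varepsilon)$ with natural maps $\Delta:!A\to !A\otimes !A$ and $e:!A\to K$ making each $!A$ a cocommutative comonoid, with $\delta\Delta=\Delta(\delta\otimes\delta)$. A *bialgebra modality* has moreover natural maps $\nabla:!A\otimes !A\to !A$ and $u:K\to !A$ making each $!A$ a commutative monoid and a bialgebra, with $\nabla\varepsilon=\varepsilon\otimes e+e\otimes\varepsilon$. It is *additive* if $!(f+g)=\Delta(!f\otimes !g)\nabla$ and $!(0)=eu$. An *additive monoidal storage category* is an additive symmetric monoidal category with finite products and a coalgebra modality whose Seely maps $e:!\mathsf T\to K$ ($\mathsf T$ terminal) and $\chi=\Delta(!\pi_0\otimes !\pi_1):!(A\times B)\to !A\otimes !B$ are isomorphisms. A *deriving transformation* is a natural map $\mathsf d:!A\otimes A\to !A$ with - $\mathsf d e=0$, $\ \mathsf d\varepsilon=e\otimes 1$,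 $\ \mathsf d\delta=(\Delta\otimes 1)(\delta\otimes\mathsf d)\mathsf d$, - $\mathsf d\Delta=(\Delta\otimes 1)\big((1\otimes\mathsf d)+(1\otimes\sigma)(\mathsf d\otimes 1)\big)$, $\ (\mathsf d\otimes 1)\mathsf d=(1\otimes\sigma)(\mathsf d\otimes1)\mathsf d$; a *differential category* is an additive symmetric monoidal category with a coalgebra modality and a deriving transformation. A *codereliction* for a bialgebra modality is a natural map $\eta:A\to !A$ with $\eta e=0$, $\eta\varepsilon=1$, $\eta\Delta=\eta\otimes u+u\otimes\eta$ and $(1\otimes\eta)\nabla\delta=(\Delta\otimes\eta)(1\otimes\nabla)(\delta\otimes\eta)\nabla$. The *biproduct completion* $\mathsf B[\mathbb X]$ has as objects finite lists $(A_1,\dots,A_n)$ of objects of $\mathbb X$, including $()$, and as maps $(A_1,\dots,A_n)\to(B_1,\dots,B_m)$ matrices of maps $f_{i,j}:A_i\to B_j$, with matrix multiplication and entrywise sum. It is an additive symmetric monoidal category with unit $(K)$, tensor product $(A_i)_i\otimes(B_j)_j=(A_1\otimes B_1,\dots,A_1\otimes B_m,\dots,A_n\otimes B_m)$ on objects and the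 Kronecker product on matrices, and structural isomorphisms induced by those of $\mathbb X$. **Proposition.** Let $\mathbb X$ be an additive symmetric monoidal category with an additive bialgebra modality $(!,\delta,\varepsilon,\Delta,e,\nabla,u)$. (If $\mathbb X$ is not strict, $n$-fold tensor products below are bracketed as $((K\otimes X_1)\otimes\cdots)\otimes X_n$ and coherence isomorphisms are suppressed.) 1. $\mathsf B[\mathbb X]$ has finite biproducts: $()$ is a zero object and concatenation of lists, with the blocks of identity matrices as projections and injections, is a biproduct. 2. $\mathsf B[\mathbb X]$ carries an additive bialgebra modality with $!(A_1,\dots,A_n)=(!A_1\otimes\cdots\otimes !A_n)$, a list of length one, given as follows. $\Delta,e,\nabla,u$ are those of the tensor product of the bialgebras $!A_i$. For a matrix $[f_{i,j}]:(A_i)_{i\le n}\to(B_j)_{j\le m}$, the map $!([f_{i,j}])$ copies each $!A_i$ into $m$ factors by $\Delta$, applies $!(f_{i,j})$ to the $j$-th of them, and multiplies the $n$ resulting factors $!B_j$ by $\nabla$, for each $j$. The counit $\varepsilon$ is the matrix with entries $e\otimes\cdots\otimes\varepsilon_{A_i}\otimes\cdots\otimes e$. The comultiplication $\delta$, with $T=!A_1\otimes\cdots\otimes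 !A_n$, is the composite $$T\to{!}T\otimes\cdots\otimes{!}T\to{!}T\xrightarrow{\ \delta\ }{!!}T\to{!}T$$ whose first map is the tensor product of the maps $\delta_{A_i}\,!(u\otimes\cdots\otimes1\otimes\cdots\otimes u)$, whose second is the $n$-fold $\nabla$, and whose last is $!$ of the $n$-fold $\Delta:!T\to !T\otimes\cdots\otimes !T$ followed by the tensor product of the maps $!(e\otimes\cdots\otimes\varepsilon_{A_i}\otimes\cdots\otimes e)$. 3. With this modality $\mathsf B[\mathbb X]$ is an additive monoidal storage category. 4. The Seely isomorphisms are strict: $e:!()\to(K)$ is an identity, and for the concatenation of two lists $\chi$ is the canonical coherence isomorphism (composed of associators and unitors) $!(A_1,\dots,A_m,B_1,\dots,B_n)\cong{!}(A_1,\dots,A_m)\otimes{!}(B_1,\dots,B_n)$. In particular, if $\mathbb X$ is strict monoidal, these two objects are equal and $\chi$ is the identity. 5. If $\eta$ is a codereliction on $\mathbb X$, then the column matrix $\eta'$ with entries $u\otimes\cdots\otimes\eta_{A_i}\otimes\cdots\otimes u:A_i\to{!}A_1\otimes\cdots\otimes{!}A_n$ is a codereliction on $\mathsf B[\mathbb X]$,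 and $(1\otimes\eta')\nabla$ is a deriving transformation on $\mathsf B[\mathbb X]$. 6. If $\mathsf d$ is a deriving transformation for the given modality on $\mathbb X$ (so that $\mathbb X$ is a differential category), then $(1\otimes\eta')\nabla$, with $\eta'$ as in 5 formed from $\eta=(u\otimes1)\mathsf d$, is a deriving transformation on $\mathsf B[\mathbb X]$; thus $\mathsf B[\mathbb X]$ is a differential category. -/

import Mathlib

open CategoryTheory MonoidalCategory

universe v u

set_option linter.unusedSectionVars false

noncomputable section

/-! ### Additive categories (commutative monoid enriched) -/

/-- An additive category in the sense of differential categories: every hom-set is a commutative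
monoid and composition is biadditive.  Neither negatives nor biproducts are assumed. -/
class AdditiveCategory (C : Type u) [Category.{v} C] where
  homAddCommMonoid : ∀ A B : C, AddCommMonoid (A ⟶ B)
  add_comp : ∀ {A B D : C} (f g : A ⟶ B) (h : B ⟶ D), (f + g) ≫ h = f ≫ h + g ≫ h
  comp_add : ∀ {A B D : C} (f : A ⟶ B) (g h : B ⟶ D), f ≫ (g + h) = f ≫ g + f ≫ h
  zero_comp : ∀ {A B D : C} (h : B ⟶ D), (0 : A ⟶ B) ≫ h = 0
  comp_zero : ∀ {A B D : C} (f : A ⟶ B), f ≫ (0 : B ⟶ D) = 0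

attribute [reducible, instance] AdditiveCategory.homAddCommMonoid

instance AdditiveCategory.hasZeroMorphisms (C : Type u) [Category.{v} C] [AdditiveCategory C] :
    Limits.HasZeroMorphisms C where
  zero _ _ := ⟨0⟩
  comp_zero f _ := AdditiveCategory.comp_zero f
  zero_comp _ _ _ h := AdditiveCategory.zero_comp h

/-- An additive symmetric monoidal category: the tensor product is additive in each variable
(the symmetric monoidal structure itself is Mathlib's). -/
class AdditiveMonoidal (C : Type u) [Category.{v} C] [MonoidalCategory C]
    [AdditiveCategory C] : Prop where
  whiskerLeft_add : ∀ (A : C) {B D : C} (f g : B ⟶ D), A ◁ (f + g) = A ◁ f + A ◁ g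
  add_whiskerRight : ∀ {B D : C} (f g : B ⟶ D) (A : C), (f + g) ▷ A = f ▷ A + g ▷ A
  whiskerLeft_zero : ∀ (A B D : C), A ◁ (0 : B ⟶ D) = 0
  zero_whiskerRight : ∀ (A B D : C), (0 : B ⟶ D) ▷ A = 0

/-- A strict monoidal category: the associators and unitors are identities. -/
structure IsStrictMonoidal (C : Type u) [Category.{v} C] [MonoidalCategory C] : Prop where
  assoc_obj : ∀ A B D : C, (A ⊗ B) ⊗ D = A ⊗ (B ⊗ D)
  unit_tensor : ∀ A : C, 𝟙_ C ⊗ A = A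
  tensor_unit : ∀ A : C, A ⊗ 𝟙_ C = A
  associator_eq : ∀ A B D : C, (α_ A B D).hom = eqToHom (assoc_obj A B D)
  leftUnitor_eq : ∀ A : C, (λ_ A).hom = eqToHom (unit_tensor A)
  rightUnitor_eq : ∀ A : C, (ρ_ A).hom = eqToHom (tensor_unit A)

/-! ### Coalgebra modalities, bialgebra modalities, Seely isomorphisms -/

/-- The data `(!, δ, ε, Δ, e)` of a coalgebra modality. -/
structure CoalgebraModalityData (C : Type u) [Category.{v} C] [MonoidalCategory C] where
  obj : C → C
  map : ∀ {A B : C}, (A ⟶ B) → (obj A ⟶ obj B)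
  δ : ∀ A : C, obj A ⟶ obj (obj A)
  ε : ∀ A : C, obj A ⟶ A
  Δ : ∀ A : C, obj A ⟶ obj A ⊗ obj A
  e : ∀ A : C, obj A ⟶ 𝟙_ C

/-- The data `(!, δ, ε, Δ, e, ∇, u)` of a bialgebra modality. -/
structure BialgebraModalityData (C : Type u) [Category.{v} C] [MonoidalCategory C]
    extends CoalgebraModalityData C where
  mul : ∀ A : C, obj A ⊗ obj A ⟶ obj A
  u : ∀ A : C, 𝟙_ C ⟶ obj A

/-- `(!, δ, ε, Δ, e)` is a coalgebra modality: `(!, δ, ε)` is a comonad, `Δ` and `e` are natural,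
`(!A, Δ, e)` is a cocommutative comonoid, and `δ` preserves `Δ`. -/
structure CoalgebraModalityData.IsCoalgebraModality {C : Type u} [Category.{v} C]
    [MonoidalCategory C] [SymmetricCategory C] (M : CoalgebraModalityData C) : Prop where
  map_id : ∀ A : C, M.map (𝟙 A) = 𝟙 (M.obj A)
  map_comp : ∀ {A B D : C} (f : A ⟶ B) (g : B ⟶ D), M.map (f ≫ g) = M.map f ≫ M.map g
  δ_natural : ∀ {A B : C} (f : A ⟶ B), M.map f ≫ M.δ B = M.δ A ≫ M.map (M.map f)
  ε_natural : ∀ {A B : C} (f : A ⟶ B), M.map f ≫ M.ε B = M.ε A ≫ f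
  left_counit : ∀ A : C, M.δ A ≫ M.ε (M.obj A) = 𝟙 (M.obj A)
  right_counit : ∀ A : C, M.δ A ≫ M.map (M.ε A) = 𝟙 (M.obj A)
  coassoc : ∀ A : C, M.δ A ≫ M.δ (M.obj A) = M.δ A ≫ M.map (M.δ A)
  Δ_natural : ∀ {A B : C} (f : A ⟶ B), M.map f ≫ M.Δ B = M.Δ A ≫ (M.map f ⊗ₘ M.map f)
  e_natural : ∀ {A B : C} (f : A ⟶ B), M.map f ≫ M.e B = M.e A
  Δ_coassoc : ∀ A : C, M.Δ A ≫ (M.Δ A ▷ M.obj A) ≫ (α_ _ _ _).hom = M.Δ A ≫ (M.obj A ◁ M.Δ A)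
  Δ_left_counit : ∀ A : C, M.Δ A ≫ (M.e A ▷ M.obj A) ≫ (λ_ _).hom = 𝟙 (M.obj A)
  Δ_right_counit : ∀ A : C, M.Δ A ≫ (M.obj A ◁ M.e A) ≫ (ρ_ _).hom = 𝟙 (M.obj A)
  Δ_cocomm : ∀ A : C, M.Δ A ≫ (β_ (M.obj A) (M.obj A)).hom = M.Δ A
  δ_Δ : ∀ A : C, M.δ A ≫ M.Δ (M.obj A) = M.Δ A ≫ (M.δ A ⊗ₘ M.δ A)

/-- The underlying comonad of a coalgebra modality, as a Mathlib `Comonad`. -/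
def CoalgebraModalityData.IsCoalgebraModality.toComonad {C : Type u} [Category.{v} C]
    [MonoidalCategory C] [SymmetricCategory C] {M : CoalgebraModalityData C}
    (h : M.IsCoalgebraModality) : Comonad C where
  obj := M.obj
  map := M.map
  map_id := h.map_id
  map_comp := h.map_comp
  δ := { app := M.δ, naturality := fun _ _ f => h.δ_natural f }
  ε := { app := M.ε, naturality := fun _ _ f => h.ε_natural f }
  coassoc A := (h.coassoc A).symm
  left_counit := h.left_counit
  right_counit := h.right_counit

/-- `(!, δ, ε, Δ, e, ∇, u)` is a bialgebra modality. -/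
structure BialgebraModalityData.IsBialgebraModality {C : Type u} [Category.{v} C]
    [MonoidalCategory C] [SymmetricCategory C] [AdditiveCategory C]
    (M : BialgebraModalityData C) : Prop
    extends M.toCoalgebraModalityData.IsCoalgebraModality where
  mul_natural : ∀ {A B : C} (f : A ⟶ B), (M.map f ⊗ₘ M.map f) ≫ M.mul B = M.mul A ≫ M.map f
  u_natural : ∀ {A B : C} (f : A ⟶ B), M.u A ≫ M.map f = M.u B
  mul_assoc : ∀ A : C,
    (M.mul A ▷ M.obj A) ≫ M.mul A = (α_ _ _ _).hom ≫ (M.obj A ◁ M.mul A) ≫ M.mul A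
  u_mul : ∀ A : C, (M.u A ▷ M.obj A) ≫ M.mul A = (λ_ (M.obj A)).hom
  mul_u : ∀ A : C, (M.obj A ◁ M.u A) ≫ M.mul A = (ρ_ (M.obj A)).hom
  mul_comm : ∀ A : C, (β_ (M.obj A) (M.obj A)).hom ≫ M.mul A = M.mul A
  mul_e : ∀ A : C, M.mul A ≫ M.e A = (M.e A ⊗ₘ M.e A) ≫ (λ_ (𝟙_ C)).hom
  u_Δ : ∀ A : C, M.u A ≫ M.Δ A = (λ_ (𝟙_ C)).inv ≫ (M.u A ⊗ₘ M.u A)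
  u_e : ∀ A : C, M.u A ≫ M.e A = 𝟙 (𝟙_ C)
  mul_Δ : ∀ A : C, M.mul A ≫ M.Δ A =
    (M.Δ A ⊗ₘ M.Δ A) ≫ tensorμ (M.obj A) (M.obj A) (M.obj A) (M.obj A) ≫ (M.mul A ⊗ₘ M.mul A)
  mul_ε : ∀ A : C, M.mul A ≫ M.ε A =
    (M.ε A ⊗ₘ M.e A) ≫ (ρ_ A).hom + (M.e A ⊗ₘ M.ε A) ≫ (λ_ A).hom

/-- A bialgebra modality is additive when addition of maps is turned into convolution. -/
structure BialgebraModalityData.IsAdditiveBialgebraModality {C : Type u} [Category.{v} C]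
    [MonoidalCategory C] [SymmetricCategory C] [AdditiveCategory C]
    (M : BialgebraModalityData C) : Prop extends M.IsBialgebraModality where
  map_add : ∀ {A B : C} (f g : A ⟶ B),
    M.map (f + g) = M.Δ A ≫ (M.map f ⊗ₘ M.map g) ≫ M.mul B
  map_zero : ∀ A B : C, M.map (0 : A ⟶ B) = M.e A ≫ M.u B

/-- The Seely comparison map `χ : !(A × B) ⟶ !A ⊗ !B` of a product cone `c`. -/
def CoalgebraModalityData.seely {C : Type u} [Category.{v} C] [MonoidalCategory C]
    (M : CoalgebraModalityData C) {A B : C} (c : Limits.BinaryFan A B) :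
    M.obj c.pt ⟶ M.obj A ⊗ M.obj B :=
  M.Δ c.pt ≫ (M.map c.fst ⊗ₘ M.map c.snd)

/-- The Seely maps `!(A × B) ⟶ !A ⊗ !B` and `e : !T ⟶ K` are isomorphisms, for every binary
product `A × B` and every terminal object `T`. -/
structure CoalgebraModalityData.HasSeelyIsos {C : Type u} [Category.{v} C] [MonoidalCategory C]
    (M : CoalgebraModalityData C) : Prop where
  prod : ∀ {A B : C} (c : Limits.BinaryFan A B), Nonempty (Limits.IsLimit c) → IsIso (M.seely c)
  terminal : ∀ T : C, Nonempty (Limits.IsTerminal T) → IsIso (M.e T)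

/-- `C`, which is additive symmetric monoidal, is with `M` an additive monoidal storage category:
it has finite products and `M` is a coalgebra modality with Seely isomorphisms. -/
structure CoalgebraModalityData.IsAdditiveMonoidalStorage {C : Type u} [Category.{v} C]
    [MonoidalCategory C] [SymmetricCategory C] [AdditiveCategory C] [AdditiveMonoidal C]
    (M : CoalgebraModalityData C) : Prop where
  hasFiniteProducts : Limits.HasFiniteProducts C
  isCoalgebraModality : M.IsCoalgebraModality
  hasSeelyIsos : M.HasSeelyIsos

/-! ### Deriving transformations and coderelictions -/

/-- `d : !A ⊗ A ⟶ !A` is a deriving transformation.  A differential category is an additive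
symmetric monoidal category with a coalgebra modality and a deriving transformation. -/
structure CoalgebraModalityData.IsDerivingTransformation {C : Type u} [Category.{v} C]
    [MonoidalCategory C] [SymmetricCategory C] [AdditiveCategory C]
    (M : CoalgebraModalityData C) (d : ∀ A : C, M.obj A ⊗ A ⟶ M.obj A) : Prop where
  natural : ∀ {A B : C} (f : A ⟶ B), (M.map f ⊗ₘ f) ≫ d B = d A ≫ M.map f
  constant : ∀ A : C, d A ≫ M.e A = 0
  leibniz : ∀ A : C, d A ≫ M.Δ A =
    (M.Δ A ▷ A) ≫ (α_ _ _ _).hom ≫ (M.obj A ◁ d A) +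
      (M.Δ A ▷ A) ≫ (α_ _ _ _).hom ≫ (M.obj A ◁ (β_ (M.obj A) A).hom) ≫ (α_ _ _ _).inv ≫
        (d A ▷ M.obj A)
  linear : ∀ A : C, d A ≫ M.ε A = (M.e A ▷ A) ≫ (λ_ A).hom
  chain : ∀ A : C, d A ≫ M.δ A =
    (M.Δ A ▷ A) ≫ (α_ _ _ _).hom ≫ (M.δ A ⊗ₘ d A) ≫ d (M.obj A)
  interchange : ∀ A : C, (d A ▷ A) ≫ d A =
    (α_ _ _ _).hom ≫ (M.obj A ◁ (β_ A A).hom) ≫ (α_ _ _ _).inv ≫ (d A ▷ A) ≫ d A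

/-- `η : A ⟶ !A` is a codereliction. -/
structure BialgebraModalityData.IsCodereliction {C : Type u} [Category.{v} C]
    [MonoidalCategory C] [AdditiveCategory C]
    (M : BialgebraModalityData C) (η : ∀ A : C, A ⟶ M.obj A) : Prop where
  natural : ∀ {A B : C} (f : A ⟶ B), f ≫ η B = η A ≫ M.map f
  constant : ∀ A : C, η A ≫ M.e A = 0
  product : ∀ A : C, η A ≫ M.Δ A =
    (ρ_ A).inv ≫ (η A ⊗ₘ M.u A) + (λ_ A).inv ≫ (M.u A ⊗ₘ η A)
  linear : ∀ A : C, η A ≫ M.ε A = 𝟙 A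
  chain : ∀ A : C, (M.obj A ◁ η A) ≫ M.mul A ≫ M.δ A =
    (M.Δ A ⊗ₘ η A) ≫ (α_ _ _ _).hom ≫ (M.obj A ◁ M.mul A) ≫
      (M.δ A ⊗ₘ η (M.obj A)) ≫ M.mul (M.obj A)

/-- The transformation `d = (1 ⊗ η) ∇` associated with `η`. -/
def BialgebraModalityData.derivingOf {C : Type u} [Category.{v} C] [MonoidalCategory C]
    (M : BialgebraModalityData C) (η : ∀ A : C, A ⟶ M.obj A) (A : C) :
    M.obj A ⊗ A ⟶ M.obj A :=
  (M.obj A ◁ η A) ≫ M.mul A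

/-- The transformation `η = (u ⊗ 1) d` associated with `d`. -/
def BialgebraModalityData.coderelictionOf {C : Type u} [Category.{v} C] [MonoidalCategory C]
    (M : BialgebraModalityData C) (d : ∀ A : C, M.obj A ⊗ A ⟶ M.obj A) (A : C) :
    A ⟶ M.obj A :=
  (λ_ A).inv ≫ (M.u A ▷ A) ≫ d A

/-! ### The biproduct completion -/

/-- Objects of the biproduct completion: finite lists `(A₁, …, Aₙ)`, including the empty one. -/
structure BiprodCompletion (C : Type u) where
  len : ℕ
  fam : Fin len → C

namespace BiprodCompletion

/-- Maps of the biproduct completion: matrices of maps. -/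
@[ext]
structure Hom {C : Type u} [Category.{v} C] (A B : BiprodCompletion C) : Type v where
  entry : ∀ (i : Fin A.len) (j : Fin B.len), A.fam i ⟶ B.fam j

section Category

variable {C : Type u} [Category.{v} C] [AdditiveCategory C]

/-- The entries of the identity matrix of a family. -/
def delta {I : Type} [DecidableEq I] (F : I → C) (i j : I) : F i ⟶ F j :=
  if h : i = j then eqToHom (congrArg F h) else 0

theorem delta_self {I : Type} [DecidableEq I] (F : I → C) (i : I) : delta F i i = 𝟙 (F i) := by
  simp [delta]

theorem delta_ne {I : Type} [DecidableEq I] (F : I → C) {i j : I} (h : i ≠ j) :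
    delta F i j = 0 := by
  simp [delta, h]

theorem sum_comp' {ι : Type} [Fintype ι] {A B D : C} (f : ι → (A ⟶ B)) (g : B ⟶ D) :
    (∑ i, f i) ≫ g = ∑ i, f i ≫ g :=
  map_sum (⟨⟨fun f => f ≫ g, AdditiveCategory.zero_comp g⟩,
    fun a b => AdditiveCategory.add_comp a b g⟩ : (A ⟶ B) →+ (A ⟶ D)) f Finset.univ

theorem comp_sum' {ι : Type} [Fintype ι] {A B D : C} (f : A ⟶ B) (g : ι → (B ⟶ D)) :
    f ≫ (∑ i, g i) = ∑ i, f ≫ g i :=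
  map_sum (⟨⟨fun g => f ≫ g, AdditiveCategory.comp_zero f⟩,
    fun a b => AdditiveCategory.comp_add f a b⟩ : (B ⟶ D) →+ (A ⟶ D)) g Finset.univ

theorem delta_comp_equiv {I J : Type} [DecidableEq I] [DecidableEq J] (e : J ≃ I) (F : I → C)
    (x y : J) : delta (fun x => F (e x)) x y = delta F (e x) (e y) := by
  by_cases h : x = y
  · subst h; simp [delta_self]
  · rw [delta_ne _ h, delta_ne _ (fun h' => h (e.injective h'))]

/-- Multiplication by an identity matrix, for rows indexed through a bijection `e`. -/
theorem sum_delta_comp {I J : Type} [DecidableEq I] [Fintype J] (e : J ≃ I) (F : I → C) {T : C}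
    (G : ∀ i, F i ⟶ T) (i : I) : ∑ q, delta F i (e q) ≫ G (e q) = G i := by
  rw [Finset.sum_eq_single (e.symm i)]
  · rw [e.apply_symm_apply, delta_self, Category.id_comp]
  · intro q _ h
    rw [delta_ne F (fun h' => h (by simp [h'])), AdditiveCategory.zero_comp]
  · simp

theorem sum_comp_delta {I : Type} [DecidableEq I] [Fintype I] {F : I → C} {T : C}
    (G : ∀ j, T ⟶ F j) (i : I) : ∑ j, G j ≫ delta F j i = G i := by
  rw [Finset.sum_eq_single i]
  · simp [delta_self]
  · intro j _ h
    rw [delta_ne F h, AdditiveCategory.comp_zero]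
  · simp

instance : Category.{v} (BiprodCompletion C) where
  Hom := Hom
  id A := ⟨delta A.fam⟩
  comp {_ B _} f g := ⟨fun i k => ∑ j : Fin B.len, f.entry i j ≫ g.entry j k⟩
  id_comp {A _} f := by
    ext i j
    exact sum_delta_comp (Equiv.refl _) A.fam (fun k => f.entry k j) i
  comp_id f := by
    ext i j
    exact sum_comp_delta (fun k => f.entry i k) j
  assoc f g h := by
    ext i j
    simp only [sum_comp', comp_sum', Category.assoc]
    exact Finset.sum_comm

theorem hom_ext {A B : BiprodCompletion C} {f g : A ⟶ B}
    (h : ∀ i j, Hom.entry f i j = Hom.entry g i j) : f = g :=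
  Hom.ext (funext fun i => funext fun j => h i j)

theorem id_entry (A : BiprodCompletion C) (i j : Fin A.len) :
    Hom.entry (𝟙 A) i j = delta A.fam i j := rfl

theorem comp_entry {A B D : BiprodCompletion C} (f : A ⟶ B) (g : B ⟶ D)
    (i : Fin A.len) (k : Fin D.len) :
    Hom.entry (f ≫ g) i k = ∑ j, Hom.entry f i j ≫ Hom.entry g j k := rfl

/-- Matrices are added entrywise. -/
instance homMonoid (A B : BiprodCompletion C) : AddCommMonoid (A ⟶ B) where
  add f g := Hom.mk fun i j => Hom.entry f i j + Hom.entry g i j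
  zero := Hom.mk fun _ _ => 0
  add_assoc _ _ _ := hom_ext fun _ _ => add_assoc _ _ _
  zero_add _ := hom_ext fun _ _ => zero_add _
  add_zero _ := hom_ext fun _ _ => add_zero _
  add_comm _ _ := hom_ext fun _ _ => add_comm _ _
  nsmul n f := Hom.mk fun i j => n • Hom.entry f i j
  nsmul_zero _ := hom_ext fun _ _ => zero_nsmul _
  nsmul_succ _ _ := hom_ext fun _ _ => succ_nsmul _ _

theorem add_entry {A B : BiprodCompletion C} (f g : A ⟶ B) (i : Fin A.len) (j : Fin B.len) :
    Hom.entry (f + g) i j = Hom.entry f i j + Hom.entry g i j := rfl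

theorem zero_entry {A B : BiprodCompletion C} (i : Fin A.len) (j : Fin B.len) :
    Hom.entry (0 : A ⟶ B) i j = 0 := rfl

instance : AdditiveCategory (BiprodCompletion C) where
  homAddCommMonoid := homMonoid
  add_comp f g h := hom_ext fun i j => by
    simp only [comp_entry, add_entry, AdditiveCategory.add_comp, Finset.sum_add_distrib]
  comp_add f g h := hom_ext fun i j => by
    simp only [comp_entry, add_entry, AdditiveCategory.comp_add, Finset.sum_add_distrib]
  zero_comp h := hom_ext fun i j => by
    simp only [comp_entry, zero_entry, AdditiveCategory.zero_comp, Finset.sum_const_zero]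
  comp_zero h := hom_ext fun i j => by
    simp only [comp_entry, zero_entry, AdditiveCategory.comp_zero, Finset.sum_const_zero]

/-- The empty list. -/
def empty (C : Type u) : BiprodCompletion C := ⟨0, Fin.elim0⟩

/-- The list `(A)` of length one. -/
def single {C : Type u} (A : C) : BiprodCompletion C := ⟨1, fun _ => A⟩

/-- The `1 × 1` matrix of a map. -/
def singleMap {A B : C} (f : A ⟶ B) : single A ⟶ single B := Hom.mk fun _ _ => f

/-- Concatenation of lists, as a bicone: the projections and injections are the blocks of the
identity matrix. -/
def concat (A B : BiprodCompletion C) : Limits.BinaryBicone A B where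
  pt := ⟨A.len + B.len, Fin.append A.fam B.fam⟩
  fst := Hom.mk fun p j =>
    if h : p = Fin.castAdd B.len j then eqToHom (by subst h; exact Fin.append_left _ _ _) else 0
  snd := Hom.mk fun p j =>
    if h : p = Fin.natAdd A.len j then eqToHom (by subst h; exact Fin.append_right _ _ _) else 0
  inl := Hom.mk fun i p =>
    if h : p = Fin.castAdd B.len i then eqToHom (by subst h; exact (Fin.append_left _ _ _).symm)
    else 0
  inr := Hom.mk fun i p =>
    if h : p = Fin.natAdd A.len i then eqToHom (by subst h; exact (Fin.append_right _ _ _).symm)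
    else 0
  inl_fst := hom_ext fun i j => by
    rw [comp_entry, Finset.sum_eq_single (Fin.castAdd B.len i)]
    · by_cases h : i = j
      · subst h; simp [id_entry, delta_self]
      · simp [id_entry, delta_ne _ h, h]
    · intro p _ h
      refine (congrArg (· ≫ _) (dif_neg h)).trans (AdditiveCategory.zero_comp _)
    · simp
  inl_snd := hom_ext fun i j => by
    refine (comp_entry _ _ i j).trans (Finset.sum_eq_zero fun p _ => ?_)
    by_cases h : p = Fin.castAdd B.len i
    · have h' : p ≠ Fin.natAdd A.len j := fun h' => by
        have := congrArg Fin.val (h.symm.trans h')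
        simp at this
        omega
      exact (congrArg (_ ≫ ·) (dif_neg h')).trans (AdditiveCategory.comp_zero _)
    · exact (congrArg (· ≫ _) (dif_neg h)).trans (AdditiveCategory.zero_comp _)
  inr_fst := hom_ext fun i j => by
    refine (comp_entry _ _ i j).trans (Finset.sum_eq_zero fun p _ => ?_)
    by_cases h : p = Fin.natAdd A.len i
    · have h' : p ≠ Fin.castAdd B.len j := fun h' => by
        have := congrArg Fin.val (h.symm.trans h')
        simp at this
        omega
      exact (congrArg (_ ≫ ·) (dif_neg h')).trans (AdditiveCategory.comp_zero _)
    · exact (congrArg (· ≫ _) (dif_neg h)).trans (AdditiveCategory.zero_comp _)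
  inr_snd := hom_ext fun i j => by
    rw [comp_entry, Finset.sum_eq_single (Fin.natAdd A.len i)]
    · by_cases h : i = j
      · subst h; simp [id_entry, delta_self]
      · simp [id_entry, delta_ne _ h, h]
    · intro p _ h
      refine (congrArg (· ≫ _) (dif_neg h)).trans (AdditiveCategory.zero_comp _)
    · simp

theorem sum_unitL {n : ℕ} {A B : C} (f : Fin n → (A ⟶ B)) :
    ∑ q : Fin (1 * n), f q.modNat = ∑ j, f j := by
  have := finProdFinEquiv.symm.sum_comp (fun x : Fin 1 × Fin n => f x.2)
  rw [Fintype.sum_prod_type] at this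
  simpa using this

theorem sum_unitR {n : ℕ} {A B : C} (f : Fin n → (A ⟶ B)) :
    ∑ q : Fin (n * 1), f q.divNat = ∑ j, f j := by
  have := finProdFinEquiv.symm.sum_comp (fun x : Fin n × Fin 1 => f x.1)
  rw [Fintype.sum_prod_type] at this
  simpa using this

end Category

section Monoidal

variable {C : Type u} [Category.{v} C] [MonoidalCategory C] [AdditiveCategory C]
  [AdditiveMonoidal C]

theorem tensor_zero' {A B D E : C} (f : A ⟶ B) : f ⊗ₘ (0 : D ⟶ E) = 0 := by
  rw [MonoidalCategory.tensorHom_def, AdditiveMonoidal.whiskerLeft_zero, AdditiveCategory.comp_zero]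

theorem zero_tensor' {A B D E : C} (f : A ⟶ B) : (0 : D ⟶ E) ⊗ₘ f = 0 := by
  rw [MonoidalCategory.tensorHom_def, AdditiveMonoidal.zero_whiskerRight, AdditiveCategory.zero_comp]

theorem tensor_add' {A B D E : C} (f : A ⟶ B) (g h : D ⟶ E) :
    f ⊗ₘ (g + h) = f ⊗ₘ g + f ⊗ₘ h := by
  simp only [MonoidalCategory.tensorHom_def, AdditiveMonoidal.whiskerLeft_add, AdditiveCategory.comp_add]

theorem add_tensor' {A B D E : C} (f g : A ⟶ B) (h : D ⟶ E) :
    (f + g) ⊗ₘ h = f ⊗ₘ h + g ⊗ₘ h := by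
  simp only [MonoidalCategory.tensorHom_def, AdditiveMonoidal.add_whiskerRight, AdditiveCategory.add_comp]

theorem sum_tensor_sum {n m : ℕ} {A B D E : C} (f : Fin n → (A ⟶ B)) (g : Fin m → (D ⟶ E)) :
    ∑ q : Fin (n * m), (f q.divNat ⊗ₘ g q.modNat) = (∑ i, f i) ⊗ₘ (∑ j, g j) := by
  have h1 : ∀ i, f i ⊗ₘ (∑ j, g j) = ∑ j, (f i ⊗ₘ g j) := fun i =>
    map_sum (⟨⟨fun x => f i ⊗ₘ x, tensor_zero' _⟩, fun a b => tensor_add' _ a b⟩ :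
      (D ⟶ E) →+ (A ⊗ D ⟶ B ⊗ E)) g Finset.univ
  have h2 : (∑ i, f i) ⊗ₘ (∑ j, g j) = ∑ i, (f i ⊗ₘ (∑ j, g j)) :=
    map_sum (⟨⟨fun x => x ⊗ₘ (∑ j, g j), zero_tensor' _⟩, fun a b => add_tensor' a b _⟩ :
      (A ⟶ B) →+ (A ⊗ D ⟶ B ⊗ E)) f Finset.univ
  rw [h2]
  simp only [h1]
  rw [← Fintype.sum_prod_type' (f := fun i j => f i ⊗ₘ g j)]
  exact finProdFinEquiv.symm.sum_comp (fun x : Fin n × Fin m => f x.1 ⊗ₘ g x.2)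

theorem delta_prod {I J : Type} [DecidableEq I] [DecidableEq J] (F : I → C) (G : J → C)
    (x y : I × J) :
    delta (fun x : I × J => F x.1 ⊗ G x.2) x y = delta F x.1 y.1 ⊗ₘ delta G x.2 y.2 := by
  obtain ⟨i, j⟩ := x
  obtain ⟨i', j'⟩ := y
  by_cases h : i = i'
  · subst h
    by_cases h' : j = j'
    · subst h'; simp [delta_self]
    · rw [delta_ne G h', tensor_zero', delta_ne _ (by simpa using h')]
  · rw [delta_ne F h, zero_tensor', delta_ne _ (by simp [h])]

/-- `(A₁, …, Aₙ) ⊗ (B₁, …, Bₘ) = (A₁ ⊗ B₁, …, A₁ ⊗ Bₘ, …, Aₙ ⊗ Bₘ)` in row-major order. -/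
abbrev tensor (A B : BiprodCompletion C) : BiprodCompletion C :=
  ⟨A.len * B.len, fun p => A.fam p.divNat ⊗ B.fam p.modNat⟩

/-- The Kronecker product of matrices. -/
def kronecker {A A' B B' : BiprodCompletion C} (f : A ⟶ A') (g : B ⟶ B') :
    tensor A B ⟶ tensor A' B' :=
  Hom.mk fun p q => Hom.entry f p.divNat q.divNat ⊗ₘ Hom.entry g p.modNat q.modNat

theorem delta_tensor (A B : BiprodCompletion C) (p q : Fin (A.len * B.len)) :
    delta (tensor A B).fam p q =
      delta A.fam p.divNat q.divNat ⊗ₘ delta B.fam p.modNat q.modNat :=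
  (delta_comp_equiv finProdFinEquiv.symm
    (fun x : Fin A.len × Fin B.len => A.fam x.1 ⊗ B.fam x.2) p q).trans (delta_prod _ _ _ _)

theorem kronecker_id (A B : BiprodCompletion C) : kronecker (𝟙 A) (𝟙 B) = 𝟙 (tensor A B) :=
  hom_ext fun p q => (delta_tensor A B p q).symm

theorem kronecker_comp {A A' A'' B B' B'' : BiprodCompletion C} (f : A ⟶ A') (f' : A' ⟶ A'')
    (g : B ⟶ B') (g' : B' ⟶ B'') :
    kronecker f g ≫ kronecker f' g' = kronecker (f ≫ f') (g ≫ g') :=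
  hom_ext fun p r => by
    refine Eq.trans ?_ (sum_tensor_sum
      (fun q => Hom.entry f p.divNat q ≫ Hom.entry f' q r.divNat)
      (fun q => Hom.entry g p.modNat q ≫ Hom.entry g' q r.modNat))
    refine (comp_entry _ _ p r).trans (Finset.sum_congr rfl fun q _ => ?_)
    exact tensorHom_comp_tensorHom
      (Hom.entry f p.divNat q.divNat) (Hom.entry g p.modNat q.modNat)
      (Hom.entry f' q.divNat r.divNat) (Hom.entry g' q.modNat r.modNat)

/-- The associator of the completion: the associators of `C` along the bijection of indices. -/
def assocHom (A B D : BiprodCompletion C) : tensor (tensor A B) D ⟶ tensor A (tensor B D) :=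
  Hom.mk fun p q => (α_ _ _ _).hom ≫
    (delta A.fam p.divNat.divNat q.divNat ⊗ₘ
      (delta B.fam p.divNat.modNat q.modNat.divNat ⊗ₘ delta D.fam p.modNat q.modNat.modNat))

def assocInv (A B D : BiprodCompletion C) : tensor A (tensor B D) ⟶ tensor (tensor A B) D :=
  Hom.mk fun p q => (α_ _ _ _).inv ≫
    ((delta A.fam p.divNat q.divNat.divNat ⊗ₘ
      delta B.fam p.modNat.divNat q.divNat.modNat) ⊗ₘ delta D.fam p.modNat.modNat q.modNat)

abbrev unitObj (C : Type u) [Category.{v} C] [MonoidalCategory C] : BiprodCompletion C :=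
  ⟨1, fun _ => 𝟙_ C⟩

def leftUnitHom (A : BiprodCompletion C) : tensor (unitObj C) A ⟶ A :=
  Hom.mk fun p j => (λ_ _).hom ≫ delta A.fam p.modNat j

def leftUnitInv (A : BiprodCompletion C) : A ⟶ tensor (unitObj C) A :=
  Hom.mk fun i q => (λ_ _).inv ≫ (𝟙 (𝟙_ C) ⊗ₘ delta A.fam i q.modNat)

def rightUnitHom (A : BiprodCompletion C) : tensor A (unitObj C) ⟶ A :=
  Hom.mk fun p j => (ρ_ _).hom ≫ delta A.fam p.divNat j

def rightUnitInv (A : BiprodCompletion C) : A ⟶ tensor A (unitObj C) :=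
  Hom.mk fun i q => (ρ_ _).inv ≫ (delta A.fam i q.divNat ⊗ₘ 𝟙 (𝟙_ C))

/-- The symmetry of the completion. -/
def braidHom [BraidedCategory C] (A B : BiprodCompletion C) : tensor A B ⟶ tensor B A :=
  Hom.mk fun p q => (β_ _ _).hom ≫
    (delta B.fam p.modNat q.divNat ⊗ₘ delta A.fam p.divNat q.modNat)

/-- Indices of `A ⊗ (B ⊗ D)` as triples. -/
def keyR (l m n : ℕ) : Fin (l * (m * n)) ≃ Fin l × (Fin m × Fin n) :=
  finProdFinEquiv.symm.trans ((Equiv.refl _).prodCongr finProdFinEquiv.symm)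

/-- Indices of `(A ⊗ B) ⊗ D` as triples. -/
def keyL (l m n : ℕ) : Fin ((l * m) * n) ≃ (Fin l × Fin m) × Fin n :=
  finProdFinEquiv.symm.trans (finProdFinEquiv.symm.prodCongr (Equiv.refl _))

/-- Collapse of a sum over the indices of `A ⊗ B`. -/
theorem sum2 {l m : ℕ} (F : Fin l → C) (G : Fin m → C) {T : C}
    (H : ∀ i j, F i ⊗ G j ⟶ T) (i : Fin l) (j : Fin m) :
    ∑ q : Fin (l * m), (delta F i q.divNat ⊗ₘ delta G j q.modNat) ≫ H q.divNat q.modNat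
      = H i j := by
  have := sum_delta_comp (finProdFinEquiv (m := l) (n := m)).symm
    (fun x : Fin l × Fin m => F x.1 ⊗ G x.2) (fun x => H x.1 x.2) (i, j)
  simp only [delta_prod] at this
  exact this

/-- Collapse of a sum over the indices of `A ⊗ (B ⊗ D)`. -/
theorem sum3R {l m n : ℕ} (F : Fin l → C) (G : Fin m → C) (K : Fin n → C) {T : C}
    (H : ∀ i j k, F i ⊗ (G j ⊗ K k) ⟶ T) (i : Fin l) (j : Fin m) (k : Fin n) :
    ∑ q : Fin (l * (m * n)), (delta F i q.divNat ⊗ₘ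
      (delta G j q.modNat.divNat ⊗ₘ delta K k q.modNat.modNat)) ≫
        H q.divNat q.modNat.divNat q.modNat.modNat = H i j k := by
  have := sum_delta_comp (keyR l m n) (fun x : Fin l × (Fin m × Fin n) => F x.1 ⊗ (G x.2.1 ⊗ K x.2.2))
    (fun x => H x.1 x.2.1 x.2.2) (i, (j, k))
  simp only [delta_prod F (fun y : Fin m × Fin n => G y.1 ⊗ K y.2), delta_prod G K] at this
  exact this

/-- Collapse of a sum over the indices of `(A ⊗ B) ⊗ D`. -/
theorem sum3L {l m n : ℕ} (F : Fin l → C) (G : Fin m → C) (K : Fin n → C) {T : C}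
    (H : ∀ i j k, (F i ⊗ G j) ⊗ K k ⟶ T) (i : Fin l) (j : Fin m) (k : Fin n) :
    ∑ q : Fin ((l * m) * n), ((delta F i q.divNat.divNat ⊗ₘ delta G j q.divNat.modNat) ⊗ₘ
      delta K k q.modNat) ≫ H q.divNat.divNat q.divNat.modNat q.modNat = H i j k := by
  have := sum_delta_comp (keyL l m n) (fun x : (Fin l × Fin m) × Fin n => (F x.1.1 ⊗ G x.1.2) ⊗ K x.2)
    (fun x => H x.1.1 x.1.2 x.2) ((i, j), k)
  simp only [delta_prod (fun y : Fin l × Fin m => F y.1 ⊗ G y.2) K, delta_prod F G] at this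
  exact this

theorem assocHom_comp_entry (A B D : BiprodCompletion C) {E : BiprodCompletion C}
    (F : tensor A (tensor B D) ⟶ E) (r : Fin E.len)
    (H : ∀ i j k, A.fam i ⊗ (B.fam j ⊗ D.fam k) ⟶ E.fam r)
    (hF : ∀ q : Fin (A.len * (B.len * D.len)),
      Hom.entry F q r = H q.divNat q.modNat.divNat q.modNat.modNat)
    (p : Fin ((A.len * B.len) * D.len)) :
    Hom.entry (assocHom A B D ≫ F) p r =
      (α_ _ _ _).hom ≫ H p.divNat.divNat p.divNat.modNat p.modNat := by
  refine Eq.trans ?_ (congrArg (fun t => (α_ _ _ _).hom ≫ t)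
    (sum3R A.fam B.fam D.fam H p.divNat.divNat p.divNat.modNat p.modNat))
  refine Eq.trans ?_ (comp_sum' _ _).symm
  refine (comp_entry _ _ _ _).trans (Finset.sum_congr rfl fun q _ => ?_)
  refine (congrArg (_ ≫ ·) (hF q)).trans (Category.assoc _ _ _)

theorem assocInv_comp_entry (A B D : BiprodCompletion C) {E : BiprodCompletion C}
    (F : tensor (tensor A B) D ⟶ E) (r : Fin E.len)
    (H : ∀ i j k, (A.fam i ⊗ B.fam j) ⊗ D.fam k ⟶ E.fam r)
    (hF : ∀ q : Fin ((A.len * B.len) * D.len),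
      Hom.entry F q r = H q.divNat.divNat q.divNat.modNat q.modNat)
    (p : Fin (A.len * (B.len * D.len))) :
    Hom.entry (assocInv A B D ≫ F) p r =
      (α_ _ _ _).inv ≫ H p.divNat p.modNat.divNat p.modNat.modNat := by
  refine Eq.trans ?_ (congrArg (fun t => (α_ _ _ _).inv ≫ t)
    (sum3L A.fam B.fam D.fam H p.divNat p.modNat.divNat p.modNat.modNat))
  refine Eq.trans ?_ (comp_sum' _ _).symm
  refine (comp_entry _ _ _ _).trans (Finset.sum_congr rfl fun q _ => ?_)
  refine (congrArg (_ ≫ ·) (hF q)).trans (Category.assoc _ _ _)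

theorem delta_tensorL (A B D : BiprodCompletion C) (p q : Fin ((A.len * B.len) * D.len)) :
    delta (tensor (tensor A B) D).fam p q =
      (delta A.fam p.divNat.divNat q.divNat.divNat ⊗ₘ
        delta B.fam p.divNat.modNat q.divNat.modNat) ⊗ₘ delta D.fam p.modNat q.modNat :=
  (delta_tensor (tensor A B) D p q).trans
    (congrArg (· ⊗ₘ _) (delta_tensor A B p.divNat q.divNat))

theorem delta_tensorR (A B D : BiprodCompletion C) (p q : Fin (A.len * (B.len * D.len))) :
    delta (tensor A (tensor B D)).fam p q =
      delta A.fam p.divNat q.divNat ⊗ₘ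
        (delta B.fam p.modNat.divNat q.modNat.divNat ⊗ₘ
          delta D.fam p.modNat.modNat q.modNat.modNat) :=
  (delta_tensor A (tensor B D) p q).trans
    (congrArg (_ ⊗ₘ ·) (delta_tensor B D p.modNat q.modNat))

theorem assocHom_assocInv (A B D : BiprodCompletion C) :
    assocHom A B D ≫ assocInv A B D = 𝟙 (tensor (tensor A B) D) :=
  hom_ext fun p r => by
    refine (assocHom_comp_entry A B D (assocInv A B D) r (fun i j k => (α_ _ _ _).inv ≫
      ((delta A.fam i r.divNat.divNat ⊗ₘ delta B.fam j r.divNat.modNat) ⊗ₘ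
        delta D.fam k r.modNat)) (fun q => rfl) p).trans ?_
    exact (Iso.hom_inv_id_assoc _ _).trans (delta_tensorL A B D p r).symm

theorem assocInv_assocHom (A B D : BiprodCompletion C) :
    assocInv A B D ≫ assocHom A B D = 𝟙 (tensor A (tensor B D)) :=
  hom_ext fun p r => by
    refine (assocInv_comp_entry A B D (assocHom A B D) r (fun i j k => (α_ _ _ _).hom ≫
      (delta A.fam i r.divNat ⊗ₘ (delta B.fam j r.modNat.divNat ⊗ₘ
        delta D.fam k r.modNat.modNat))) (fun q => rfl) p).trans ?_
    exact (Iso.inv_hom_id_assoc _ _).trans (delta_tensorR A B D p r).symm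

theorem assocHom_natural {A B D A' B' D' : BiprodCompletion C} (f : A ⟶ A') (g : B ⟶ B')
    (h : D ⟶ D') :
    kronecker (kronecker f g) h ≫ assocHom A' B' D' =
      assocHom A B D ≫ kronecker f (kronecker g h) :=
  hom_ext fun p r => by
    refine Eq.trans ?_ (assocHom_comp_entry A B D (kronecker f (kronecker g h)) r
      (fun i j k => Hom.entry f i r.divNat ⊗ₘ
        (Hom.entry g j r.modNat.divNat ⊗ₘ Hom.entry h k r.modNat.modNat)) (fun q => rfl) p).symm
    have h1 := sum_tensor_sum (n := A'.len * B'.len) (m := D'.len)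
      (fun q => (Hom.entry f p.divNat.divNat q.divNat ⊗ₘ Hom.entry g p.divNat.modNat q.modNat) ≫
        (delta A'.fam q.divNat r.divNat ⊗ₘ delta B'.fam q.modNat r.modNat.divNat))
      (fun q => Hom.entry h p.modNat q ≫ delta D'.fam q r.modNat.modNat)
    simp only [tensorHom_comp_tensorHom] at h1
    rw [sum_tensor_sum (fun q => Hom.entry f p.divNat.divNat q ≫ delta A'.fam q r.divNat)
      (fun q => Hom.entry g p.divNat.modNat q ≫ delta B'.fam q r.modNat.divNat)] at h1
    simp only [sum_comp_delta] at h1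
    rw [← associator_naturality, ← h1, sum_comp']
    refine (comp_entry _ _ _ _).trans (Finset.sum_congr rfl fun q _ => ?_)
    rw [← tensorHom_comp_tensorHom, ← tensorHom_comp_tensorHom, Category.assoc,
      associator_naturality]
    rfl

theorem delta_unit (p q : Fin 1) : delta (unitObj C).fam p q = 𝟙 (𝟙_ C) := by
  obtain rfl : p = q := Subsingleton.elim _ _
  exact delta_self _ _

theorem leftUnitHom_inv (A : BiprodCompletion C) :
    leftUnitHom A ≫ leftUnitInv A = 𝟙 (tensor (unitObj C) A) :=
  hom_ext fun p r => by
    have h := sum_delta_comp (Equiv.refl _) A.fam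
      (fun j => (λ_ _).inv ≫ (𝟙 (𝟙_ C) ⊗ₘ delta A.fam j r.modNat)) p.modNat
    have h' := congrArg (fun t => (λ_ _).hom ≫ t) h
    refine Eq.trans ?_ (h'.trans ?_)
    · refine Eq.trans ?_ (comp_sum' _ _).symm
      exact (comp_entry _ _ _ _).trans (Finset.sum_congr rfl fun q _ => Category.assoc _ _ _)
    · refine (Iso.hom_inv_id_assoc _ _).trans ((delta_tensor (unitObj C) A p r).trans ?_).symm
      exact congrArg (· ⊗ₘ _) (delta_unit _ _)

theorem leftUnitInv_hom (A : BiprodCompletion C) : leftUnitInv A ≫ leftUnitHom A = 𝟙 A :=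
  hom_ext fun i j => by
    refine Eq.trans ?_ ((sum_unitL fun q => delta A.fam i q ≫ delta A.fam q j).trans
      (sum_comp_delta (fun q => delta A.fam i q) j))
    refine (comp_entry _ _ _ _).trans (Finset.sum_congr rfl fun q _ => ?_)
    have : ((λ_ _).inv ≫ (𝟙 (𝟙_ C) ⊗ₘ delta A.fam i q.modNat)) ≫ (λ_ _).hom ≫
        delta A.fam q.modNat j = delta A.fam i q.modNat ≫ delta A.fam q.modNat j := by
      simp
    exact this

theorem rightUnitHom_inv (A : BiprodCompletion C) :
    rightUnitHom A ≫ rightUnitInv A = 𝟙 (tensor A (unitObj C)) :=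
  hom_ext fun p r => by
    have h := sum_delta_comp (Equiv.refl _) A.fam
      (fun j => (ρ_ _).inv ≫ (delta A.fam j r.divNat ⊗ₘ 𝟙 (𝟙_ C))) p.divNat
    have h' := congrArg (fun t => (ρ_ _).hom ≫ t) h
    refine Eq.trans ?_ (h'.trans ?_)
    · refine Eq.trans ?_ (comp_sum' _ _).symm
      exact (comp_entry _ _ _ _).trans (Finset.sum_congr rfl fun q _ => Category.assoc _ _ _)
    · refine (Iso.hom_inv_id_assoc _ _).trans ((delta_tensor A (unitObj C) p r).trans ?_).symm
      exact congrArg (_ ⊗ₘ ·) (delta_unit _ _)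

theorem rightUnitInv_hom (A : BiprodCompletion C) : rightUnitInv A ≫ rightUnitHom A = 𝟙 A :=
  hom_ext fun i j => by
    refine Eq.trans ?_ ((sum_unitR fun q => delta A.fam i q ≫ delta A.fam q j).trans
      (sum_comp_delta (fun q => delta A.fam i q) j))
    refine (comp_entry _ _ _ _).trans (Finset.sum_congr rfl fun q _ => ?_)
    have : ((ρ_ _).inv ≫ (delta A.fam i q.divNat ⊗ₘ 𝟙 (𝟙_ C))) ≫ (ρ_ _).hom ≫
        delta A.fam q.divNat j = delta A.fam i q.divNat ≫ delta A.fam q.divNat j := by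
      simp
    exact this

theorem leftUnitHom_natural {A B : BiprodCompletion C} (f : A ⟶ B) :
    kronecker (𝟙 (unitObj C)) f ≫ leftUnitHom B = leftUnitHom A ≫ f :=
  hom_ext fun p j => by
    have h1 : Hom.entry (leftUnitHom A ≫ f) p j = (λ_ _).hom ≫ Hom.entry f p.modNat j := by
      have h := congrArg (fun t => (λ_ _).hom ≫ t) (sum_delta_comp (Equiv.refl _) A.fam
        (fun k => Hom.entry f k j) p.modNat)
      refine Eq.trans ?_ h
      refine Eq.trans ?_ (comp_sum' _ _).symm
      exact (comp_entry _ _ _ _).trans (Finset.sum_congr rfl fun q _ => Category.assoc _ _ _)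
    refine Eq.trans ?_ h1.symm
    have h := congrArg (fun t => (λ_ _).hom ≫ t) ((sum_unitL fun q =>
      Hom.entry f p.modNat q ≫ delta B.fam q j).trans (sum_comp_delta (Hom.entry f p.modNat) j))
    refine Eq.trans ?_ h
    refine Eq.trans ?_ (comp_sum' _ _).symm
    refine (comp_entry _ _ _ _).trans (Finset.sum_congr rfl fun q _ => ?_)
    have : (𝟙 (𝟙_ C) ⊗ₘ Hom.entry f p.modNat q.modNat) ≫ (λ_ _).hom ≫
        delta B.fam q.modNat j = (λ_ _).hom ≫ Hom.entry f p.modNat q.modNat ≫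
          delta B.fam q.modNat j := by
      simp
    exact (congrArg (fun t => (t ⊗ₘ Hom.entry f p.modNat q.modNat) ≫ (λ_ _).hom ≫
        delta B.fam q.modNat j) (delta_unit p.divNat q.divNat)).trans this

theorem rightUnitHom_natural {A B : BiprodCompletion C} (f : A ⟶ B) :
    kronecker f (𝟙 (unitObj C)) ≫ rightUnitHom B = rightUnitHom A ≫ f :=
  hom_ext fun p j => by
    have h1 : Hom.entry (rightUnitHom A ≫ f) p j = (ρ_ _).hom ≫ Hom.entry f p.divNat j := by
      have h := congrArg (fun t => (ρ_ _).hom ≫ t) (sum_delta_comp (Equiv.refl _) A.fam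
        (fun k => Hom.entry f k j) p.divNat)
      refine Eq.trans ?_ h
      refine Eq.trans ?_ (comp_sum' _ _).symm
      exact (comp_entry _ _ _ _).trans (Finset.sum_congr rfl fun q _ => Category.assoc _ _ _)
    refine Eq.trans ?_ h1.symm
    have h := congrArg (fun t => (ρ_ _).hom ≫ t) ((sum_unitR fun q =>
      Hom.entry f p.divNat q ≫ delta B.fam q j).trans (sum_comp_delta (Hom.entry f p.divNat) j))
    refine Eq.trans ?_ h
    refine Eq.trans ?_ (comp_sum' _ _).symm
    refine (comp_entry _ _ _ _).trans (Finset.sum_congr rfl fun q _ => ?_)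
    have : (Hom.entry f p.divNat q.divNat ⊗ₘ 𝟙 (𝟙_ C)) ≫ (ρ_ _).hom ≫
        delta B.fam q.divNat j = (ρ_ _).hom ≫ Hom.entry f p.divNat q.divNat ≫
          delta B.fam q.divNat j := by
      simp
    exact (congrArg (fun t => (Hom.entry f p.divNat q.divNat ⊗ₘ t) ≫ (ρ_ _).hom ≫
        delta B.fam q.divNat j) (delta_unit p.modNat q.modNat)).trans this

/-- Indices of `(A ⊗ (B ⊗ D)) ⊗ E` as quadruples. -/
def key4 (k l m n : ℕ) : Fin ((k * (l * m)) * n) ≃ (Fin k × (Fin l × Fin m)) × Fin n :=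
  finProdFinEquiv.symm.trans ((keyR k l m).prodCongr (Equiv.refl _))

theorem sum4 {k l m n : ℕ} (F : Fin k → C) (G : Fin l → C) (K : Fin m → C) (L : Fin n → C)
    {T : C} (H : ∀ a b c d, (F a ⊗ (G b ⊗ K c)) ⊗ L d ⟶ T) (a : Fin k) (b : Fin l) (c : Fin m)
    (d : Fin n) :
    ∑ q : Fin ((k * (l * m)) * n), ((delta F a q.divNat.divNat ⊗ₘ
      (delta G b q.divNat.modNat.divNat ⊗ₘ delta K c q.divNat.modNat.modNat)) ⊗ₘ
        delta L d q.modNat) ≫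
        H q.divNat.divNat q.divNat.modNat.divNat q.divNat.modNat.modNat q.modNat = H a b c d := by
  have := sum_delta_comp (key4 k l m n)
    (fun x : (Fin k × (Fin l × Fin m)) × Fin n => (F x.1.1 ⊗ (G x.1.2.1 ⊗ K x.1.2.2)) ⊗ L x.2)
    (fun x => H x.1.1 x.1.2.1 x.1.2.2 x.2) ((a, (b, c)), d)
  simp only [delta_prod (fun y : Fin k × (Fin l × Fin m) => F y.1 ⊗ (G y.2.1 ⊗ K y.2.2)) L,
    delta_prod F (fun y : Fin l × Fin m => G y.1 ⊗ K y.2), delta_prod G K] at this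
  exact this

theorem tensor_comp_right {X Y Z W V : C} (f : X ⟶ Y) (g : Z ⟶ W) (h : W ⟶ V) :
    f ⊗ₘ (g ≫ h) = (X ◁ g) ≫ (f ⊗ₘ h) := by
  rw [← id_tensorHom, tensorHom_comp_tensorHom, Category.id_comp]

theorem pentagon' (A B D E : BiprodCompletion C) :
    kronecker (assocHom A B D) (𝟙 E) ≫ assocHom A (tensor B D) E ≫
        kronecker (𝟙 A) (assocHom B D E) =
      assocHom (tensor A B) D E ≫ assocHom A B (tensor D E) :=
  hom_ext fun p r => by
    refine Eq.trans ?_ (assocHom_comp_entry (tensor A B) D E (assocHom A B (tensor D E)) r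
      (fun i j k => (α_ _ _ _).hom ≫ (delta A.fam i.divNat r.divNat ⊗ₘ
        (delta B.fam i.modNat r.modNat.divNat ⊗ₘ (delta D.fam j r.modNat.modNat.divNat ⊗ₘ
          delta E.fam k r.modNat.modNat.modNat))))
      (fun q => congrArg (fun t => (α_ _ _ _).hom ≫ (_ ⊗ₘ (_ ⊗ₘ t)))
        (delta_tensor D E q.modNat r.modNat.modNat)) p).symm
    have h1 : ∀ q : Fin ((A.len * (B.len * D.len)) * E.len),
        Hom.entry (assocHom A (tensor B D) E ≫ kronecker (𝟙 A) (assocHom B D E)) q r =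
        (α_ _ _ _).hom ≫ (delta A.fam q.divNat.divNat r.divNat ⊗ₘ ((α_ _ _ _).hom ≫
          (delta B.fam q.divNat.modNat.divNat r.modNat.divNat ⊗ₘ
            (delta D.fam q.divNat.modNat.modNat r.modNat.modNat.divNat ⊗ₘ
              delta E.fam q.modNat r.modNat.modNat.modNat)))) := fun q =>
      assocHom_comp_entry A (tensor B D) E (kronecker (𝟙 A) (assocHom B D E)) r
        (fun i j k => delta A.fam i r.divNat ⊗ₘ ((α_ _ _ _).hom ≫
          (delta B.fam j.divNat r.modNat.divNat ⊗ₘ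
            (delta D.fam j.modNat r.modNat.modNat.divNat ⊗ₘ
              delta E.fam k r.modNat.modNat.modNat)))) (fun q => rfl) q
    have h2 := sum4 A.fam B.fam D.fam E.fam (fun a b c d =>
      (α_ _ _ _).hom ≫ (delta A.fam a r.divNat ⊗ₘ ((α_ _ _ _).hom ≫
          (delta B.fam b r.modNat.divNat ⊗ₘ
            (delta D.fam c r.modNat.modNat.divNat ⊗ₘ
              delta E.fam d r.modNat.modNat.modNat))))) p.divNat.divNat.divNat
                p.divNat.divNat.modNat p.divNat.modNat p.modNat
    have h3 := congrArg (fun t => ((α_ _ _ _).hom ⊗ₘ 𝟙 _) ≫ t) h2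
    refine Eq.trans ?_ (h3.trans ?_)
    · refine Eq.trans ?_ (comp_sum' _ _).symm
      refine (comp_entry _ _ _ _).trans (Finset.sum_congr rfl fun q _ => ?_)
      refine (congrArg (_ ≫ ·) (h1 q)).trans ?_
      refine Eq.trans ?_ (Category.assoc _ _ _)
      refine congrArg (· ≫ _) ?_
      refine Eq.trans ?_ (tensorHom_comp_tensorHom _ _ _ _).symm
      rw [Category.id_comp]
      rfl
    · rw [tensorHom_id, tensor_comp_right, MonoidalCategory.pentagon_assoc]

theorem triangle' (A B : BiprodCompletion C) :
    assocHom A (unitObj C) B ≫ kronecker (𝟙 A) (leftUnitHom B) =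
      kronecker (rightUnitHom A) (𝟙 B) :=
  hom_ext fun p r => by
    refine (assocHom_comp_entry A (unitObj C) B (kronecker (𝟙 A) (leftUnitHom B)) r
      (fun i j k => delta A.fam i r.divNat ⊗ₘ ((λ_ _).hom ≫ delta B.fam k r.modNat))
      (fun q => rfl) p).trans ?_
    have : ∀ {X Y X' Y' : C} (f : X ⟶ X') (g : Y ⟶ Y'),
        (α_ X (𝟙_ C) Y).hom ≫ (f ⊗ₘ ((λ_ _).hom ≫ g)) = ((ρ_ _).hom ≫ f) ⊗ₘ g := by
      intros X Y X' Y' f g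
      have h := tensorHom_comp_tensorHom (𝟙 X) (λ_ Y).hom f g
      rw [Category.id_comp] at h
      rw [← h, id_tensorHom, triangle_assoc, ← tensorHom_id, tensorHom_comp_tensorHom,
        Category.id_comp]
    exact this _ _

theorem braidHom_comp_entry [BraidedCategory C] (A B : BiprodCompletion C)
    {E : BiprodCompletion C} (F : tensor B A ⟶ E) (r : Fin E.len)
    (H : ∀ i j, B.fam i ⊗ A.fam j ⟶ E.fam r)
    (hF : ∀ q : Fin (B.len * A.len), Hom.entry F q r = H q.divNat q.modNat)
    (p : Fin (A.len * B.len)) :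
    Hom.entry (braidHom A B ≫ F) p r = (β_ _ _).hom ≫ H p.modNat p.divNat := by
  refine Eq.trans ?_ (congrArg (fun t => (β_ _ _).hom ≫ t)
    (sum2 B.fam A.fam H p.modNat p.divNat))
  refine Eq.trans ?_ (comp_sum' _ _).symm
  refine (comp_entry _ _ _ _).trans (Finset.sum_congr rfl fun q _ => ?_)
  refine (congrArg (_ ≫ ·) (hF q)).trans (Category.assoc _ _ _)

theorem braidHom_braidHom [SymmetricCategory C] (A B : BiprodCompletion C) :
    braidHom A B ≫ braidHom B A = 𝟙 (tensor A B) :=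
  hom_ext fun p r => by
    refine (braidHom_comp_entry A B (braidHom B A) r
      (fun i j => (β_ _ _).hom ≫ (delta A.fam j r.divNat ⊗ₘ delta B.fam i r.modNat))
      (fun q => rfl) p).trans ?_
    exact (SymmetricCategory.symmetry_assoc _ _ _).trans (delta_tensor A B p r).symm

theorem braidHom_natural [BraidedCategory C] {A A' B B' : BiprodCompletion C} (f : A ⟶ A')
    (g : B ⟶ B') : kronecker f g ≫ braidHom A' B' = braidHom A B ≫ kronecker g f :=
  hom_ext fun p r => by
    refine Eq.trans ?_ (braidHom_comp_entry A B (kronecker g f) r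
      (fun i j => Hom.entry g i r.divNat ⊗ₘ Hom.entry f j r.modNat) (fun q => rfl) p).symm
    have h1 := sum_tensor_sum
      (fun q => Hom.entry f p.divNat q ≫ delta A'.fam q r.modNat)
      (fun q => Hom.entry g p.modNat q ≫ delta B'.fam q r.divNat)
    simp only [sum_comp_delta] at h1
    rw [← BraidedCategory.braiding_naturality, ← h1, sum_comp']
    refine (comp_entry _ _ _ _).trans (Finset.sum_congr rfl fun q _ => ?_)
    rw [← tensorHom_comp_tensorHom, Category.assoc, BraidedCategory.braiding_naturality]
    rfl

theorem hexagon' [BraidedCategory C] (A B D : BiprodCompletion C) :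
    assocHom A B D ≫ braidHom A (tensor B D) ≫ assocHom B D A =
      kronecker (braidHom A B) (𝟙 D) ≫ assocHom B A D ≫ kronecker (𝟙 B) (braidHom A D) :=
  hom_ext fun p r => by
    have h1 : ∀ q : Fin (A.len * (B.len * D.len)),
        Hom.entry (braidHom A (tensor B D) ≫ assocHom B D A) q r = (β_ _ _).hom ≫
          (α_ _ _ _).hom ≫ (delta B.fam q.modNat.divNat r.divNat ⊗ₘ
            (delta D.fam q.modNat.modNat r.modNat.divNat ⊗ₘ
              delta A.fam q.divNat r.modNat.modNat)) := fun q =>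
      braidHom_comp_entry A (tensor B D) (assocHom B D A) r (fun j i =>
        (α_ _ _ _).hom ≫ (delta B.fam j.divNat r.divNat ⊗ₘ
            (delta D.fam j.modNat r.modNat.divNat ⊗ₘ
              delta A.fam i r.modNat.modNat))) (fun q => rfl) q
    refine (assocHom_comp_entry A B D (braidHom A (tensor B D) ≫ assocHom B D A) r
      (fun i j k => (β_ _ _).hom ≫ (α_ _ _ _).hom ≫ (delta B.fam j r.divNat ⊗ₘ
            (delta D.fam k r.modNat.divNat ⊗ₘ delta A.fam i r.modNat.modNat))) h1 p).trans ?_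
    have h2 : ∀ q : Fin ((B.len * A.len) * D.len),
        Hom.entry (assocHom B A D ≫ kronecker (𝟙 B) (braidHom A D)) q r =
          (α_ _ _ _).hom ≫ (delta B.fam q.divNat.divNat r.divNat ⊗ₘ ((β_ _ _).hom ≫
            (delta D.fam q.modNat r.modNat.divNat ⊗ₘ
              delta A.fam q.divNat.modNat r.modNat.modNat))) := fun q =>
      assocHom_comp_entry B A D (kronecker (𝟙 B) (braidHom A D)) r (fun j i k =>
        delta B.fam j r.divNat ⊗ₘ ((β_ _ _).hom ≫ (delta D.fam k r.modNat.divNat ⊗ₘ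
              delta A.fam i r.modNat.modNat))) (fun q => rfl) q
    have h3 := congrArg (fun t => ((β_ _ _).hom ⊗ₘ 𝟙 _) ≫ t)
      (sum3L B.fam A.fam D.fam (fun j i k => (α_ _ _ _).hom ≫
        (delta B.fam j r.divNat ⊗ₘ ((β_ _ _).hom ≫ (delta D.fam k r.modNat.divNat ⊗ₘ
              delta A.fam i r.modNat.modNat)))) p.divNat.modNat p.divNat.divNat p.modNat)
    refine Eq.trans ?_ (h3.symm.trans ?_)
    · have h := BraidedCategory.hexagon_forward_assoc (A.fam p.divNat.divNat)
        (B.fam p.divNat.modNat) (D.fam p.modNat) (delta B.fam p.divNat.modNat r.divNat ⊗ₘ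
            (delta D.fam p.modNat r.modNat.divNat ⊗ₘ
              delta A.fam p.divNat.divNat r.modNat.modNat))
      refine h.trans ?_
      rw [tensorHom_id, tensor_comp_right]
    · refine (comp_sum' _ _).trans (Eq.symm ?_)
      refine (comp_entry _ _ _ _).trans (Finset.sum_congr rfl fun q _ => ?_)
      refine (congrArg (_ ≫ ·) (h2 q)).trans ?_
      refine Eq.trans ?_ (Category.assoc _ _ _)
      refine congrArg (· ≫ _) ?_
      refine Eq.trans ?_ (tensorHom_comp_tensorHom _ _ _ _).symm
      rw [Category.id_comp]
      rfl

/-- The monoidal structure of the completion: the unit is the list `(K)`, lists are tensored in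
row-major order, and maps by the Kronecker product. -/
instance monoidalStruct : MonoidalCategoryStruct (BiprodCompletion C) where
  tensorObj := tensor
  tensorHom := kronecker
  whiskerLeft A _ _ g := kronecker (𝟙 A) g
  whiskerRight f B := kronecker f (𝟙 B)
  tensorUnit := unitObj C
  associator A B D :=
    ⟨assocHom A B D, assocInv A B D, assocHom_assocInv A B D, assocInv_assocHom A B D⟩
  leftUnitor A := ⟨leftUnitHom A, leftUnitInv A, leftUnitHom_inv A, leftUnitInv_hom A⟩
  rightUnitor A := ⟨rightUnitHom A, rightUnitInv A, rightUnitHom_inv A, rightUnitInv_hom A⟩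

instance monoidal : MonoidalCategory (BiprodCompletion C) :=
  MonoidalCategory.ofTensorHom
    (id_tensorHom_id := kronecker_id)
    (id_tensorHom := fun _ _ _ _ => rfl)
    (tensorHom_id := fun _ _ => rfl)
    (tensorHom_comp_tensorHom := fun f g f' g' => kronecker_comp f f' g g')
    (associator_naturality := assocHom_natural)
    (leftUnitor_naturality := leftUnitHom_natural)
    (rightUnitor_naturality := rightUnitHom_natural)
    (pentagon := pentagon')
    (triangle := triangle')

instance symmetric [SymmetricCategory C] : SymmetricCategory (BiprodCompletion C) where
  braiding A B := ⟨braidHom A B, braidHom B A, braidHom_braidHom A B, braidHom_braidHom B A⟩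
  braiding_naturality_right _ _ _ f := braidHom_natural _ f
  braiding_naturality_left f _ := braidHom_natural f _
  hexagon_forward := hexagon'
  hexagon_reverse A B D := by
    let b (X Y : BiprodCompletion C) : X ⊗ Y ≅ Y ⊗ X :=
      ⟨braidHom X Y, braidHom Y X, braidHom_braidHom X Y, braidHom_braidHom Y X⟩
    have h : α_ D A B ≪≫ b D (A ⊗ B) ≪≫ α_ A B D =
        whiskerRightIso (b D A) B ≪≫ α_ A D B ≪≫ whiskerLeftIso A (b D B) :=
      Iso.ext (hexagon' D A B)
    have h' := congrArg Iso.inv h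
    exact (Category.assoc _ _ _).symm.trans (h'.trans (Category.assoc _ _ _))
  symmetry := braidHom_braidHom

instance additiveMonoidal : AdditiveMonoidal (BiprodCompletion C) where
  whiskerLeft_add _ _ _ _ _ := hom_ext fun _ _ => tensor_add' _ _ _
  add_whiskerRight _ _ _ := hom_ext fun _ _ => add_tensor' _ _ _
  whiskerLeft_zero _ _ _ := hom_ext fun _ _ => tensor_zero' _
  zero_whiskerRight _ _ _ := hom_ext fun _ _ => zero_tensor' _

end Monoidal

/-! ### The modality of the biproduct completion -/

section Modality

variable {C : Type u} [Category.{v} C] [MonoidalCategory C]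

/-- The tensor product of a family, `((K ⊗ F₁) ⊗ …) ⊗ Fₙ`; it is `F₁ ⊗ … ⊗ Fₙ` if `C` is strict. -/
def tensorFam : (n : ℕ) → (Fin n → C) → C
  | 0, _ => 𝟙_ C
  | n + 1, F => tensorFam n (fun i => F i.castSucc) ⊗ F (Fin.last n)

/-- The tensor product of a family of maps. -/
def tensorFamMap : (n : ℕ) → {F G : Fin n → C} → (∀ i, F i ⟶ G i) →
    (tensorFam n F ⟶ tensorFam n G)
  | 0, _, _, _ => 𝟙 (𝟙_ C)
  | n + 1, _, _, f => tensorFamMap n (fun i => f i.castSucc) ⊗ₘ f (Fin.last n)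

/-- The `n`-fold comultiplication of a comonoid `(X, c, e)`. -/
def iterComul {X : C} (c : X ⟶ X ⊗ X) (e : X ⟶ 𝟙_ C) : (n : ℕ) → (X ⟶ tensorFam n fun _ => X)
  | 0 => e
  | n + 1 => c ≫ (iterComul c e n ▷ X)

/-- The `n`-fold multiplication of a monoid `(X, m, u)`. -/
def iterMul {X : C} (m : X ⊗ X ⟶ X) (u : 𝟙_ C ⟶ X) : (n : ℕ) → (tensorFam n (fun _ => X) ⟶ X)
  | 0 => u
  | n + 1 => (iterMul m u n ▷ X) ≫ m

/-- `!A₁ ⊗ … ⊗ !Aₙ` -/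
abbrev bang (M : BialgebraModalityData C) {n : ℕ} (F : Fin n → C) : C :=
  tensorFam n fun i => M.obj (F i)

/-- The counit `e ⊗ … ⊗ e` of the tensor product of comonoids. -/
def bangE (M : BialgebraModalityData C) : (n : ℕ) → (F : Fin n → C) → (bang M F ⟶ 𝟙_ C)
  | 0, _ => 𝟙 (𝟙_ C)
  | n + 1, F => (bangE M n (fun i => F i.castSucc) ⊗ₘ M.e (F (Fin.last n))) ≫ (λ_ (𝟙_ C)).hom

/-- The unit `u ⊗ … ⊗ u` of the tensor product of monoids. -/
def bangU (M : BialgebraModalityData C) : (n : ℕ) → (F : Fin n → C) → (𝟙_ C ⟶ bang M F)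
  | 0, _ => 𝟙 (𝟙_ C)
  | n + 1, F => (λ_ (𝟙_ C)).inv ≫ (bangU M n (fun i => F i.castSucc) ⊗ₘ M.u (F (Fin.last n)))

/-- The comultiplication of the tensor product of comonoids. -/
def bangΔ [BraidedCategory C] (M : BialgebraModalityData C) :
    (n : ℕ) → (F : Fin n → C) → (bang M F ⟶ bang M F ⊗ bang M F)
  | 0, _ => (λ_ (𝟙_ C)).inv
  | n + 1, F => (bangΔ M n (fun i => F i.castSucc) ⊗ₘ M.Δ (F (Fin.last n))) ≫ tensorμ _ _ _ _

/-- The multiplication of the tensor product of monoids. -/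
def bangMul [BraidedCategory C] (M : BialgebraModalityData C) :
    (n : ℕ) → (F : Fin n → C) → (bang M F ⊗ bang M F ⟶ bang M F)
  | 0, _ => (λ_ (𝟙_ C)).hom
  | n + 1, F =>
    tensorμ _ _ _ _ ≫ (bangMul M n (fun i => F i.castSucc) ⊗ₘ M.mul (F (Fin.last n)))

/-- `e ⊗ … ⊗ 1 ⊗ … ⊗ e : !A₁ ⊗ … ⊗ !Aₙ ⟶ !Aᵢ` -/
def bangProj (M : BialgebraModalityData C) :
    (n : ℕ) → (F : Fin n → C) → (i : Fin n) → (bang M F ⟶ M.obj (F i))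
  | 0, _, i => i.elim0
  | n + 1, F, i =>
    Fin.lastCases (motive := fun i => bang M F ⟶ M.obj (F i))
      ((bangE M n (fun i => F i.castSucc) ⊗ₘ 𝟙 _) ≫ (λ_ _).hom)
      (fun i => (bangProj M n (fun i => F i.castSucc) i ⊗ₘ M.e (F (Fin.last n))) ≫ (ρ_ _).hom) i

/-- `u ⊗ … ⊗ 1 ⊗ … ⊗ u : !Aᵢ ⟶ !A₁ ⊗ … ⊗ !Aₙ` -/
def bangInj (M : BialgebraModalityData C) :
    (n : ℕ) → (F : Fin n → C) → (i : Fin n) → (M.obj (F i) ⟶ bang M F)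
  | 0, _, i => i.elim0
  | n + 1, F, i =>
    Fin.lastCases (motive := fun i => M.obj (F i) ⟶ bang M F)
      ((λ_ _).inv ≫ (bangU M n (fun i => F i.castSucc) ⊗ₘ 𝟙 _))
      (fun i => (ρ_ _).inv ≫ (bangInj M n (fun i => F i.castSucc) i ⊗ₘ M.u (F (Fin.last n)))) i

/-- The map `!A₁ ⊗ … ⊗ !Aₙ ⟶ !B₁ ⊗ … ⊗ !Bₘ` of a matrix `f`: each `!Aᵢ` is copied by `Δ` into
`m` wires, the wire from `i` to `j` carries `!(f i j)`, and the `n` wires arriving at `j` are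
merged by `∇` into `!Bⱼ`; that is, the `n` rows `!Aᵢ ⟶ !B₁ ⊗ … ⊗ !Bₘ` are multiplied in the
tensor product monoid `!B₁ ⊗ … ⊗ !Bₘ`. -/
def bangMap [BraidedCategory C] (M : BialgebraModalityData C) {n m : ℕ} {F : Fin n → C}
    {G : Fin m → C} (f : ∀ i j, F i ⟶ G j) : bang M F ⟶ bang M G :=
  tensorFamMap n (fun i => iterComul (M.Δ (F i)) (M.e (F i)) m ≫
    tensorFamMap m (fun j => M.map (f i j))) ≫ iterMul (bangMul M m G) (bangU M m G) n

/-- `!A₁ ⊗ … ⊗ !Aₙ ⟶ !(!A₁ ⊗ … ⊗ !Aₙ)`: apply `δ` and `!(u ⊗ … ⊗ 1 ⊗ … ⊗ u)` to each factor,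
multiply by `∇`, apply `δ`, and, inside `!`, comultiply by `Δ` into `n` factors and apply
`!(e ⊗ … ⊗ ε ⊗ … ⊗ e)` to each of them. -/
def bangδ (M : BialgebraModalityData C) {n : ℕ} (F : Fin n → C) :
    bang M F ⟶ M.obj (bang M F) :=
  tensorFamMap n (fun i => M.δ (F i) ≫ M.map (bangInj M n F i)) ≫
    iterMul (M.mul (bang M F)) (M.u (bang M F)) n ≫ M.δ (bang M F) ≫
      M.map (iterComul (M.Δ (bang M F)) (M.e (bang M F)) n ≫
        tensorFamMap n (fun i => M.map (bangProj M n F i ≫ M.ε (F i))))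

variable [AdditiveCategory C] [AdditiveMonoidal C]

/-- The modality of the biproduct completion, `!(A₁, …, Aₙ) = (!A₁ ⊗ … ⊗ !Aₙ)`. -/
def modality [BraidedCategory C] (M : BialgebraModalityData C) :
    BialgebraModalityData (BiprodCompletion C) where
  obj A := single (bang M A.fam)
  map f := singleMap (bangMap M (Hom.entry f))
  δ A := singleMap (bangδ M A.fam ≫ (λ_ (M.obj (bang M A.fam))).inv)
  ε A := Hom.mk fun _ i => bangProj M A.len A.fam i ≫ M.ε (A.fam i)
  Δ A := Hom.mk fun _ _ => bangΔ M A.len A.fam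
  e A := Hom.mk fun _ _ => bangE M A.len A.fam
  mul A := Hom.mk fun _ _ => bangMul M A.len A.fam
  u A := Hom.mk fun _ _ => bangU M A.len A.fam

/-- The codereliction of the biproduct completion: the column with entries
`u ⊗ … ⊗ η ⊗ … ⊗ u`. -/
def codereliction [BraidedCategory C] (M : BialgebraModalityData C)
    (η : ∀ A : C, A ⟶ M.obj A) (A : BiprodCompletion C) : A ⟶ (modality M).obj A :=
  Hom.mk fun i _ => η (A.fam i) ≫ bangInj M A.len A.fam i

/-- The coherence isomorphism `F₁ ⊗ … ⊗ Fₘ₊ₙ ≅ (F₁ ⊗ … ⊗ Fₘ) ⊗ (Fₘ₊₁ ⊗ … ⊗ Fₘ₊ₙ)`, composed of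
associators and unitors only. -/
def splitIso {C : Type u} [Category.{v} C] [MonoidalCategory C] (m : ℕ) :
    (n : ℕ) → (F : Fin (m + n) → C) →
    (tensorFam (m + n) F ≅ tensorFam m (fun i => F (Fin.castAdd n i)) ⊗
      tensorFam n (fun j => F (Fin.natAdd m j)))
  | 0, F => (ρ_ (tensorFam m F)).symm
  | n + 1, F => whiskerRightIso (splitIso m n (fun i => F i.castSucc)) (F (Fin.last (m + n))) ≪≫
      α_ _ _ _

/-- The coherence isomorphism `!(A₁, …, Aₘ, B₁, …, Bₙ) ≅ !(A₁, …, Aₘ) ⊗ !(B₁, …, Bₙ)`. -/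
def seelyCoherence [BraidedCategory C] (M : BialgebraModalityData C)
    (A B : BiprodCompletion C) :
    (modality M).obj (concat A B).pt ⟶ (modality M).obj A ⊗ (modality M).obj B :=
  Hom.mk fun _ _ => (splitIso A.len B.len fun p => M.obj (Fin.append A.fam B.fam p)).hom ≫
    (eqToHom (by simp only [Fin.append_left]; rfl) ⊗ₘ
      eqToHom (by simp only [Fin.append_right]; rfl))

end Modality

end BiprodCompletion
end

noncomputable section

/-! Everything is computed by convolution. For a cocommutative comonoid `X` and a commutative monoid
`R`, the maps `X ⟶ R` form a commutative monoid under `f * g = Δ (f ⊗ g) ∇`. Precomposition with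
comonoid maps and postcomposition with monoid maps are homomorphisms for it, and additivity of the
modality says that `!` sends finite sums of maps to convolution products.

The bimonoid T = !A₁ ⊗ … ⊗ !Aₙ has projections pᵢ and injections qᵢ such that qᵢ pᵢ = 1, qᵢ pⱼ is
the convolution unit for i ≠ j, and ∏ pᵢ qᵢ = 1 (`prod_famProj_famInj`). This is a multiplicative
copy of the calculus of biproducts. In particular comonoid maps into T are determined by their
components (`fam_hom_ext`). The map induced by a matrix f has components ∏ᵢ pᵢ !(fᵢⱼ), so
functoriality and additivity are checked on components.

For the comultiplication, T is a retract of !T: the section s is the convolution product of the maps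
pᵢ δ !(qᵢ), the retraction r has components !(pᵢ ε), and s r = 1 (`bangSection_retraction`). The
comultiplication of T is s δ !(r). The maps `bangLift g : !X ⟶ T` are coalgebra maps
(`bangLift_bangδ`). Both r and r followed by the map of a matrix have this form, so coassociativity
and naturality follow after precomposing with s.

For a codereliction η, multiplication by the primitive map η qᵢ satisfies the Leibniz rule for
convolution products. Applied to s, it kills every factor but the i-th. The chain rule at Aᵢ,
followed by the chain rule of η at the object T, gives the chain rule for the comultiplication of T
(`mulRight_bangδ`). A deriving transformation d is reduced to this case: additivity forces d = (1 ⊗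
η)∇ for η = (u ⊗ 1)d (`deriving_eq_mulRight`), whence η is a codereliction.

Most axioms on the completion compare maps between lists of length one and translate into these
statements through `Represents`; the others are compared entry by entry. The Seely map of a
concatenation pairs the two projections of a tensor product of comonoids, and this pairing is the
identity up to coherence (`comul_tfst_tsnd`). -/

namespace BialgebraModality

open scoped MonObj ComonObj
open Opposite
open BiprodCompletion (tensorFam tensorFamMap iterComul iterMul bang bangE bangU bangΔ bangMul
  bangProj bangInj bangMap bangδ tensor_zero' zero_tensor' tensor_add' add_tensor' delta
  delta_self delta_ne comp_sum' sum_comp')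

/-! ### Comonoids and bimonoids in a symmetric monoidal category -/

section Comonoids

variable {C : Type u} [Category.{v} C] [MonoidalCategory C]

instance unitComonObj : ComonObj (𝟙_ C) := ComonObj.instTensorUnit C

theorem unit_counit : ε[𝟙_ C] = 𝟙 (𝟙_ C) := rfl

theorem unit_comul : Δ[𝟙_ C] = (λ_ (𝟙_ C)).inv := rfl

instance counit_isComonHom (X : C) [ComonObj X] : IsComonHom ε[X] where
  hom_counit := Category.comp_id _
  hom_comul := by
    rw [unit_comul, ComonObj.counit_comul_hom]

variable [SymmetricCategory C]

instance unit_isCommComonObj : IsCommComonObj (𝟙_ C) where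
  comul_comm := by
    rw [unit_comul, braiding_tensorUnit_left, unitors_equal]; simp [unitors_inv_equal]

variable {X Y Z W : C} [ComonObj X] [ComonObj Y] [ComonObj Z] [ComonObj W]

instance tensorHom_isComonHom (f : X ⟶ Y) (g : Z ⟶ W) [IsComonHom f] [IsComonHom g] :
    IsComonHom (f ⊗ₘ g) where
  hom_counit := by
    simp [tensorHom_comp_tensorHom_assoc, IsComonHom.hom_counit]
  hom_comul := by
    rw [Comon.tensorObj_comul, Comon.tensorObj_comul, tensorHom_comp_tensorHom_assoc,
      IsComonHom.hom_comul f, IsComonHom.hom_comul g, ← tensorHom_comp_tensorHom, Category.assoc,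
      Category.assoc, tensorμ_natural]

instance whiskerLeft_isComonHom (f : Z ⟶ W) [IsComonHom f] : IsComonHom (X ◁ f) := by
  rw [← id_tensorHom]; infer_instance

instance whiskerRight_isComonHom (f : Z ⟶ W) [IsComonHom f] : IsComonHom (f ▷ X) := by
  rw [← tensorHom_id]; infer_instance

/-- Comonoids are monoids in the opposite category. This instance and the next three results
transport facts about commutative monoids to cocommutative comonoids. -/
instance op_monObj (X : C) [ComonObj X] : MonObj (op X) := Comon.ComonToMonOpOpObjMon ⟨X⟩

instance op_symmetricCategory : SymmetricCategory Cᵒᵖ where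
  symmetry X Y := Quiver.Hom.unop_inj (SymmetricCategory.symmetry (unop X) (unop Y))

instance op_isCommMonObj (X : C) [ComonObj X] [IsCommComonObj X] : IsCommMonObj (op X) where
  mul_comm := Quiver.Hom.unop_inj (IsCommComonObj.comul_comm X)

theorem op_tensor_mul : μ[op X ⊗ op Y] = (Δ[X ⊗ Y]).op := by
  apply Quiver.Hom.unop_inj
  rw [MonObj.tensorObj.mul_def, Quiver.Hom.unop_op, Comon.tensorObj_comul, unop_comp,
    BraidedCategory.unop_tensorμ]
  rfl

instance associator_isComonHom : IsComonHom (α_ X Y Z).hom := by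
  have h := (α_ (Comon.mk X) (Comon.mk Y) (Comon.mk Z)).hom.isComonHom_hom
  have e : (α_ (Comon.mk X) (Comon.mk Y) (Comon.mk Z)).hom.hom = (α_ X Y Z).hom := by
    rw [Comon.monoidal_associator_hom_hom]
    -- The associator of `Comon C` has that of `C` as underlying map, up to identity factors left by
    -- the passage through the opposite category.
    change 𝟙 (X ⊗ Y) ▷ Z ≫ (α_ X Y Z).hom ≫ X ◁ 𝟙 (Y ⊗ Z) = _
    simp
  rw [e] at h
  exact h

instance leftUnitor_isComonHom : IsComonHom (λ_ X).hom := by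
  have h := (λ_ (Comon.mk X)).hom.isComonHom_hom
  have e : (λ_ (Comon.mk X)).hom.hom = (λ_ X).hom := by
    rw [Comon.monoidal_leftUnitor_hom_hom]
    change 𝟙 (𝟙_ C) ▷ X ≫ (λ_ X).hom = _
    simp
  rw [e] at h
  exact h

instance rightUnitor_isComonHom : IsComonHom (ρ_ X).hom := by
  have h := (ρ_ (Comon.mk X)).hom.isComonHom_hom
  have e : (ρ_ (Comon.mk X)).hom.hom = (ρ_ X).hom := by
    rw [Comon.monoidal_rightUnitor_hom_hom]
    change X ◁ 𝟙 (𝟙_ C) ≫ (ρ_ X).hom = _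
    simp
  rw [e] at h
  exact h

instance braiding_isComonHom : IsComonHom (β_ X Y).hom where
  hom_counit := by
    rw [Comon.tensorObj_counit, Comon.tensorObj_counit,
      ← BraidedCategory.braiding_naturality_assoc, braiding_tensorUnit_left, unitors_equal]
    simp
  hom_comul := by
    have h := congrArg Quiver.Hom.unop (MonObj.mul_braiding (op Y) (op X))
    rw [op_tensor_mul, op_tensor_mul] at h
    simp only [unop_comp, unop_tensorHom, unop_hom_braiding, Quiver.Hom.unop_op] at h
    exact h

instance tensor_isCommComonObj [IsCommComonObj X] [IsCommComonObj Y] :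
    IsCommComonObj (X ⊗ Y) where
  comul_comm := by
    have h := congrArg Quiver.Hom.unop (IsCommMonObj.mul_comm (op X ⊗ op Y))
    rw [op_tensor_mul] at h
    exact h

/-- Eckmann–Hilton: the dual of the interchange law (ab)(cd) = (ac)(bd) of a commutative monoid. -/
instance comul_isComonHom [IsCommComonObj X] : IsComonHom Δ[X] where
  hom_counit := by
    rw [Comon.tensorObj_counit, ComonObj.comul_counit_hom_assoc, unitors_equal,
      Iso.inv_hom_id, Category.comp_id]
  hom_comul := by
    have h := congrArg Quiver.Hom.unop (MonObj.mul_mul_mul_comm (op X))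
    rw [Comon.tensorObj_comul]
    simp only [unop_comp, BraidedCategory.unop_tensorμ, unop_tensorHom, Category.assoc] at h
    exact h

instance tensorμ_isComonHom : IsComonHom (tensorμ X Y Z W) := by
  unfold tensorμ; infer_instance

instance unitBimonObj : BimonObj (𝟙_ C) where
  __ := (inferInstance : MonObj (𝟙_ C))
  __ := unitComonObj
  mul_comul := by
    have h : IsMonHom (λ_ (𝟙_ C)).inv := inferInstance
    have h' := h.mul_hom
    rw [MonObj.tensorObj.mul_def] at h'
    exact h'
  one_comul := by simp [MonObj.tensorObj.one_def]
  mul_counit := by simp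
  one_counit := by simp

instance mul_isComonHom (X : C) [BimonObj X] : IsComonHom μ[X] where
  hom_counit := BimonObj.mul_counit X
  hom_comul := by rw [BimonObj.mul_comul, Comon.tensorObj_comul, Category.assoc]

instance one_isMonHom (R : C) [MonObj R] : IsMonHom η[R] where
  one_hom := Category.id_comp _
  mul_hom := (MonObj.one_mul_hom _).symm

instance one_isComonHom (X : C) [BimonObj X] : IsComonHom η[X] where
  hom_counit := BimonObj.one_counit X
  hom_comul := BimonObj.one_comul X

instance comul_isMonHom (X : C) [BimonObj X] : IsMonHom Δ[X] where
  one_hom := BimonObj.one_comul X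
  mul_hom := by rw [BimonObj.mul_comul, MonObj.tensorObj.mul_def]

instance counit_isMonHom (X : C) [BimonObj X] : IsMonHom ε[X] where
  one_hom := BimonObj.one_counit X
  mul_hom := BimonObj.mul_counit X

/-- The bimonoid axioms say that multiplication and unit are comonoid maps, and for `X ⊗ Y` these
are composites of comonoid maps. -/
instance tensorBimonObj (X Y : C) [BimonObj X] [BimonObj Y] : BimonObj (X ⊗ Y) where
  __ := (inferInstance : MonObj (X ⊗ Y))
  __ := (inferInstance : ComonObj (X ⊗ Y))
  mul_comul := by
    have h : IsComonHom (tensorμ X Y X Y ≫ (μ[X] ⊗ₘ μ[Y])) := inferInstance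
    have h' := h.hom_comul
    rw [Comon.tensorObj_comul (X ⊗ Y)] at h'
    exact h'.trans (Category.assoc _ _ _)
  one_comul := by
    have h : IsComonHom ((λ_ (𝟙_ C)).inv ≫ (η[X] ⊗ₘ η[Y])) := inferInstance
    exact h.hom_comul
  mul_counit := by
    have h : IsComonHom (tensorμ X Y X Y ≫ (μ[X] ⊗ₘ μ[Y])) := inferInstance
    exact h.hom_counit
  one_counit := by
    have h : IsComonHom ((λ_ (𝟙_ C)).inv ≫ (η[X] ⊗ₘ η[Y])) := inferInstance
    exact h.hom_counit

end Comonoids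

/-! ### Projections and injections of a binary tensor product -/

section Projections

variable {C : Type u} [Category.{v} C] [MonoidalCategory C] [SymmetricCategory C]

/-- The projection of a tensor product that discards the second factor. -/
def tfst (X Y : C) [ComonObj Y] : X ⊗ Y ⟶ X := X ◁ ε[Y] ≫ (ρ_ X).hom

/-- The projection of a tensor product that discards the first factor. -/
def tsnd (X Y : C) [ComonObj X] : X ⊗ Y ⟶ Y := ε[X] ▷ Y ≫ (λ_ Y).hom

/-- The injection into a tensor product given by the unit of the second factor. -/
def tinl (X Y : C) [MonObj Y] : X ⟶ X ⊗ Y := (ρ_ X).inv ≫ X ◁ η[Y]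

/-- The injection into a tensor product given by the unit of the first factor. -/
def tinr (X Y : C) [MonObj X] : Y ⟶ X ⊗ Y := (λ_ Y).inv ≫ η[X] ▷ Y

instance tfst_isComonHom (X Y : C) [ComonObj X] [ComonObj Y] : IsComonHom (tfst X Y) := by
  unfold tfst; infer_instance

instance tsnd_isComonHom (X Y : C) [ComonObj X] [ComonObj Y] : IsComonHom (tsnd X Y) := by
  unfold tsnd; infer_instance

instance tinl_isComonHom (X Y : C) [ComonObj X] [BimonObj Y] : IsComonHom (tinl X Y) := by
  unfold tinl; infer_instance

instance tinr_isComonHom (X Y : C) [BimonObj X] [ComonObj Y] : IsComonHom (tinr X Y) := by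
  unfold tinr; infer_instance

instance tfst_isMonHom (X Y : C) [MonObj X] [BimonObj Y] : IsMonHom (tfst X Y) := by
  unfold tfst; infer_instance

instance tsnd_isMonHom (X Y : C) [BimonObj X] [MonObj Y] : IsMonHom (tsnd X Y) := by
  unfold tsnd; infer_instance

instance tinl_isMonHom (X Y : C) [MonObj X] [MonObj Y] : IsMonHom (tinl X Y) := by
  unfold tinl; infer_instance

instance tinr_isMonHom (X Y : C) [MonObj X] [MonObj Y] : IsMonHom (tinr X Y) := by
  unfold tinr; infer_instance

/-- The tensor product behaves as a cartesian product of comonoids: copying and then discarding one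
half of each copy changes nothing, by the counit laws. The Seely isomorphism rests on this identity.
-/
theorem comul_tfst_tsnd (X Y : C) [ComonObj X] [ComonObj Y] :
    Δ[X ⊗ Y] ≫ (tfst X Y ⊗ₘ tsnd X Y) = 𝟙 (X ⊗ Y) := by
  -- After discarding, `tensorμ` only swaps two copies of the unit; that braiding is a composite of
  -- unitors, so coherence applies.
  have h : tensorμ X (𝟙_ C) (𝟙_ C) Y ≫ ((ρ_ X).hom ⊗ₘ (λ_ Y).hom) =
      (ρ_ X).hom ⊗ₘ (λ_ Y).hom := by
    simp only [tensorμ, braiding_tensorUnit_left]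
    monoidal
  rw [Comon.tensorObj_comul, tfst, tsnd, ← tensorHom_comp_tensorHom, ← id_tensorHom,
    ← tensorHom_id, Category.assoc, ← tensorμ_natural_assoc, h, tensorHom_comp_tensorHom_assoc,
    id_tensorHom, tensorHom_id, ComonObj.comul_counit, ComonObj.counit_comul,
    tensorHom_comp_tensorHom]
  simp

theorem tinl_tinr_mul (X Y : C) [MonObj X] [MonObj Y] :
    (tinl X Y ⊗ₘ tinr X Y) ≫ μ[X ⊗ Y] = 𝟙 (X ⊗ Y) := by
  have h : ((ρ_ X).inv ⊗ₘ (λ_ Y).inv) ≫ tensorμ X (𝟙_ C) (𝟙_ C) Y =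
      (ρ_ X).inv ⊗ₘ (λ_ Y).inv := by
    simp only [tensorμ, braiding_tensorUnit_left]
    monoidal
  rw [MonObj.tensorObj.mul_def, tinl, tinr, ← tensorHom_comp_tensorHom, ← id_tensorHom,
    ← tensorHom_id, Category.assoc, tensorμ_natural_assoc, reassoc_of% h,
    tensorHom_comp_tensorHom, id_tensorHom, tensorHom_id, MonObj.mul_one, MonObj.one_mul,
    tensorHom_comp_tensorHom]
  simp

@[simp]
theorem tinl_tfst (X Y : C) [BimonObj Y] : tinl X Y ≫ tfst X Y = 𝟙 X := by
  simp [tinl, tfst, ← MonoidalCategory.whiskerLeft_comp_assoc]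

@[simp]
theorem tinl_tfst_assoc (X Y : C) [BimonObj Y] {Z : C} (h : X ⟶ Z) :
    tinl X Y ≫ tfst X Y ≫ h = h := by
  rw [← Category.assoc, tinl_tfst, Category.id_comp]

@[simp]
theorem tinr_tsnd (X Y : C) [BimonObj X] : tinr X Y ≫ tsnd X Y = 𝟙 Y := by
  simp [tinr, tsnd, ← MonoidalCategory.comp_whiskerRight_assoc]

@[simp]
theorem tinr_tsnd_assoc (X Y : C) [BimonObj X] {Z : C} (h : Y ⟶ Z) :
    tinr X Y ≫ tsnd X Y ≫ h = h := by
  rw [← Category.assoc, tinr_tsnd, Category.id_comp]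

/-- The right-hand side is the unit for convolution, which plays the part of the zero off the
diagonal of a biproduct. -/
theorem tinl_tsnd (X Y : C) [ComonObj X] [MonObj Y] : tinl X Y ≫ tsnd X Y = ε[X] ≫ η[Y] := by
  rw [tinl, tsnd, Category.assoc, whisker_exchange_assoc, leftUnitor_naturality,
    ← rightUnitor_inv_naturality_assoc, unitors_equal, Iso.inv_hom_id_assoc]

theorem tinr_tfst (X Y : C) [MonObj X] [ComonObj Y] : tinr X Y ≫ tfst X Y = ε[Y] ≫ η[X] := by
  rw [tinr, tfst, Category.assoc, ← whisker_exchange_assoc, rightUnitor_naturality,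
    ← leftUnitor_inv_naturality_assoc, ← unitors_equal, Iso.inv_hom_id_assoc]

theorem tensorHom_counit_rightUnitor {X X' Y : C} [ComonObj Y] (f : X ⟶ X') :
    (f ⊗ₘ ε[Y]) ≫ (ρ_ X').hom = tfst X Y ≫ f := by
  rw [tfst, tensorHom_def', Category.assoc, Category.assoc, rightUnitor_naturality]

theorem rightUnitor_inv_tensorHom_one {X X' Y : C} [MonObj Y] (f : X ⟶ X') :
    (ρ_ X).inv ≫ (f ⊗ₘ η[Y]) = f ≫ tinl X' Y := by
  rw [tinl, MonoidalCategory.tensorHom_def, rightUnitor_inv_naturality_assoc]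

end Projections

/-! ### The convolution monoid of maps from a comonoid to a monoid -/

section Convolution

variable {C : Type u} [Category.{v} C] [MonoidalCategory C] [SymmetricCategory C]

/-- The convolution of two maps from a comonoid to a monoid. -/
instance convMul (X R : C) [ComonObj X] [MonObj R] : Mul (X ⟶ R) where
  mul f g := Δ ≫ (f ⊗ₘ g) ≫ μ

instance convOne (X R : C) [ComonObj X] [MonObj R] : One (X ⟶ R) where
  one := ε ≫ η

theorem conv_mul {X R : C} [ComonObj X] [MonObj R] (f g : X ⟶ R) :
    f * g = Δ ≫ (f ⊗ₘ g) ≫ μ := rfl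

theorem conv_one {X R : C} [ComonObj X] [MonObj R] : (1 : X ⟶ R) = ε ≫ η := rfl

/-- Maps from a cocommutative comonoid to a commutative monoid form a commutative monoid. -/
instance convCommMonoid (X R : C) [ComonObj X] [IsCommComonObj X] [MonObj R] [IsCommMonObj R] :
    CommMonoid (X ⟶ R) where
  mul_assoc f g h := by
    simp only [conv_mul]
    have e₁ : (Δ[X] ≫ (f ⊗ₘ g) ≫ μ[R]) ⊗ₘ h =
        Δ[X] ▷ X ≫ ((f ⊗ₘ g) ⊗ₘ h) ≫ μ[R] ▷ R := by
      rw [← tensorHom_id, ← tensorHom_id, tensorHom_comp_tensorHom, tensorHom_comp_tensorHom,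
        Category.id_comp, Category.comp_id]
    have e₂ : f ⊗ₘ (Δ[X] ≫ (g ⊗ₘ h) ≫ μ[R]) =
        X ◁ Δ[X] ≫ (f ⊗ₘ (g ⊗ₘ h)) ≫ R ◁ μ[R] := by
      rw [← id_tensorHom, ← id_tensorHom, tensorHom_comp_tensorHom, tensorHom_comp_tensorHom,
        Category.id_comp, Category.comp_id]
    rw [e₁, e₂]
    simp only [Category.assoc, MonObj.mul_assoc]
    rw [associator_naturality_assoc, ComonObj.comul_assoc_assoc]
  one_mul f := by
    rw [conv_mul, conv_one, ← Category.id_comp f, ← tensorHom_comp_tensorHom]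
    simp
  mul_one f := by
    rw [conv_mul, conv_one, ← Category.id_comp f, ← tensorHom_comp_tensorHom]
    simp
  mul_comm f g := by
    rw [conv_mul, conv_mul, ← IsCommComonObj.comul_comm_assoc X,
      ← BraidedCategory.braiding_naturality_assoc, IsCommMonObj.mul_comm]

section

variable {X Y R S : C} [ComonObj X] [ComonObj Y] [MonObj R] [MonObj S]

theorem comp_conv_mul (h : Y ⟶ X) [IsComonHom h] (f g : X ⟶ R) :
    h ≫ (f * g) = (h ≫ f) * (h ≫ g) := by
  rw [conv_mul, conv_mul, IsComonHom.hom_comul_assoc, tensorHom_comp_tensorHom_assoc]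

theorem comp_conv_one (h : Y ⟶ X) [IsComonHom h] : h ≫ (1 : X ⟶ R) = 1 := by
  rw [conv_one, conv_one, IsComonHom.hom_counit_assoc]

theorem conv_mul_comp (f g : X ⟶ R) (k : R ⟶ S) [IsMonHom k] :
    (f * g) ≫ k = (f ≫ k) * (g ≫ k) := by
  rw [conv_mul, conv_mul, Category.assoc, Category.assoc, IsMonHom.mul_hom,
    tensorHom_comp_tensorHom_assoc]

theorem conv_one_comp (k : R ⟶ S) [IsMonHom k] : (1 : X ⟶ R) ≫ k = 1 := by
  rw [conv_one, conv_one, Category.assoc, IsMonHom.one_hom]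

variable [IsCommComonObj X] [IsCommComonObj Y] [IsCommMonObj R] [IsCommMonObj S]

theorem comp_conv_prod (h : Y ⟶ X) [IsComonHom h] {I : Type*} (s : Finset I) (f : I → (X ⟶ R)) :
    h ≫ ∏ i ∈ s, f i = ∏ i ∈ s, h ≫ f i :=
  map_prod (⟨⟨fun f => h ≫ f, comp_conv_one h⟩, comp_conv_mul h⟩ : (X ⟶ R) →* (Y ⟶ R)) f s

theorem conv_prod_comp {I : Type*} (s : Finset I) (f : I → (X ⟶ R)) (k : R ⟶ S) [IsMonHom k] :
    (∏ i ∈ s, f i) ≫ k = ∏ i ∈ s, f i ≫ k :=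
  map_prod (⟨⟨fun f => f ≫ k, conv_one_comp k⟩, fun f g => conv_mul_comp f g k⟩ :
    (X ⟶ R) →* (X ⟶ S)) f s

end

section

variable {X R : C} [ComonObj X] [BimonObj R]

instance conv_one_isComonHom : IsComonHom (1 : X ⟶ R) := by
  rw [conv_one]; infer_instance

/-- The product is Δ followed by `f ⊗ g` and ∇: the first is a comonoid map by cocommutativity of
`X`, the last because `R` is a bimonoid. -/
instance conv_mul_isComonHom [IsCommComonObj X] (f g : X ⟶ R) [IsComonHom f] [IsComonHom g] :
    IsComonHom (f * g) := by
  rw [conv_mul]; infer_instance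

theorem conv_prod_isComonHom [IsCommComonObj X] [IsCommMonObj R] {I : Type*} (s : Finset I)
    (f : I → (X ⟶ R)) (hf : ∀ i ∈ s, IsComonHom (f i)) : IsComonHom (∏ i ∈ s, f i) :=
  Finset.prod_induction f (fun f => IsComonHom f) (fun _ _ _ _ => inferInstance) inferInstance hf

end

instance mul_isMonHom (R : C) [MonObj R] [IsCommMonObj R] : IsMonHom μ[R] where
  one_hom := by
    rw [MonObj.tensorObj.one_def, Category.assoc, MonObj.one_mul_hom, Iso.inv_hom_id_assoc]
  mul_hom := by rw [MonObj.tensorObj.mul_def, Category.assoc, MonObj.mul_mul_mul_comm]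

section

variable {X R : C} [BimonObj X] [MonObj R] [IsCommMonObj R]

instance conv_one_isMonHom : IsMonHom (1 : X ⟶ R) := by
  rw [conv_one]; infer_instance

instance conv_mul_isMonHom (f g : X ⟶ R) [IsMonHom f] [IsMonHom g] : IsMonHom (f * g) := by
  rw [conv_mul]; infer_instance

theorem conv_prod_isMonHom [IsCommComonObj X] {I : Type*} (s : Finset I)
    (f : I → (X ⟶ R)) (hf : ∀ i ∈ s, IsMonHom (f i)) : IsMonHom (∏ i ∈ s, f i) :=
  Finset.prod_induction f (fun f => IsMonHom f) (fun _ _ _ _ => inferInstance) inferInstance hf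

end

/-- This turns tensor products of maps into convolution products, so that iterated tensors need not
be handled directly. -/
theorem tfst_mul_tsnd {X Y R : C} [ComonObj X] [ComonObj Y] [MonObj R] (a : X ⟶ R) (b : Y ⟶ R) :
    (tfst X Y ≫ a) * (tsnd X Y ≫ b) = (a ⊗ₘ b) ≫ μ := by
  rw [conv_mul, ← tensorHom_comp_tensorHom, Category.assoc, reassoc_of% comul_tfst_tsnd]

theorem tinl_mul_tinr {X R S : C} [ComonObj X] [MonObj R] [MonObj S] (a : X ⟶ R) (b : X ⟶ S) :
    (a ≫ tinl R S) * (b ≫ tinr R S) = Δ ≫ (a ⊗ₘ b) := by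
  rw [conv_mul, ← tensorHom_comp_tensorHom, Category.assoc, tinl_tinr_mul, Category.comp_id]

theorem tfst_tinl_mul_tsnd_tinr (X Y : C) [BimonObj X] [BimonObj Y] :
    (tfst X Y ≫ tinl X Y) * (tsnd X Y ≫ tinr X Y) = 𝟙 (X ⊗ Y) := by
  rw [tfst_mul_tsnd, tinl_tinr_mul]

end Convolution

/-! ### Tensor products of finite families of bimonoids -/

section Families

variable {C : Type u} [Category.{v} C] [MonoidalCategory C] [SymmetricCategory C]

/-- The recursion follows `tensorFam`, so that at `n + 1` the structure is by definition that of a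
binary tensor product and the lemmas on binary tensors apply without transport. -/
instance famMonObj : (n : ℕ) → (F : Fin n → C) → [∀ i, MonObj (F i)] → MonObj (tensorFam n F)
  | 0, _, _ => (inferInstance : MonObj (𝟙_ C))
  | n + 1, F, _ =>
    haveI := famMonObj n (fun i => F i.castSucc)
    (inferInstance : MonObj (tensorFam n (fun i => F i.castSucc) ⊗ F (Fin.last n)))

instance famComonObj : (n : ℕ) → (F : Fin n → C) → [∀ i, ComonObj (F i)] →
    ComonObj (tensorFam n F)
  | 0, _, _ => (inferInstance : ComonObj (𝟙_ C))
  | n + 1, F, _ =>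
    haveI := famComonObj n (fun i => F i.castSucc)
    (inferInstance : ComonObj (tensorFam n (fun i => F i.castSucc) ⊗ F (Fin.last n)))

instance fam_isCommMonObj : (n : ℕ) → (F : Fin n → C) → [∀ i, MonObj (F i)] →
    [∀ i, IsCommMonObj (F i)] → IsCommMonObj (tensorFam n F)
  | 0, _, _, _ => (inferInstance : IsCommMonObj (𝟙_ C))
  | n + 1, F, _, _ =>
    haveI := fam_isCommMonObj n (fun i => F i.castSucc)
    (inferInstance : IsCommMonObj (tensorFam n (fun i => F i.castSucc) ⊗ F (Fin.last n)))

instance fam_isCommComonObj : (n : ℕ) → (F : Fin n → C) → [∀ i, ComonObj (F i)] →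
    [∀ i, IsCommComonObj (F i)] → IsCommComonObj (tensorFam n F)
  | 0, _, _, _ => (inferInstance : IsCommComonObj (𝟙_ C))
  | n + 1, F, _, _ =>
    haveI := fam_isCommComonObj n (fun i => F i.castSucc)
    (inferInstance : IsCommComonObj (tensorFam n (fun i => F i.castSucc) ⊗ F (Fin.last n)))

/-- A monoid and comonoid structure are compatible. -/
class IsBimon (X : C) [MonObj X] [ComonObj X] : Prop where
  mul_comul : μ[X] ≫ Δ[X] = (Δ[X] ⊗ₘ Δ[X]) ≫ tensorμ X X X X ≫ (μ[X] ⊗ₘ μ[X])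
  one_comul : η[X] ≫ Δ[X] = η[X ⊗ X]
  mul_counit : μ[X] ≫ ε[X] = ε[X ⊗ X]
  one_counit : η[X] ≫ ε[X] = 𝟙 (𝟙_ C)

theorem BimonObj.isBimon (X : C) [BimonObj X] : IsBimon X :=
  ⟨BimonObj.mul_comul X, BimonObj.one_comul X, BimonObj.mul_counit X, BimonObj.one_counit X⟩

/-- Compatibility is proved as a proposition about `famMonObj` and `famComonObj`, so that
`famBimonObj` extends exactly these structures instead of building others by a separate recursion.
-/
theorem fam_isBimon : (n : ℕ) → (F : Fin n → C) → [∀ i, BimonObj (F i)] →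
    IsBimon (tensorFam n F)
  | 0, _, _ => BimonObj.isBimon (𝟙_ C)
  | n + 1, F, _ =>
    have h := fam_isBimon n (fun i => F i.castSucc)
    letI : BimonObj (tensorFam n (fun i => F i.castSucc)) :=
      ⟨h.mul_comul, h.one_comul, h.mul_counit, h.one_counit⟩
    BimonObj.isBimon (tensorFam n (fun i => F i.castSucc) ⊗ F (Fin.last n))

instance famBimonObj (n : ℕ) (F : Fin n → C) [∀ i, BimonObj (F i)] : BimonObj (tensorFam n F) where
  mul_comul := (fam_isBimon n F).mul_comul
  one_comul := (fam_isBimon n F).one_comul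
  mul_counit := (fam_isBimon n F).mul_counit
  one_counit := (fam_isBimon n F).one_counit

/-- The projection of a tensor product of `n + 1` comonoids to the first `n` factors. -/
def famInit {n : ℕ} (F : Fin (n + 1) → C) [∀ i, ComonObj (F i)] :
    tensorFam (n + 1) F ⟶ tensorFam n (fun i => F i.castSucc) :=
  tfst (tensorFam n fun i => F i.castSucc) (F (Fin.last n))

/-- The projection of a tensor product of `n + 1` comonoids to the last factor. -/
def famLast {n : ℕ} (F : Fin (n + 1) → C) [∀ i, ComonObj (F i)] :
    tensorFam (n + 1) F ⟶ F (Fin.last n) :=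
  tsnd (tensorFam n fun i => F i.castSucc) (F (Fin.last n))

/-- The injection of the first `n` factors into a tensor product of `n + 1` monoids. -/
def famInitInj {n : ℕ} (F : Fin (n + 1) → C) [∀ i, MonObj (F i)] :
    tensorFam n (fun i => F i.castSucc) ⟶ tensorFam (n + 1) F :=
  tinl (tensorFam n fun i => F i.castSucc) (F (Fin.last n))

/-- The injection of the last factor into a tensor product of `n + 1` monoids. -/
def famLastInj {n : ℕ} (F : Fin (n + 1) → C) [∀ i, MonObj (F i)] :
    F (Fin.last n) ⟶ tensorFam (n + 1) F :=
  tinr (tensorFam n fun i => F i.castSucc) (F (Fin.last n))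

/-- The projection `e ⊗ … ⊗ 1 ⊗ … ⊗ e` of a tensor product of comonoids. -/
def famProj : (n : ℕ) → (F : Fin n → C) → [∀ i, ComonObj (F i)] → (i : Fin n) →
    (tensorFam n F ⟶ F i)
  | 0, _, _, i => i.elim0
  | n + 1, F, _, i =>
    Fin.lastCases (motive := fun i => tensorFam (n + 1) F ⟶ F i) (famLast F)
      (fun i => famInit F ≫ famProj n (fun i => F i.castSucc) i) i

/-- The injection `u ⊗ … ⊗ 1 ⊗ … ⊗ u` into a tensor product of monoids. -/
def famInj : (n : ℕ) → (F : Fin n → C) → [∀ i, MonObj (F i)] → (i : Fin n) →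
    (F i ⟶ tensorFam n F)
  | 0, _, _, i => i.elim0
  | n + 1, F, _, i =>
    Fin.lastCases (motive := fun i => F i ⟶ tensorFam (n + 1) F) (famLastInj F)
      (fun i => famInj n (fun i => F i.castSucc) i ≫ famInitInj F) i

section Comon

variable {n : ℕ} (F : Fin (n + 1) → C) [∀ i, ComonObj (F i)]

instance famInit_isComonHom : IsComonHom (famInit F) :=
  tfst_isComonHom (tensorFam n fun i => F i.castSucc) (F (Fin.last n))

instance famLast_isComonHom : IsComonHom (famLast F) :=
  tsnd_isComonHom (tensorFam n fun i => F i.castSucc) (F (Fin.last n))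

theorem famProj_last : famProj (n + 1) F (Fin.last n) = famLast F := by
  rw [famProj, Fin.lastCases_last]

theorem famProj_castSucc (i : Fin n) :
    famProj (n + 1) F i.castSucc = famInit F ≫ famProj n (fun i => F i.castSucc) i := by
  rw [famProj, Fin.lastCases_castSucc]

theorem famInit_mul_famLast {R : C} [MonObj R] (a : tensorFam n (fun i => F i.castSucc) ⟶ R)
    (b : F (Fin.last n) ⟶ R) : (famInit F ≫ a) * (famLast F ≫ b) = (a ⊗ₘ b) ≫ μ[R] :=
  tfst_mul_tsnd a b

end Comon

section Mon

variable {n : ℕ} (F : Fin (n + 1) → C) [∀ i, MonObj (F i)]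

theorem famInj_last : famInj (n + 1) F (Fin.last n) = famLastInj F := by
  rw [famInj, Fin.lastCases_last]

theorem famInj_castSucc (i : Fin n) :
    famInj (n + 1) F i.castSucc = famInj n (fun i => F i.castSucc) i ≫ famInitInj F := by
  rw [famInj, Fin.lastCases_castSucc]

theorem famInitInj_mul_famLastInj {X : C} [ComonObj X]
    (a : X ⟶ tensorFam n (fun i => F i.castSucc)) (b : X ⟶ F (Fin.last n)) :
    (a ≫ famInitInj F) * (b ≫ famLastInj F) = Δ[X] ≫ (a ⊗ₘ b) :=
  tinl_mul_tinr a b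

end Mon

section Bimon

variable {n : ℕ} (F : Fin (n + 1) → C) [∀ i, BimonObj (F i)]

instance famInitInj_isComonHom : IsComonHom (famInitInj F) :=
  tinl_isComonHom (tensorFam n fun i => F i.castSucc) (F (Fin.last n))

instance famLastInj_isComonHom : IsComonHom (famLastInj F) :=
  tinr_isComonHom (tensorFam n fun i => F i.castSucc) (F (Fin.last n))

instance famInitInj_isMonHom : IsMonHom (famInitInj F) :=
  tinl_isMonHom (tensorFam n fun i => F i.castSucc) (F (Fin.last n))

instance famLastInj_isMonHom : IsMonHom (famLastInj F) :=
  tinr_isMonHom (tensorFam n fun i => F i.castSucc) (F (Fin.last n))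

instance famInit_isMonHom : IsMonHom (famInit F) :=
  tfst_isMonHom (tensorFam n fun i => F i.castSucc) (F (Fin.last n))

instance famLast_isMonHom : IsMonHom (famLast F) :=
  tsnd_isMonHom (tensorFam n fun i => F i.castSucc) (F (Fin.last n))

theorem famInitInj_famInit : famInitInj F ≫ famInit F = 𝟙 _ :=
  tinl_tfst (tensorFam n fun i => F i.castSucc) (F (Fin.last n))

theorem famLastInj_famLast : famLastInj F ≫ famLast F = 𝟙 _ :=
  tinr_tsnd (tensorFam n fun i => F i.castSucc) (F (Fin.last n))

theorem famInitInj_famLast : famInitInj F ≫ famLast F = 1 :=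
  tinl_tsnd (tensorFam n fun i => F i.castSucc) (F (Fin.last n))

theorem famLastInj_famInit : famLastInj F ≫ famInit F = 1 :=
  tinr_tfst (tensorFam n fun i => F i.castSucc) (F (Fin.last n))

theorem famInit_famInitInj_mul :
    (famInit F ≫ famInitInj F) * (famLast F ≫ famLastInj F) = 𝟙 (tensorFam (n + 1) F) :=
  tfst_tinl_mul_tsnd_tinr (tensorFam n fun i => F i.castSucc) (F (Fin.last n))

end Bimon

instance famProj_isComonHom : (n : ℕ) → (F : Fin n → C) → [∀ i, ComonObj (F i)] → (i : Fin n) →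
    IsComonHom (famProj n F i)
  | 0, _, _, i => i.elim0
  | n + 1, F, _, i => by
    have := famProj_isComonHom n fun i => F i.castSucc
    refine Fin.lastCases ?_ (fun i => ?_) i
    · rw [famProj_last]; infer_instance
    · rw [famProj_castSucc]; infer_instance

instance famProj_isMonHom : (n : ℕ) → (F : Fin n → C) → [∀ i, BimonObj (F i)] → (i : Fin n) →
    IsMonHom (famProj n F i)
  | 0, _, _, i => i.elim0
  | n + 1, F, _, i => by
    have := famProj_isMonHom n fun i => F i.castSucc
    refine Fin.lastCases ?_ (fun i => ?_) i
    · rw [famProj_last]; infer_instance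
    · rw [famProj_castSucc]; infer_instance

instance famInj_isComonHom : (n : ℕ) → (F : Fin n → C) → [∀ i, BimonObj (F i)] → (i : Fin n) →
    IsComonHom (famInj n F i)
  | 0, _, _, i => i.elim0
  | n + 1, F, _, i => by
    have := famInj_isComonHom n fun i => F i.castSucc
    refine Fin.lastCases ?_ (fun i => ?_) i
    · rw [famInj_last]; infer_instance
    · rw [famInj_castSucc]; infer_instance

instance famInj_isMonHom : (n : ℕ) → (F : Fin n → C) → [∀ i, BimonObj (F i)] → (i : Fin n) →
    IsMonHom (famInj n F i)
  | 0, _, _, i => i.elim0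
  | n + 1, F, _, i => by
    have := famInj_isMonHom n fun i => F i.castSucc
    refine Fin.lastCases ?_ (fun i => ?_) i
    · rw [famInj_last]; infer_instance
    · rw [famInj_castSucc]; infer_instance

theorem famInj_famProj : (n : ℕ) → (F : Fin n → C) → [∀ i, BimonObj (F i)] → (i : Fin n) →
    famInj n F i ≫ famProj n F i = 𝟙 (F i)
  | 0, _, _, i => i.elim0
  | n + 1, F, _, i => by
    refine Fin.lastCases ?_ (fun i => ?_) i
    · rw [famProj_last, famInj_last, famLastInj_famLast]
    · rw [famProj_castSucc, famInj_castSucc, Category.assoc, reassoc_of% famInitInj_famInit,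
        famInj_famProj n fun i => F i.castSucc]

theorem famInj_famProj_ne : (n : ℕ) → (F : Fin n → C) → [∀ i, BimonObj (F i)] → (i j : Fin n) →
    i ≠ j → famInj n F i ≫ famProj n F j = 1
  | 0, _, _, i, _, _ => i.elim0
  | n + 1, F, _, i, j, h => by
    revert h
    refine Fin.lastCases ?_ (fun i => ?_) i <;> refine Fin.lastCases ?_ (fun j => ?_) j <;> intro h
    · exact absurd rfl h
    · rw [famInj_last, famProj_castSucc, reassoc_of% famLastInj_famInit, conv_one_comp]
    · rw [famInj_castSucc, famProj_last, Category.assoc, famInitInj_famLast, comp_conv_one]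
    · rw [famProj_castSucc, famInj_castSucc, Category.assoc, reassoc_of% famInitInj_famInit,
        famInj_famProj_ne n (fun i => F i.castSucc) i j fun h' => h (h' ▸ rfl)]

/-- A tensor product of maps into a commutative monoid, followed by the multiplication. -/
theorem tensorFamMap_iterMul {R : C} [MonObj R] [IsCommMonObj R] : (n : ℕ) → (F : Fin n → C) →
    [∀ i, ComonObj (F i)] → [∀ i, IsCommComonObj (F i)] → (a : ∀ i, F i ⟶ R) →
    tensorFamMap n a ≫ iterMul μ[R] η[R] n = ∏ i, famProj n F i ≫ a i
  | 0, _, _, _, _ => rfl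
  | n + 1, F, _, _, a => by
    rw [Fin.prod_univ_castSucc]
    simp only [famProj_last, famProj_castSucc, Category.assoc]
    -- The first `n` factors share the comonoid map `famInit`, which is pulled out of their product;
    -- what remains is the inductive hypothesis times the last factor.
    rw [← comp_conv_prod, ← tensorFamMap_iterMul n (fun i => F i.castSucc), famInit_mul_famLast]
    change (tensorFamMap n (fun i => a i.castSucc) ⊗ₘ a (Fin.last n)) ≫
      (iterMul μ[R] η[R] n ▷ R) ≫ μ[R] = _
    rw [← tensorHom_id, tensorHom_comp_tensorHom_assoc, Category.comp_id]

/-- The iterated comultiplication of a cocommutative comonoid, followed by a tensor product of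
maps to commutative monoids. -/
theorem iterComul_tensorFamMap {X : C} [ComonObj X] [IsCommComonObj X] : (n : ℕ) →
    (F : Fin n → C) → [∀ i, BimonObj (F i)] → [∀ i, IsCommMonObj (F i)] → (b : ∀ i, X ⟶ F i) →
    iterComul Δ[X] ε[X] n ≫ tensorFamMap n b = ∏ i, b i ≫ famInj n F i
  | 0, _, _, _, _ => rfl
  | n + 1, F, _, _, b => by
    rw [Fin.prod_univ_castSucc]
    simp only [famInj_last, famInj_castSucc, ← Category.assoc]
    rw [← conv_prod_comp, ← iterComul_tensorFamMap n (fun i => F i.castSucc),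
      famInitInj_mul_famLastInj]
    change (Δ[X] ≫ iterComul Δ[X] ε[X] n ▷ X) ≫
      (tensorFamMap n (fun i => b i.castSucc) ⊗ₘ b (Fin.last n)) = _
    rw [← tensorHom_id, Category.assoc, tensorHom_comp_tensorHom, Category.id_comp]

/-- The multiplicative analogue of the decomposition of the identity of a biproduct as a sum of
idempotents. The inductive step is the binary case `famInit_famInitInj_mul`. -/
theorem prod_famProj_famInj : (n : ℕ) → (F : Fin n → C) → [∀ i, BimonObj (F i)] →
    [∀ i, IsCommMonObj (F i)] → [∀ i, IsCommComonObj (F i)] →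
    ∏ i, famProj n F i ≫ famInj n F i = 𝟙 (tensorFam n F)
  | 0, _, _, _, _ => Category.id_comp (𝟙 (𝟙_ C))
  | n + 1, F, _, _, _ => by
    rw [Fin.prod_univ_castSucc]
    simp only [famProj_last, famProj_castSucc, famInj_last, famInj_castSucc, Category.assoc]
    simp only [← Category.assoc (famProj n _ _)]
    rw [← comp_conv_prod, ← conv_prod_comp, prod_famProj_famInj n fun i => F i.castSucc,
      Category.id_comp, famInit_famInitInj_mul]

section

variable {n : ℕ} {F : Fin n → C} [∀ i, BimonObj (F i)] [∀ i, IsCommMonObj (F i)]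
  [∀ i, IsCommComonObj (F i)]

theorem comp_eq_prod_famProj {X : C} [ComonObj X] [IsCommComonObj X] (f : X ⟶ tensorFam n F)
    [IsComonHom f] : f = ∏ i, (f ≫ famProj n F i) ≫ famInj n F i := by
  simp only [Category.assoc]
  rw [← comp_conv_prod, prod_famProj_famInj, Category.comp_id]

/-- Comonoid maps to a tensor product of bimonoids are determined by their components. -/
theorem fam_hom_ext {X : C} [ComonObj X] [IsCommComonObj X] {f g : X ⟶ tensorFam n F}
    [IsComonHom f] [IsComonHom g] (h : ∀ i, f ≫ famProj n F i = g ≫ famProj n F i) : f = g := by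
  rw [comp_eq_prod_famProj f, comp_eq_prod_famProj g]
  simp only [h]

/-- Projection is a monoid map, so it acts on each factor; those with `j ≠ i` become the convolution
unit because `f j` preserves counits. -/
theorem prod_famInj_famProj {X : C} [ComonObj X] [IsCommComonObj X] (f : ∀ i, X ⟶ F i)
    [∀ i, IsComonHom (f i)] (i : Fin n) :
    (∏ j, f j ≫ famInj n F j) ≫ famProj n F i = f i := by
  rw [conv_prod_comp, Finset.prod_eq_single i]
  · rw [Category.assoc, famInj_famProj, Category.comp_id]
  · intro j _ h
    rw [Category.assoc, famInj_famProj_ne n F j i h, comp_conv_one]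
  · simp

theorem famInj_prod_famProj {R : C} [MonObj R] [IsCommMonObj R] (f : ∀ i, F i ⟶ R)
    [∀ i, IsMonHom (f i)] (i : Fin n) :
    famInj n F i ≫ (∏ j, famProj n F j ≫ f j) = f i := by
  rw [comp_conv_prod, Finset.prod_eq_single i]
  · rw [reassoc_of% famInj_famProj]
  · intro j _ h
    rw [reassoc_of% (famInj_famProj_ne n F i j h.symm), conv_one_comp]
  · simp

end

end Families

/-! ### The modality in the language of bimonoids and convolution -/

section ModalityInstances

variable {C : Type u} [Category.{v} C] [MonoidalCategory C] [SymmetricCategory C]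
  [AdditiveCategory C] [AdditiveMonoidal C] (M : BialgebraModalityData C)

section Instances

variable [hM : Fact M.IsAdditiveBialgebraModality]

/-- The `Fact` makes the axioms of the modality available to instance search, so that each `!A`, and
then each tensor product of such objects, is found to be a bimonoid. -/
instance bangBimonObj (A : C) : BimonObj (M.obj A) where
  one := M.u A
  mul := M.mul A
  one_mul := hM.out.u_mul A
  mul_one := hM.out.mul_u A
  mul_assoc := hM.out.mul_assoc A
  counit := M.e A
  comul := M.Δ A
  counit_comul := by
    have h := hM.out.Δ_left_counit A
    rw [← Category.assoc] at h
    exact (Iso.comp_hom_eq_id _).1 h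
  comul_counit := by
    have h := hM.out.Δ_right_counit A
    rw [← Category.assoc] at h
    exact (Iso.comp_hom_eq_id _).1 h
  comul_assoc := (hM.out.Δ_coassoc A).symm
  mul_comul := hM.out.mul_Δ A
  one_comul := hM.out.u_Δ A
  mul_counit := hM.out.mul_e A
  one_counit := hM.out.u_e A

instance bang_isCommMonObj (A : C) : IsCommMonObj (M.obj A) where
  mul_comm := hM.out.mul_comm A

instance bang_isCommComonObj (A : C) : IsCommComonObj (M.obj A) where
  comul_comm := hM.out.Δ_cocomm A

variable {M}

instance map_isComonHom {A B : C} (f : A ⟶ B) : IsComonHom (M.map f) where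
  hom_counit := hM.out.e_natural f
  hom_comul := hM.out.Δ_natural f

instance map_isMonHom {A B : C} (f : A ⟶ B) : IsMonHom (M.map f) where
  one_hom := hM.out.u_natural f
  mul_hom := (hM.out.mul_natural f).symm

theorem map_comp {A B D : C} (f : A ⟶ B) (g : B ⟶ D) : M.map (f ≫ g) = M.map f ≫ M.map g :=
  hM.out.map_comp f g

theorem δ_natural {A B : C} (f : A ⟶ B) : M.map f ≫ M.δ B = M.δ A ≫ M.map (M.map f) :=
  hM.out.δ_natural f

theorem ε_natural {A B : C} (f : A ⟶ B) : M.map f ≫ M.ε B = M.ε A ≫ f := hM.out.ε_natural f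

theorem δ_ε (A : C) : M.δ A ≫ M.ε (M.obj A) = 𝟙 (M.obj A) := hM.out.left_counit A

theorem δ_map_ε (A : C) : M.δ A ≫ M.map (M.ε A) = 𝟙 (M.obj A) := hM.out.right_counit A

theorem δ_δ (A : C) : M.δ A ≫ M.δ (M.obj A) = M.δ A ≫ M.map (M.δ A) := hM.out.coassoc A

instance δ_isComonHom (A : C) : IsComonHom (M.δ A) where
  hom_counit := by
    -- That `δ` preserves `e` is not an axiom. It follows from naturality of `e` along `ε` and the
    -- law `δ !(ε) = 1`.
    have h : M.map (M.ε A) ≫ ε[M.obj A] = ε[M.obj (M.obj A)] := IsComonHom.hom_counit _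
    rw [← h, reassoc_of% δ_map_ε]
  hom_comul := hM.out.δ_Δ A

theorem map_zero (A B : C) : M.map (0 : A ⟶ B) = 1 := hM.out.map_zero A B

theorem map_add {A B : C} (f g : A ⟶ B) : M.map (f + g) = M.map f * M.map g := hM.out.map_add f g

theorem map_sum {A B : C} {I : Type} (s : Finset I) (f : I → (A ⟶ B)) :
    M.map (∑ i ∈ s, f i) = ∏ i ∈ s, M.map (f i) := by
  classical
  induction s using Finset.induction_on with
  | empty => exact map_zero A B
  | insert i s h ih => rw [Finset.sum_insert h, Finset.prod_insert h, map_add, ih]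

/-- The unit absorbs `!(0)`, and naturality of `ε` turns `!(0)` into composition with zero. -/
theorem one_ε (A : C) : η[M.obj A] ≫ M.ε A = 0 := by
  have h : η[M.obj A] ≫ M.map (0 : A ⟶ A) = η[M.obj A] := IsMonHom.one_hom _
  rw [← h, Category.assoc, ε_natural, AdditiveCategory.comp_zero, AdditiveCategory.comp_zero]

theorem conv_one_ε {X : C} [ComonObj X] (A : C) : (1 : X ⟶ M.obj A) ≫ M.ε A = 0 := by
  rw [conv_one, Category.assoc, one_ε, AdditiveCategory.comp_zero]

/-- In `∇ ε = ε ⊗ e + e ⊗ ε` the factor `e` erases a comonoid map, so that `ε` carries convolution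
of comonoid maps to addition. -/
theorem conv_mul_ε {X A : C} [ComonObj X] (f g : X ⟶ M.obj A) [IsComonHom f] [IsComonHom g] :
    (f * g) ≫ M.ε A = f ≫ M.ε A + g ≫ M.ε A := by
  have h : μ[M.obj A] ≫ M.ε A = (M.ε A ⊗ₘ ε[M.obj A]) ≫ (ρ_ A).hom +
      (ε[M.obj A] ⊗ₘ M.ε A) ≫ (λ_ A).hom := hM.out.mul_ε A
  rw [conv_mul, Category.assoc, Category.assoc, h, AdditiveCategory.comp_add,
    AdditiveCategory.comp_add, tensorHom_comp_tensorHom_assoc, tensorHom_comp_tensorHom_assoc,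
    IsComonHom.hom_counit, IsComonHom.hom_counit, ComonObj.comul_counit_hom_assoc,
    ComonObj.counit_comul_hom_assoc, Iso.inv_hom_id, Iso.inv_hom_id, Category.comp_id,
    Category.comp_id]

theorem conv_prod_ε {X A : C} [ComonObj X] [IsCommComonObj X] {I : Type} (s : Finset I)
    (f : I → (X ⟶ M.obj A)) [∀ i, IsComonHom (f i)] :
    (∏ i ∈ s, f i) ≫ M.ε A = ∑ i ∈ s, f i ≫ M.ε A := by
  classical
  induction s using Finset.induction_on with
  | empty => exact conv_one_ε A
  | insert i s h ih =>
    have := conv_prod_isComonHom s f fun _ _ => inferInstance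
    rw [Finset.sum_insert h, Finset.prod_insert h, conv_mul_ε, ih]

end Instances

section Bang

variable {M} [hM : Fact M.IsAdditiveBialgebraModality]

/-- This and the next lemmas identify the explicit recursive formulas for the modality with the
structure maps of the tensor product bimonoid. -/
theorem bangE_eq : (n : ℕ) → (F : Fin n → C) → bangE M n F = ε[bang M F]
  | 0, _ => rfl
  | n + 1, F => by rw [bangE, bangE_eq n]; rfl

theorem bangU_eq : (n : ℕ) → (F : Fin n → C) → bangU M n F = η[bang M F]
  | 0, _ => rfl
  | n + 1, F => by rw [bangU, bangU_eq n]; rfl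

theorem bangΔ_eq : (n : ℕ) → (F : Fin n → C) → bangΔ M n F = Δ[bang M F]
  | 0, _ => rfl
  | n + 1, F => by
    rw [bangΔ, bangΔ_eq n]
    exact (Comon.tensorObj_comul (bang M fun i => F i.castSucc) (M.obj (F (Fin.last n)))).symm

theorem bangMul_eq : (n : ℕ) → (F : Fin n → C) → bangMul M n F = μ[bang M F]
  | 0, _ => rfl
  | n + 1, F => by rw [bangMul, bangMul_eq n]; rfl

theorem bangProj_eq : (n : ℕ) → (F : Fin n → C) → (i : Fin n) →
    bangProj M n F i = famProj n (fun i => M.obj (F i)) i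
  | 0, _, i => i.elim0
  | n + 1, F, i => by
    refine Fin.lastCases ?_ (fun i => ?_) i
    · rw [bangProj, Fin.lastCases_last, famProj_last, bangE_eq, tensorHom_id]; rfl
    · rw [bangProj, Fin.lastCases_castSucc, famProj_castSucc, bangProj_eq n]
      exact tensorHom_counit_rightUnitor _

theorem bangInj_eq : (n : ℕ) → (F : Fin n → C) → (i : Fin n) →
    bangInj M n F i = famInj n (fun i => M.obj (F i)) i
  | 0, _, i => i.elim0
  | n + 1, F, i => by
    refine Fin.lastCases ?_ (fun i => ?_) i
    · rw [bangInj, Fin.lastCases_last, famInj_last, bangU_eq, tensorHom_id]; rfl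
    · rw [bangInj, Fin.lastCases_castSucc, famInj_castSucc, bangInj_eq n]
      exact rightUnitor_inv_tensorHom_one _

theorem bangMap_eq {n m : ℕ} {F : Fin n → C} {G : Fin m → C} (f : ∀ i j, F i ⟶ G j) :
    bangMap M f = ∏ i, famProj n (fun i => M.obj (F i)) i ≫
      ∏ j, M.map (f i j) ≫ famInj m (fun j => M.obj (G j)) j := by
  rw [bangMap, bangMul_eq, bangU_eq, tensorFamMap_iterMul]
  refine Finset.prod_congr rfl fun i _ => congrArg (_ ≫ ·) ?_
  exact iterComul_tensorFamMap m _ _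

/-- The comonoid map `!A₁ ⊗ … ⊗ !Aₙ ⟶ !(!A₁ ⊗ … ⊗ !Aₙ)` which is the convolution of the maps
`δ !(u ⊗ … ⊗ 1 ⊗ … ⊗ u)` on the factors. -/
def bangSection {n : ℕ} (F : Fin n → C) : bang M F ⟶ M.obj (bang M F) :=
  ∏ i, famProj n (fun i => M.obj (F i)) i ≫ M.δ (F i) ≫
    M.map (famInj n (fun i => M.obj (F i)) i)

/-- The comonoid map `!X ⟶ !B₁ ⊗ … ⊗ !Bₘ` whose components are the maps `!(g j)`. -/
def bangLift {X : C} {m : ℕ} {G : Fin m → C} (g : ∀ j, X ⟶ G j) : M.obj X ⟶ bang M G :=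
  ∏ j, M.map (g j) ≫ famInj m (fun j => M.obj (G j)) j

theorem bangδ_eq {n : ℕ} (F : Fin n → C) :
    bangδ M F = bangSection F ≫ M.δ (bang M F) ≫
      M.map (bangLift fun i => famProj n (fun i => M.obj (F i)) i ≫ M.ε (F i)) := by
  have h₁ := tensorFamMap_iterMul (R := M.obj (bang M F)) n (fun i => M.obj (F i))
    (fun i => M.δ (F i) ≫ M.map (famInj n (fun i => M.obj (F i)) i))
  have h₂ := iterComul_tensorFamMap (X := M.obj (bang M F)) n (fun i => M.obj (F i))
    (fun i => M.map (famProj n (fun i => M.obj (F i)) i ≫ M.ε (F i)))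
  rw [bangSection, bangLift, ← h₁, ← h₂, bangδ]
  simp only [bangProj_eq, bangInj_eq, Category.assoc]
  rfl

end Bang

end ModalityInstances

/-! ### Functoriality and additivity on matrices -/

section BangFunctor

variable {C : Type u} [Category.{v} C] [MonoidalCategory C] [SymmetricCategory C]
  [AdditiveCategory C] [AdditiveMonoidal C] {M : BialgebraModalityData C}
  [hM : Fact M.IsAdditiveBialgebraModality]

section BangMap

variable {n m : ℕ} {F : Fin n → C} {G : Fin m → C}

/-- `e ⊗ … ⊗ 1 ⊗ … ⊗ e : !A₁ ⊗ … ⊗ !Aₙ ⟶ !Aᵢ` -/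
abbrev proj (M : BialgebraModalityData C) [Fact M.IsAdditiveBialgebraModality] {n : ℕ}
    (F : Fin n → C) (i : Fin n) : bang M F ⟶ M.obj (F i) := famProj n (fun i => M.obj (F i)) i

/-- `u ⊗ … ⊗ 1 ⊗ … ⊗ u : !Aᵢ ⟶ !A₁ ⊗ … ⊗ !Aₙ` -/
abbrev inj (M : BialgebraModalityData C) [Fact M.IsAdditiveBialgebraModality] {n : ℕ}
    (F : Fin n → C) (i : Fin n) : M.obj (F i) ⟶ bang M F := famInj n (fun i => M.obj (F i)) i

instance bangLift_isComonHom {X : C} (g : ∀ j, X ⟶ G j) : IsComonHom (bangLift (M := M) g) :=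
  conv_prod_isComonHom _ _ fun _ _ => inferInstance

instance bangLift_isMonHom {X : C} (g : ∀ j, X ⟶ G j) : IsMonHom (bangLift (M := M) g) :=
  conv_prod_isMonHom _ _ fun _ _ => inferInstance

theorem bangMap_eq_prod (f : ∀ i j, F i ⟶ G j) :
    bangMap M f = ∏ i, proj M F i ≫ bangLift (f i) := bangMap_eq f

instance bangMap_isComonHom (f : ∀ i j, F i ⟶ G j) : IsComonHom (bangMap M f) := by
  rw [bangMap_eq_prod]
  exact conv_prod_isComonHom _ _ fun _ _ => inferInstance

instance bangMap_isMonHom (f : ∀ i j, F i ⟶ G j) : IsMonHom (bangMap M f) := by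
  rw [bangMap_eq_prod]
  exact conv_prod_isMonHom _ _ fun _ _ => inferInstance

instance bangSection_isComonHom (F : Fin n → C) : IsComonHom (bangSection (M := M) F) :=
  conv_prod_isComonHom _ _ fun _ _ => inferInstance

instance bangδ_isComonHom (F : Fin n → C) : IsComonHom (bangδ M F) := by
  rw [bangδ_eq]; infer_instance

theorem bangLift_proj {X : C} (g : ∀ j, X ⟶ G j) (j : Fin m) :
    bangLift g ≫ proj M G j = M.map (g j) :=
  prod_famInj_famProj (fun j => M.map (g j)) j

theorem bangMap_proj (f : ∀ i j, F i ⟶ G j) (j : Fin m) :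
    bangMap M f ≫ proj M G j = ∏ i, proj M F i ≫ M.map (f i j) := by
  rw [bangMap_eq_prod, conv_prod_comp]
  simp only [Category.assoc, bangLift_proj]

theorem inj_bangMap (f : ∀ i j, F i ⟶ G j) (i : Fin n) :
    inj M F i ≫ bangMap M f = bangLift (f i) := by
  rw [bangMap_eq_prod]
  exact famInj_prod_famProj (fun i => bangLift (f i)) i

theorem bangMap_id (F : Fin n → C) : bangMap M (delta F) = 𝟙 (bang M F) := by
  refine fam_hom_ext fun j => ?_
  rw [Category.id_comp]
  refine (bangMap_proj _ _).trans ((Finset.prod_eq_single j ?_ (by simp)).trans ?_)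
  · intro i _ h
    rw [delta_ne F h, map_zero, comp_conv_one]
  · rw [delta_self, hM.out.map_id, Category.comp_id]

/-- On components, `!` of the sum defining an entry of the matrix product is a convolution product
over the middle index, and the two sides differ only in the order of a double product. -/
theorem bangMap_comp {k : ℕ} {H : Fin k → C} (f : ∀ i j, F i ⟶ G j) (g : ∀ i j, G i ⟶ H j) :
    bangMap M (fun i k => ∑ j, f i j ≫ g j k) = bangMap M f ≫ bangMap M g := by
  refine fam_hom_ext fun k => ?_
  refine (bangMap_proj _ _).trans (((Category.assoc _ _ _).trans
    (congrArg (_ ≫ ·) (bangMap_proj g k))).trans ?_).symm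
  rw [comp_conv_prod]
  simp only [← Category.assoc]
  simp only [bangMap_proj, conv_prod_comp, Category.assoc, map_sum, map_comp, comp_conv_prod]
  exact Finset.prod_comm

theorem bangMap_add (f g : ∀ i j, F i ⟶ G j) :
    bangMap M (fun i j => f i j + g i j) = bangMap M f * bangMap M g := by
  refine fam_hom_ext fun j => ?_
  rw [conv_mul_comp]
  refine (bangMap_proj _ _).trans ?_
  simp only [map_add, comp_conv_mul, Finset.prod_mul_distrib]
  exact (congrArg₂ (· * ·) (bangMap_proj f j) (bangMap_proj g j)).symm

theorem bangMap_zero (F : Fin n → C) (G : Fin m → C) :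
    bangMap M (fun i j => (0 : F i ⟶ G j)) = 1 := by
  refine fam_hom_ext fun j => ?_
  rw [conv_one_comp]
  refine (bangMap_proj _ _).trans (Finset.prod_eq_one fun i _ => ?_)
  rw [map_zero, comp_conv_one]

end BangMap

/-! ### The comonad structure, from a retraction of `!T` onto `T` -/

section Comultiplication

variable {n m : ℕ} {F : Fin n → C} {G : Fin m → C}

/-- `e ⊗ … ⊗ ε ⊗ … ⊗ e : !A₁ ⊗ … ⊗ !Aₙ ⟶ Aᵢ` -/
def projε (M : BialgebraModalityData C) [Fact M.IsAdditiveBialgebraModality] {n : ℕ}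
    (F : Fin n → C) (i : Fin n) : bang M F ⟶ F i := proj M F i ≫ M.ε (F i)

/-- The comonoid map `!(!A₁ ⊗ … ⊗ !Aₙ) ⟶ !A₁ ⊗ … ⊗ !Aₙ` whose components are the maps
`!(e ⊗ … ⊗ ε ⊗ … ⊗ e)`. -/
def bangRetraction (M : BialgebraModalityData C) [Fact M.IsAdditiveBialgebraModality] {n : ℕ}
    (F : Fin n → C) : M.obj (bang M F) ⟶ bang M F := bangLift (projε M F)

instance bangRetraction_isComonHom (F : Fin n → C) : IsComonHom (bangRetraction M F) :=
  bangLift_isComonHom _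

theorem bangδ_eq_comp (F : Fin n → C) :
    bangδ M F = bangSection F ≫ M.δ (bang M F) ≫ M.map (bangRetraction M F) := bangδ_eq F

theorem bangRetraction_proj (F : Fin n → C) (i : Fin n) :
    bangRetraction M F ≫ proj M F i = M.map (projε M F i) :=
  bangLift_proj (projε M F) i

theorem bangLift_projε {X : C} (g : ∀ j, X ⟶ G j) (j : Fin m) :
    bangLift g ≫ projε M G j = M.ε X ≫ g j := by
  rw [projε, ← Category.assoc, bangLift_proj, ε_natural]

theorem map_bangLift {X Y : C} (h : Y ⟶ X) (g : ∀ j, X ⟶ G j) :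
    M.map h ≫ bangLift g = bangLift fun j => h ≫ g j := by
  rw [bangLift, comp_conv_prod]
  simp only [← Category.assoc, ← map_comp]
  rfl

theorem inj_projε (F : Fin n → C) (i : Fin n) : inj M F i ≫ projε M F i = M.ε (F i) := by
  rw [projε, ← Category.assoc, famInj_famProj, Category.id_comp]

theorem inj_projε_ne (F : Fin n → C) {i j : Fin n} (h : i ≠ j) :
    inj M F i ≫ projε M F j = 0 := by
  rw [projε, ← Category.assoc, famInj_famProj_ne n _ i j h, conv_one_ε]

/-- On the `j`-th component, the factor `i = j` gives `δ !(ε) = 1`, and any other factor contains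
`!(0)`, the convolution unit. -/
theorem bangSection_retraction (F : Fin n → C) :
    bangSection F ≫ bangRetraction M F = 𝟙 (bang M F) := by
  refine fam_hom_ext fun j => ?_
  rw [Category.assoc, bangRetraction_proj, Category.id_comp, bangSection, conv_prod_comp,
    Finset.prod_eq_single j]
  · rw [Category.assoc, Category.assoc, ← map_comp]
    have h := inj_projε (M := M) F j
    rw [h, δ_map_ε, Category.comp_id]
  · intro i _ h
    have h' := inj_projε_ne (M := M) F h
    rw [Category.assoc, Category.assoc, ← map_comp, h', map_zero, comp_conv_one, comp_conv_one]
  · simp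

theorem bangLift_bangSection {X : C} (g : ∀ j, X ⟶ G j) :
    bangLift g ≫ bangSection G =
      M.δ X ≫ M.map (∑ j, M.map (g j) ≫ inj M G j) := by
  rw [bangSection, comp_conv_prod, map_sum, comp_conv_prod]
  refine Finset.prod_congr rfl fun j _ => ?_
  rw [← Category.assoc]
  refine (congrArg (· ≫ _) (bangLift_proj g j)).trans ?_
  rw [map_comp, ← Category.assoc, δ_natural, Category.assoc]

/-- The maps `bangLift g` are coalgebra maps. -/
theorem bangLift_bangδ {X : C} (g : ∀ j, X ⟶ G j) :
    bangLift g ≫ bangδ M G = M.δ X ≫ M.map (bangLift g) := by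
  -- Since the section is split by the retraction, `bangLift g` has the form δ !(k) r. The claim
  -- then follows from naturality and coassociativity of the given δ.
  have h : bangLift g = M.δ X ≫ M.map (∑ j, M.map (g j) ≫ inj M G j) ≫ bangRetraction M G := by
    rw [← Category.assoc, ← bangLift_bangSection, Category.assoc, bangSection_retraction,
      Category.comp_id]
  rw [bangδ_eq_comp, ← Category.assoc, bangLift_bangSection, Category.assoc, ← Category.assoc _ _
    (M.map _), δ_natural, Category.assoc, ← Category.assoc, δ_δ, Category.assoc, ← map_comp,
    ← map_comp, ← h]

theorem bangδ_δ (F : Fin n → C) :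
    bangδ M F ≫ M.δ (bang M F) = bangδ M F ≫ M.map (bangδ M F) := by
  have h := bangLift_bangδ (M := M) (projε M F)
  -- The retraction is itself a `bangLift`, hence a coalgebra map from `!T` with its given
  -- comultiplication.
  change bangRetraction M F ≫ bangδ M F = M.δ _ ≫ M.map (bangRetraction M F) at h
  have e : bangδ M F ≫ M.map (bangδ M F) =
      bangSection F ≫ M.δ (bang M F) ≫ M.map (bangRetraction M F ≫ bangδ M F) := by
    rw [map_comp, ← Category.assoc (M.δ _), ← Category.assoc, ← bangδ_eq_comp]
  rw [e, h, bangδ_eq_comp, Category.assoc, Category.assoc, δ_natural, ← Category.assoc (M.δ _),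
    δ_δ, Category.assoc, ← map_comp]

theorem bangMap_bangδ (f : ∀ i j, F i ⟶ G j) :
    bangMap M f ≫ bangδ M G = bangδ M F ≫ M.map (bangMap M f) := by
  -- A matrix map need not be a `bangLift`, but it becomes one after the retraction. Precomposing
  -- with the section recovers the matrix map.
  have h : bangRetraction M F ≫ bangMap M f = bangLift fun j => ∑ i, projε M F i ≫ f i j := by
    refine fam_hom_ext fun j => ?_
    refine ((Category.assoc _ _ _).trans (congrArg (_ ≫ ·) (bangMap_proj f j))).trans
      (Eq.trans ?_ (bangLift_proj _ j).symm)
    rw [comp_conv_prod, map_sum]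
    refine Finset.prod_congr rfl fun i _ => ?_
    rw [← Category.assoc, bangRetraction_proj, map_comp]
  have h' : bangMap M f = bangSection F ≫ bangLift fun j => ∑ i, projε M F i ≫ f i j := by
    rw [← h, ← Category.assoc, bangSection_retraction, Category.id_comp]
  conv_lhs => rw [h', Category.assoc, bangLift_bangδ, ← h, map_comp]
  rw [bangδ_eq_comp, Category.assoc, Category.assoc]

theorem bangδ_ε (F : Fin n → C) : bangδ M F ≫ M.ε (bang M F) = 𝟙 (bang M F) := by
  rw [bangδ_eq_comp, Category.assoc, Category.assoc, ε_natural, ← Category.assoc (M.δ _), δ_ε,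
    Category.id_comp, bangSection_retraction]

/-- Applying `!` to the retraction r or to `ε` makes no difference before a further r: the
components only involve r followed by `projε`, which is `ε` followed by `projε`. -/
theorem bangδ_retraction (F : Fin n → C) :
    bangδ M F ≫ bangRetraction M F = 𝟙 (bang M F) := by
  have h : M.map (bangRetraction M F) ≫ bangRetraction M F =
      M.map (M.ε (bang M F)) ≫ bangRetraction M F := by
    refine (map_bangLift _ _).trans (Eq.trans ?_ (map_bangLift _ _).symm)
    congr 1
    funext j
    exact bangLift_projε _ j
  rw [bangδ_eq_comp, Category.assoc, Category.assoc, h, ← Category.assoc (M.δ _), δ_map_ε,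
    Category.id_comp, bangSection_retraction]

theorem bangMap_projε (f : ∀ i j, F i ⟶ G j) (j : Fin m) :
    bangMap M f ≫ projε M G j = ∑ i, projε M F i ≫ f i j := by
  rw [projε, ← Category.assoc, bangMap_proj, conv_prod_ε]
  refine Finset.sum_congr rfl fun i _ => ?_
  rw [Category.assoc, ε_natural, projε, Category.assoc]

theorem mul_projε (F : Fin n → C) (j : Fin n) :
    μ[bang M F] ≫ projε M F j = (projε M F j ⊗ₘ ε[bang M F]) ≫ (ρ_ _).hom +
      (ε[bang M F] ⊗ₘ projε M F j) ≫ (λ_ _).hom := by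
  have h : μ[M.obj (F j)] ≫ M.ε (F j) = (M.ε (F j) ⊗ₘ ε[M.obj (F j)]) ≫ (ρ_ _).hom +
      (ε[M.obj (F j)] ⊗ₘ M.ε (F j)) ≫ (λ_ _).hom := hM.out.mul_ε (F j)
  rw [projε, ← Category.assoc, IsMonHom.mul_hom, Category.assoc, h, AdditiveCategory.comp_add,
    tensorHom_comp_tensorHom_assoc, tensorHom_comp_tensorHom_assoc, IsComonHom.hom_counit]

end Comultiplication

end BangFunctor

/-! ### Coactions and convolution on maps out of `T ⊗ A` -/

section Coaction

variable {C : Type u} [Category.{v} C] [MonoidalCategory C] [SymmetricCategory C]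

/-- For a comonoid `T`, the map `T ⊗ A ⟶ T ⊗ (T ⊗ A) ⟶ Y ⊗ Z` given by `f` and `w`. -/
def coact {T A Y Z : C} [ComonObj T] (f : T ⟶ Y) (w : T ⊗ A ⟶ Z) : T ⊗ A ⟶ Y ⊗ Z :=
  Δ[T] ▷ A ≫ (α_ T T A).hom ≫ (f ⊗ₘ w)

/-- The action of a map `f : T ⟶ R` from a comonoid to a monoid on a map `h : T ⊗ A ⟶ R`, by
convolution. -/
def convAct {T A R : C} [ComonObj T] [MonObj R] (f : T ⟶ R) (h : T ⊗ A ⟶ R) : T ⊗ A ⟶ R :=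
  coact f h ≫ μ[R]

/-- `x ↦ (1 ⊗ x) ∇` -/
def mulRight {T A : C} [MonObj T] (x : A ⟶ T) : T ⊗ A ⟶ T := T ◁ x ≫ μ[T]

section

variable {T A Y Z : C} [ComonObj T]

theorem coact_comp {Y' Z' : C} (f : T ⟶ Y) (w : T ⊗ A ⟶ Z) (k : Y ⟶ Y') (l : Z ⟶ Z') :
    coact f w ≫ (k ⊗ₘ l) = coact (f ≫ k) (w ≫ l) := by
  rw [coact, coact, Category.assoc, Category.assoc, tensorHom_comp_tensorHom]

/-- `T ⊗ A` is a cofree `T`-comodule. This is the coassociativity of its coaction, with the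
associators settled by the pentagon. -/
theorem coaction_coassoc (T A : C) [ComonObj T] :
    Δ[T] ▷ A ≫ (α_ T T A).hom ≫ Δ[T] ▷ (T ⊗ A) ≫ (α_ T T (T ⊗ A)).hom =
      Δ[T] ▷ A ≫ (α_ T T A).hom ≫ T ◁ (Δ[T] ▷ A ≫ (α_ T T A).hom) := by
  have h := congrArg (fun t => t ▷ A ≫ (α_ T (T ⊗ T) A).hom ≫ T ◁ (α_ T T A).hom)
    (ComonObj.comul_assoc T)
  simp only [comp_whiskerRight, Category.assoc] at h
  rw [pentagon] at h
  rw [whiskerRight_tensor, MonoidalCategory.whiskerLeft_comp]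
  simp only [Category.assoc, Iso.hom_inv_id_assoc]
  simpa using h.symm

theorem whiskerRight_coact {S : C} [ComonObj S] (k : S ⟶ T) [IsComonHom k] (f : T ⟶ Y)
    (w : T ⊗ A ⟶ Z) : k ▷ A ≫ coact f w = coact (k ≫ f) (k ▷ A ≫ w) := by
  rw [coact, coact, ← comp_whiskerRight_assoc, IsComonHom.hom_comul, comp_whiskerRight_assoc,
    ← tensorHom_id (k ⊗ₘ k) A, associator_naturality_assoc, tensorHom_comp_tensorHom,
    tensorHom_id]

theorem coact_coact {W : C} {V : C} [ComonObj Y] (s : T ⟶ Y) [IsComonHom s] (w : T ⊗ A ⟶ Z)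
    (g : Y ⟶ W) (h : Y ⊗ Z ⟶ V) :
    coact s w ≫ coact g h = coact (s ≫ g) (coact s w ≫ h) := by
  have e₁ : (s ⊗ₘ w) ≫ Δ[Y] ▷ Z ≫ (α_ Y Y Z).hom ≫ (g ⊗ₘ h) =
      Δ[T] ▷ (T ⊗ A) ≫ (α_ T T (T ⊗ A)).hom ≫ (s ≫ g ⊗ₘ (s ⊗ₘ w) ≫ h) := by
    rw [← tensorHom_comp_tensorHom, ← associator_naturality_assoc, ← tensorHom_id,
      ← tensorHom_id, tensorHom_comp_tensorHom_assoc, tensorHom_comp_tensorHom_assoc,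
      IsComonHom.hom_comul, Category.comp_id, Category.id_comp]
  have e₂ : s ≫ g ⊗ₘ (Δ[T] ▷ A ≫ (α_ T T A).hom ≫ (s ⊗ₘ w)) ≫ h =
      T ◁ (Δ[T] ▷ A ≫ (α_ T T A).hom) ≫ (s ≫ g ⊗ₘ (s ⊗ₘ w) ≫ h) := by
    rw [← id_tensorHom, tensorHom_comp_tensorHom]
    simp only [Category.id_comp, Category.assoc]
  simp only [coact, Category.assoc]
  rw [e₁]
  simp only [Category.assoc] at e₂
  rw [e₂]
  have := coaction_coassoc T A
  simp only [← Category.assoc] at this ⊢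
  rw [this]

/-- The second summand of the Leibniz rule is the first followed by the symmetry. Cocommutativity
makes it irrelevant which copy of `T` the derivation receives. -/
theorem coact_braiding [IsCommComonObj T] (d : T ⊗ A ⟶ Z) :
    Δ[T] ▷ A ≫ (α_ T T A).hom ≫ T ◁ (β_ T A).hom ≫ (α_ T A T).inv ≫ d ▷ T =
      coact (𝟙 T) d ≫ (β_ T Z).hom := by
  have h : Δ[T] ▷ A ≫ (α_ T T A).hom ≫ (β_ T (T ⊗ A)).hom =
      Δ[T] ▷ A ≫ (α_ T T A).hom ≫ T ◁ (β_ T A).hom ≫ (α_ T A T).inv := by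
    rw [BraidedCategory.braiding_tensor_right_hom, Iso.hom_inv_id_assoc,
      ← comp_whiskerRight_assoc, IsCommComonObj.comul_comm]
  rw [coact, id_tensorHom, Category.assoc, Category.assoc,
    BraidedCategory.braiding_naturality_right]
  simp only [← Category.assoc] at h ⊢
  rw [h]

end

section

variable {T A R : C} [ComonObj T] [MonObj R]

/-- Maps `T ⊗ A ⟶ R` carry an action of the convolution monoid `T ⟶ R`; this is the associativity of
the action. -/
theorem convAct_mul (f g : T ⟶ R) (h : T ⊗ A ⟶ R) :
    convAct (f * g) h = convAct f (convAct g h) := by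
  have e₁ : (f * g) ⊗ₘ h = Δ[T] ▷ (T ⊗ A) ≫ ((f ⊗ₘ g) ⊗ₘ h) ≫ μ[R] ▷ R := by
    rw [conv_mul, ← tensorHom_id, ← tensorHom_id, tensorHom_comp_tensorHom,
      tensorHom_comp_tensorHom, Category.id_comp, Category.comp_id]
  have e₂ : f ⊗ₘ ((Δ[T] ▷ A ≫ (α_ T T A).hom) ≫ (g ⊗ₘ h) ≫ μ[R]) =
      T ◁ (Δ[T] ▷ A ≫ (α_ T T A).hom) ≫ (f ⊗ₘ (g ⊗ₘ h)) ≫ R ◁ μ[R] := by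
    rw [← id_tensorHom, ← id_tensorHom, tensorHom_comp_tensorHom, tensorHom_comp_tensorHom,
      Category.id_comp, Category.comp_id]
  simp only [convAct, coact, Category.assoc] at e₂ ⊢
  rw [e₁, e₂]
  simp only [Category.assoc, MonObj.mul_assoc]
  rw [associator_naturality_assoc]
  have := coaction_coassoc T A
  simp only [← Category.assoc] at this ⊢
  rw [this]

theorem convAct_comp {S : C} [MonObj S] (f : T ⟶ R) (h : T ⊗ A ⟶ R) (k : R ⟶ S) [IsMonHom k] :
    convAct f h ≫ k = convAct (f ≫ k) (h ≫ k) := by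
  rw [convAct, convAct, Category.assoc, IsMonHom.mul_hom, ← Category.assoc, coact_comp]

theorem whiskerRight_convAct {S : C} [ComonObj S] (k : S ⟶ T) [IsComonHom k] (f : T ⟶ R)
    (h : T ⊗ A ⟶ R) : k ▷ A ≫ convAct f h = convAct (k ≫ f) (k ▷ A ≫ h) := by
  rw [convAct, convAct, ← Category.assoc, whiskerRight_coact]

theorem coact_convAct {Y Z : C} [ComonObj Y] (s : T ⟶ Y) [IsComonHom s] (w : T ⊗ A ⟶ Z)
    (g : Y ⟶ R) (h : Y ⊗ Z ⟶ R) :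
    coact s w ≫ convAct g h = convAct (s ≫ g) (coact s w ≫ h) := by
  rw [convAct, convAct, ← Category.assoc, coact_coact]

/-- A monoid map carries right multiplication by `x` to right multiplication by the image of `x`. -/
theorem mulRight_comp {S : C} [MonObj S] (x : A ⟶ R) (k : R ⟶ S) [IsMonHom k] :
    mulRight x ≫ k = k ▷ A ≫ mulRight (x ≫ k) := by
  rw [mulRight, mulRight, Category.assoc, IsMonHom.mul_hom, ← id_tensorHom, ← id_tensorHom,
    ← tensorHom_id, tensorHom_comp_tensorHom_assoc, tensorHom_comp_tensorHom_assoc,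
    Category.id_comp, Category.id_comp, Category.comp_id]

theorem coact_mulRight (f : T ⟶ R) {Z : C} (w : T ⊗ A ⟶ Z) (x : Z ⟶ R) :
    coact f w ≫ mulRight x = convAct f (w ≫ x) := by
  rw [mulRight, convAct, ← id_tensorHom, ← Category.assoc, coact_comp, Category.comp_id]

end

theorem whiskerLeft_coact {T A B Y Z : C} [ComonObj T] (k : B ⟶ A) (f : T ⟶ Y)
    (w : T ⊗ A ⟶ Z) : T ◁ k ≫ coact f w = coact f (T ◁ k ≫ w) := by
  rw [coact, coact, whisker_exchange_assoc, associator_naturality_right_assoc, ← id_tensorHom,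
    tensorHom_comp_tensorHom, Category.id_comp]

theorem whiskerLeft_convAct {T A B R : C} [ComonObj T] [MonObj R] (k : B ⟶ A) (f : T ⟶ R)
    (h : T ⊗ A ⟶ R) : T ◁ k ≫ convAct f h = convAct f (T ◁ k ≫ h) := by
  rw [convAct, convAct, ← Category.assoc, whiskerLeft_coact]

theorem coact_counit (T A : C) [ComonObj T] :
    coact (𝟙 T) (ε[T] ▷ A ≫ (λ_ A).hom) = 𝟙 (T ⊗ A) := by
  have h : Δ[T] ▷ A ≫ (T ◁ ε[T]) ▷ A ≫ (ρ_ T).hom ▷ A = 𝟙 (T ⊗ A) := by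
    rw [← comp_whiskerRight, ← comp_whiskerRight, ComonObj.comul_counit_assoc, Iso.inv_hom_id,
      id_whiskerRight]
  rw [coact, id_tensorHom, MonoidalCategory.whiskerLeft_comp,
    ← associator_naturality_middle_assoc, triangle, h]

theorem leftUnitor_inv_coact {A Y Z : C} (f : 𝟙_ C ⟶ Y) (w : 𝟙_ C ⊗ A ⟶ Z) :
    (λ_ A).inv ≫ coact f w = ((λ_ A).inv ≫ w) ≫ (λ_ Z).inv ≫ f ▷ Z := by
  have h : (λ_ A).inv ≫ (λ_ (𝟙_ C)).inv ▷ A ≫ (α_ _ _ _).hom =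
      (λ_ A).inv ≫ (λ_ (𝟙_ C ⊗ A)).inv := by
    simp
  rw [coact, unit_comul, reassoc_of% h, tensorHom_def', Category.assoc,
    leftUnitor_inv_naturality_assoc w]

/-- Multiplying by an element 1 ⊗ t changes the second tensor factor only, by the unit law in the
first. -/
theorem tensor_tinr_mul (T : C) [MonObj T] :
    (T ⊗ T) ◁ tinr T T ≫ μ[T ⊗ T] = (α_ T T T).hom ≫ T ◁ μ[T] := by
  have h : (T ⊗ T) ◁ (λ_ T).inv ≫ tensorμ T T (𝟙_ C) T ≫ (ρ_ T).hom ▷ (T ⊗ T) =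
      (α_ T T T).hom := by
    simp only [tensorμ, braiding_tensorUnit_right]
    monoidal
  rw [tinr, MonObj.tensorObj.mul_def, ← tensorHom_id, MonoidalCategory.whiskerLeft_comp,
    Category.assoc, tensorμ_natural_right_assoc, tensorHom_comp_tensorHom, MonObj.mul_one,
    whiskerLeft_id, Category.id_comp, MonoidalCategory.tensorHom_def]
  rw [reassoc_of% h]

theorem tinr_braiding (X Y : C) [MonObj X] : tinr X Y ≫ (β_ X Y).hom = tinl Y X := by
  rw [tinr, tinl, Category.assoc, BraidedCategory.braiding_naturality_left,
    braiding_tensorUnit_left]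
  simp

theorem tinl_tensorHom {X Y X' Y' : C} [MonObj Y] [MonObj Y'] (f : X ⟶ X') (g : Y ⟶ Y')
    [IsMonHom g] : tinl X Y ≫ (f ⊗ₘ g) = f ≫ tinl X' Y' := by
  rw [tinl, ← rightUnitor_inv_tensorHom_one, Category.assoc, ← id_tensorHom,
    tensorHom_comp_tensorHom, Category.id_comp, IsMonHom.one_hom]

theorem tinr_tensorHom {X Y X' Y' : C} [MonObj X] [MonObj X'] (f : X ⟶ X') (g : Y ⟶ Y')
    [IsMonHom f] : tinr X Y ≫ (f ⊗ₘ g) = g ≫ tinr X' Y' := by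
  rw [tinr, tinr, Category.assoc, ← tensorHom_id, ← tensorHom_id, tensorHom_comp_tensorHom,
    Category.id_comp, IsMonHom.one_hom, leftUnitor_inv_naturality_assoc, ← id_tensorHom,
    tensorHom_comp_tensorHom, Category.id_comp, Category.comp_id]

end Coaction

/-! ### The Leibniz rule for convolution products -/

section Derivation

variable {C : Type u} [Category.{v} C] [MonoidalCategory C] [SymmetricCategory C]
  [AdditiveCategory C] [AdditiveMonoidal C]

section

variable {T A Y Z : C} [ComonObj T]

theorem coact_zero (f : T ⟶ Y) : coact f (0 : T ⊗ A ⟶ Z) = 0 := by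
  simp only [coact, tensor_zero', AdditiveCategory.comp_zero]

variable {R : C} [MonObj R]

theorem convAct_zero (f : T ⟶ R) : convAct f (0 : T ⊗ A ⟶ R) = 0 := by
  simp only [convAct, coact_zero, AdditiveCategory.zero_comp]

/-- The Leibniz rule for convolution products. -/
theorem leibniz_conv [IsCommMonObj R] {d : T ⊗ A ⟶ T}
    (hd : d ≫ Δ[T] = coact (𝟙 T) d + coact (𝟙 T) d ≫ (β_ T T).hom) (f g : T ⟶ R) :
    d ≫ (f * g) = convAct f (d ≫ g) + convAct g (d ≫ f) := by
  rw [conv_mul, ← Category.assoc, hd, AdditiveCategory.add_comp, Category.assoc,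
    ← BraidedCategory.braiding_naturality_assoc, IsCommMonObj.mul_comm, ← Category.assoc,
    ← Category.assoc, coact_comp, coact_comp, Category.id_comp, Category.id_comp]
  rfl

/-- The maps with zero derivative contain the convolution unit and are closed under products. -/
theorem leibniz_conv_prod_eq_zero [IsCommComonObj T] [IsCommMonObj R] {d : T ⊗ A ⟶ T}
    (hd : d ≫ Δ[T] = coact (𝟙 T) d + coact (𝟙 T) d ≫ (β_ T T).hom) (h₁ : d ≫ ε[T] = 0)
    {I : Type} (s : Finset I) (f : I → (T ⟶ R)) (hf : ∀ i ∈ s, d ≫ f i = 0) :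
    d ≫ ∏ i ∈ s, f i = 0 := by
  refine Finset.prod_induction f (fun f => d ≫ f = 0) (fun f g hf hg => ?_) ?_ hf
  · rw [leibniz_conv hd, hf, hg, convAct_zero, convAct_zero, add_zero]
  · rw [conv_one, ← Category.assoc, h₁, AdditiveCategory.zero_comp]

end

section

variable {T A : C} [BimonObj T] [IsCommComonObj T]

theorem mulRight_counit (x : A ⟶ T) (hx : x ≫ ε[T] = 0) : mulRight x ≫ ε[T] = 0 := by
  have h := mulRight_comp x ε[T]
  rw [h, hx, mulRight, AdditiveMonoidal.whiskerLeft_zero, AdditiveCategory.zero_comp,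
    AdditiveCategory.comp_zero]

/-- Multiplication by a primitive map satisfies the Leibniz rule. -/
theorem mulRight_comul (x : A ⟶ T) (hx : x ≫ Δ[T] = x ≫ tinl T T + x ≫ tinr T T) :
    mulRight x ≫ Δ[T] =
      coact (𝟙 T) (mulRight x) + coact (𝟙 T) (mulRight x) ≫ (β_ T T).hom := by
  have h₁ : Δ[T] ▷ A ≫ mulRight (x ≫ tinr T T) = coact (𝟙 T) (mulRight x) := by
    rw [mulRight, MonoidalCategory.whiskerLeft_comp, Category.assoc, tensor_tinr_mul, coact,
      mulRight, id_tensorHom, MonoidalCategory.whiskerLeft_comp, associator_naturality_right_assoc]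
  -- The left injection is the right one followed by the symmetry, and the symmetry is absorbed by
  -- `Δ`.
  have h₂ : Δ[T] ▷ A ≫ mulRight (x ≫ tinl T T) =
      coact (𝟙 T) (mulRight x) ≫ (β_ T T).hom := by
    rw [← h₁, Category.assoc, mulRight_comp, Category.assoc, tinr_braiding,
      ← comp_whiskerRight_assoc, IsCommComonObj.comul_comm]
  have h₃ : mulRight (x ≫ tinl T T + x ≫ tinr T T) =
      mulRight (x ≫ tinl T T) + mulRight (x ≫ tinr T T) := by
    simp only [mulRight, AdditiveMonoidal.whiskerLeft_add, AdditiveCategory.add_comp]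
  rw [mulRight_comp, hx, h₃, AdditiveCategory.comp_add, h₁, h₂, add_comm]

end

end Derivation

/-! ### Coderelictions and deriving transformations -/

section DerivingTransformation

variable {C : Type u} [Category.{v} C] [MonoidalCategory C] [SymmetricCategory C]
  [AdditiveCategory C] [AdditiveMonoidal C] {M : BialgebraModalityData C}
  [hM : Fact M.IsAdditiveBialgebraModality]

theorem convAct_mulRight_comp {T R A : C} [ComonObj T] [MonObj T] [MonObj R] (f : T ⟶ R)
    (x : A ⟶ T) (y : T ⟶ R) :
    convAct f (mulRight x ≫ y) =
      (Δ[T] ⊗ₘ x) ≫ (α_ _ _ _).hom ≫ (T ◁ μ[T]) ≫ (f ⊗ₘ y) ≫ μ[R] := by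
  have e : f ⊗ₘ (mulRight x ≫ y) = T ◁ (T ◁ x) ≫ T ◁ μ[T] ≫ (f ⊗ₘ y) := by
    rw [← MonoidalCategory.whiskerLeft_comp_assoc, ← id_tensorHom, tensorHom_comp_tensorHom,
      Category.id_comp]
    rfl
  rw [convAct, coact, e, MonoidalCategory.tensorHom_def Δ[T]]
  simp only [Category.assoc]
  rw [associator_naturality_right_assoc]

/-- In this form both sides of the chain rule can be pushed through monoid and comonoid maps by the
rules for `convAct`. -/
theorem chain_iff (c : ∀ A : C, A ⟶ M.obj A) (A : C) :
    (M.obj A ◁ c A) ≫ M.mul A ≫ M.δ A =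
      (M.Δ A ⊗ₘ c A) ≫ (α_ _ _ _).hom ≫ (M.obj A ◁ M.mul A) ≫
        (M.δ A ⊗ₘ c (M.obj A)) ≫ M.mul (M.obj A) ↔
    mulRight (c A) ≫ M.δ A = convAct (M.δ A) (mulRight (c A) ≫ c (M.obj A)) := by
  have e : mulRight (c A) ≫ M.δ A = (M.obj A ◁ c A) ≫ M.mul A ≫ M.δ A := Category.assoc _ _ _
  rw [e, convAct_mulRight_comp]
  rfl

theorem product_iff {A : C} (x : A ⟶ M.obj A) :
    x ≫ M.Δ A = (ρ_ A).inv ≫ (x ⊗ₘ M.u A) + (λ_ A).inv ≫ (M.u A ⊗ₘ x) ↔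
      x ≫ Δ[M.obj A] = x ≫ tinl (M.obj A) (M.obj A) + x ≫ tinr (M.obj A) (M.obj A) := by
  have h₁ : (ρ_ A).inv ≫ (x ⊗ₘ M.u A) = x ≫ tinl (M.obj A) (M.obj A) :=
    rightUnitor_inv_tensorHom_one x
  have h₂ : (λ_ A).inv ≫ (M.u A ⊗ₘ x) = x ≫ tinr (M.obj A) (M.obj A) := by
    rw [tinr, tensorHom_def', leftUnitor_inv_naturality_assoc]
    rfl
  rw [h₁, h₂]
  rfl

section Codereliction

variable {c : ∀ A : C, A ⟶ M.obj A}

/-- Maps of bimonoids preserve primitive elements. It is applied to the injections into a tensor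
product. -/
theorem primitive_comp (hc : M.IsCodereliction c) {A T : C} [BimonObj T] (k : M.obj A ⟶ T)
    [IsComonHom k] [IsMonHom k] :
    (c A ≫ k) ≫ Δ[T] = (c A ≫ k) ≫ tinl T T + (c A ≫ k) ≫ tinr T T := by
  rw [Category.assoc, IsComonHom.hom_comul, ← Category.assoc, (product_iff _).1 (hc.product A),
    AdditiveCategory.add_comp, Category.assoc, Category.assoc, tinl_tensorHom, tinr_tensorHom,
    Category.assoc, Category.assoc]

theorem codereliction_comp_counit (hc : M.IsCodereliction c) {A T : C} [ComonObj T]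
    (k : M.obj A ⟶ T) [IsComonHom k] :
    (c A ≫ k) ≫ ε[T] = 0 := by
  rw [Category.assoc, IsComonHom.hom_counit]
  exact hc.constant A

theorem isDerivingTransformation_derivingOf (hc : M.IsCodereliction c) :
    M.IsDerivingTransformation (M.derivingOf c) where
  natural {A B} f := by
    change (M.map f ⊗ₘ f) ≫ mulRight (c B) = mulRight (c A) ≫ M.map f
    rw [mulRight_comp, ← hc.natural f, mulRight, mulRight, MonoidalCategory.whiskerLeft_comp,
      MonoidalCategory.tensorHom_def, Category.assoc, Category.assoc]
  constant A := mulRight_counit (c A) (hc.constant A)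
  leibniz A := by
    have h := mulRight_comul (c A) ((product_iff _).1 (hc.product A))
    rw [← coact_braiding, coact, id_tensorHom] at h
    exact h
  linear A := by
    have h : μ[M.obj A] ≫ M.ε A = (M.ε A ⊗ₘ ε[M.obj A]) ≫ (ρ_ A).hom +
      (ε[M.obj A] ⊗ₘ M.ε A) ≫ (λ_ A).hom := hM.out.mul_ε A
    have h₀ : c A ≫ ε[M.obj A] = 0 := hc.constant A
    change (M.obj A ◁ c A ≫ μ[M.obj A]) ≫ M.ε A = _
    rw [Category.assoc, h, AdditiveCategory.comp_add, ← id_tensorHom,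
      tensorHom_comp_tensorHom_assoc, tensorHom_comp_tensorHom_assoc, h₀, tensor_zero',
      AdditiveCategory.zero_comp, zero_add, hc.linear, Category.id_comp, tensorHom_id]
    rfl
  chain A := by
    have h := (chain_iff c A).1 (hc.chain A)
    rw [← coact_mulRight, coact, Category.assoc, Category.assoc] at h
    exact h
  interchange A := by
    -- By associativity two successive multiplications are one multiplication by a product, and
    -- commutativity of that product gives the interchange.
    have h : mulRight (c A) ▷ A ≫ mulRight (c A) =
        (α_ _ _ _).hom ≫ M.obj A ◁ ((c A ⊗ₘ c A) ≫ μ[M.obj A]) ≫ μ[M.obj A] := by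
      have e : (M.obj A ◁ c A ≫ μ[M.obj A]) ▷ A ≫ M.obj A ◁ c A =
          ((𝟙 (M.obj A) ⊗ₘ c A) ⊗ₘ c A) ≫ μ[M.obj A] ▷ M.obj A := by
        simp only [← id_tensorHom, ← tensorHom_id, tensorHom_comp_tensorHom, Category.id_comp,
          Category.comp_id]
      rw [mulRight, ← Category.assoc, e, Category.assoc, MonObj.mul_assoc,
        associator_naturality_assoc, id_tensorHom, MonoidalCategory.whiskerLeft_comp,
        Category.assoc]
    change mulRight (c A) ▷ A ≫ mulRight (c A) = _ ≫ _ ≫ _ ≫ mulRight (c A) ▷ A ≫ mulRight (c A)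
    rw [h, Iso.inv_hom_id_assoc, ← MonoidalCategory.whiskerLeft_comp_assoc,
      ← BraidedCategory.braiding_naturality_assoc, IsCommMonObj.mul_comm]

/-- The chain rule for the codereliction `u ⊗ … ⊗ η ⊗ … ⊗ u` of a tensor product. -/
theorem mulRight_bangδ (hc : M.IsCodereliction c) {n : ℕ} (F : Fin n → C) (i : Fin n) :
    mulRight (c (F i) ≫ inj M F i) ≫ bangδ M F =
      convAct (bangδ M F) (mulRight (c (F i) ≫ inj M F i) ≫ c (bang M F)) := by
  have hx := mulRight_comul (c (F i) ≫ inj M F i) (primitive_comp hc (inj M F i))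
  have hx₀ := mulRight_counit (c (F i) ≫ inj M F i) (codereliction_comp_counit hc (inj M F i))
  set D := mulRight (c (F i) ≫ inj M F i) with hD
  set w := D ≫ proj M F i ≫ inj M F i with hw
  have hproj : D ≫ proj M F i = proj M F i ▷ F i ≫ mulRight (c (F i)) := by
    rw [hD, mulRight_comp, Category.assoc, famInj_famProj, Category.comp_id]
  -- the chain rule on the `i`-th factor
  have h₁ : D ≫ proj M F i ≫ M.δ (F i) ≫ M.map (inj M F i) =
      convAct (proj M F i ≫ M.δ (F i) ≫ M.map (inj M F i)) (w ≫ c (bang M F)) := by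
    rw [← Category.assoc, hproj, Category.assoc, ← Category.assoc (mulRight _),
      (chain_iff c (F i)).1 (hc.chain (F i)), convAct_comp, whiskerRight_convAct, Category.assoc,
      ← hc.natural, hw, ← Category.assoc D, hproj, Category.assoc, Category.assoc]
  -- The direction of `D` lies in the `i`-th factor: its projection to another factor passes through
  -- `η e = 0`.
  have h₂ : ∀ j, j ≠ i → D ≫ proj M F j ≫ M.δ (F j) ≫ M.map (inj M F j) = 0 := by
    intro j hj
    have e : (c (F i) ≫ inj M F i) ≫ proj M F j = 0 := by
      have h₀ : c (F i) ≫ ε[M.obj (F i)] = 0 := hc.constant _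
      rw [Category.assoc, famInj_famProj_ne n _ i j hj.symm, conv_one, ← Category.assoc, h₀,
        AdditiveCategory.zero_comp]
    rw [← Category.assoc, hD, mulRight_comp, e, mulRight, AdditiveMonoidal.whiskerLeft_zero,
      AdditiveCategory.zero_comp, AdditiveCategory.comp_zero, AdditiveCategory.zero_comp]
  -- By the Leibniz rule only the derivative of the `i`-th factor survives. The other factors act on
  -- it and reassemble the whole section by `convAct_mul`.
  have h₃ : D ≫ bangSection F = convAct (bangSection F) (w ≫ c (bang M F)) := by
    rw [bangSection, ← Finset.prod_erase_mul _ _ (Finset.mem_univ i), leibniz_conv hx,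
      leibniz_conv_prod_eq_zero hx hx₀ _ _ (fun j hj => h₂ j (Finset.ne_of_mem_erase hj)),
      convAct_zero, add_zero, h₁, convAct_mul]
  have h₄ : D ≫ bangSection F = coact (bangSection F) w ≫ mulRight (c (bang M F)) := by
    rw [h₃, coact_mulRight]
  -- The chain rule of `c` is now used at the object `T`. Naturality moves the retraction past `c`,
  -- and reading `h₄` backwards lets it cancel the section, leaving `D` itself.
  rw [bangδ_eq_comp, ← Category.assoc, h₄, Category.assoc, ← Category.assoc (mulRight _),
    (chain_iff c (bang M F)).1 (hc.chain _), convAct_comp, coact_convAct, Category.assoc,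
    ← hc.natural, ← Category.assoc (mulRight _), ← Category.assoc (coact _ _),
    ← Category.assoc (coact _ _), ← h₄, Category.assoc D (bangSection F),
    bangSection_retraction, Category.comp_id]

end Codereliction

section Deriving

variable {d : ∀ A : C, M.obj A ⊗ A ⟶ M.obj A}

theorem deriving_comul (hd : M.IsDerivingTransformation d) (A : C) :
    d A ≫ Δ[M.obj A] =
      coact (𝟙 (M.obj A)) (d A) + coact (𝟙 (M.obj A)) (d A) ≫ (β_ _ _).hom := by
  rw [← coact_braiding, coact, id_tensorHom]
  exact hd.leibniz A

theorem coderelictionOf_counit (hd : M.IsDerivingTransformation d) (A : C) :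
    M.coderelictionOf d A ≫ ε[M.obj A] = 0 := by
  have h : d A ≫ ε[M.obj A] = 0 := hd.constant A
  rw [BialgebraModalityData.coderelictionOf, Category.assoc, Category.assoc, h,
    AdditiveCategory.comp_zero, AdditiveCategory.comp_zero]

theorem coderelictionOf_ε (hd : M.IsDerivingTransformation d) (A : C) :
    M.coderelictionOf d A ≫ M.ε A = 𝟙 A := by
  rw [BialgebraModalityData.coderelictionOf, Category.assoc, Category.assoc, hd.linear,
    ← comp_whiskerRight_assoc, hM.out.u_e, id_whiskerRight, Category.id_comp, Iso.inv_hom_id]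

/-- A deriving transformation of an additive bialgebra modality is determined by its
codereliction. -/
theorem deriving_eq_mulRight (hd : M.IsDerivingTransformation d) (A : C) :
    d A = mulRight (M.coderelictionOf d A) := by
  -- The map `d` is evaluated on `!T` at the base point `σ`, which is concentrated in the first
  -- factor, in the direction `y`, which is concentrated in the second. By naturality the sum `g₁ +
  -- g₂` recovers `d A`, because `g₁` sees only the base point and `g₂` only the direction.
  let T := M.obj A ⊗ M.obj A
  let x := M.coderelictionOf d A
  let g₁ : T ⟶ A := tfst _ _ ≫ M.ε A
  let g₂ : T ⟶ A := tsnd _ _ ≫ M.ε A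
  let σ : M.obj A ⟶ M.obj T := M.δ A ≫ M.map (tinl _ _)
  let y : A ⟶ T := x ≫ tinr _ _
  have i₁ : tinl (M.obj A) (M.obj A) ≫ g₁ = M.ε A := tinl_tfst_assoc _ _ _
  have i₂ : tinl (M.obj A) (M.obj A) ≫ g₂ = 0 := by
    change _ ≫ _ ≫ _ = _
    rw [← Category.assoc, tinl_tsnd]
    exact conv_one_ε A
  have y₁ : y ≫ g₁ = 0 := by
    change (x ≫ _) ≫ _ ≫ _ = _
    rw [Category.assoc, ← Category.assoc (tinr _ _), tinr_tfst, Category.assoc, one_ε,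
      AdditiveCategory.comp_zero, AdditiveCategory.comp_zero]
  have y₂ : y ≫ g₂ = 𝟙 A := by
    change (x ≫ _) ≫ _ ≫ _ = _
    rw [Category.assoc, tinr_tsnd_assoc]
    exact coderelictionOf_ε hd A
  have hσ : ∀ g : T ⟶ A, σ ≫ M.map g = M.δ A ≫ M.map (tinl _ _ ≫ g) := fun g => by
    rw [Category.assoc, ← map_comp]
  have hF : ∀ g : T ⟶ A, σ ▷ A ≫ M.obj T ◁ y ≫ d T ≫ M.map g =
      (M.δ A ≫ M.map (tinl _ _ ≫ g) ⊗ₘ y ≫ g) ≫ d A := fun g => by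
    rw [← hd.natural g, ← hσ]
    simp only [← tensorHom_id, ← id_tensorHom, tensorHom_comp_tensorHom_assoc, Category.id_comp]
  have h₁ : σ ▷ A ≫ M.obj T ◁ y ≫ d T ≫ M.map (g₁ + g₂) = d A := by
    rw [hF, AdditiveCategory.comp_add, AdditiveCategory.comp_add, i₁, i₂, y₁, y₂, add_zero,
      zero_add, δ_map_ε, id_tensorHom_id, Category.id_comp]
  have h₂ : σ ▷ A ≫ M.obj T ◁ y ≫ d T ≫ M.map g₁ = 0 := by
    rw [hF, y₁, tensor_zero', AdditiveCategory.zero_comp]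
  have h₃ : σ ▷ A ≫ M.obj T ◁ y ≫ d T ≫ M.map g₂ = (ε[M.obj A] ▷ A ≫ (λ_ A).hom) ≫ x := by
    rw [hF, i₂, y₂, map_zero, comp_conv_one, conv_one, tensorHom_id, comp_whiskerRight]
    change _ = _ ≫ (λ_ A).inv ≫ M.u A ▷ A ≫ d A
    rw [Category.assoc, Category.assoc, Iso.hom_inv_id_assoc]
    rfl
  -- Additivity makes `!(g₁ + g₂)` a convolution product. Its Leibniz expansion has one vanishing
  -- term by `h₂`, and the other is `(1 ⊗ η)∇`.
  rw [← h₁, map_add, leibniz_conv (deriving_comul hd T), AdditiveCategory.comp_add,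
    AdditiveCategory.comp_add, whiskerLeft_convAct, whiskerLeft_convAct, whiskerRight_convAct,
    whiskerRight_convAct, h₂, h₃, convAct_zero, add_zero, hσ, i₁, δ_map_ε, ← coact_mulRight,
    coact_counit, Category.id_comp]

theorem isCodereliction_coderelictionOf (hd : M.IsDerivingTransformation d) :
    M.IsCodereliction (M.coderelictionOf d) where
  natural {A B} f := by
    rw [BialgebraModalityData.coderelictionOf, BialgebraModalityData.coderelictionOf,
      Category.assoc, Category.assoc, ← hd.natural f, leftUnitor_inv_naturality_assoc]
    simp only [← tensorHom_id, ← id_tensorHom, tensorHom_comp_tensorHom_assoc, Category.id_comp,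
      Category.comp_id, hM.out.u_natural]
  constant := coderelictionOf_counit hd
  product A := by
    have h : M.coderelictionOf d A = (λ_ A).inv ≫ η[M.obj A] ▷ A ≫ d A := rfl
    have e : (λ_ A).inv ≫ η[M.obj A] ▷ A ≫ coact (𝟙 (M.obj A)) (d A) =
        M.coderelictionOf d A ≫ tinr (M.obj A) (M.obj A) := by
      rw [whiskerRight_coact, Category.comp_id, leftUnitor_inv_coact]
      rfl
    refine (product_iff _).2 ?_
    rw [← tinr_braiding, ← Category.assoc (M.coderelictionOf d A), ← e, h]
    simp only [Category.assoc]
    rw [deriving_comul hd, AdditiveCategory.comp_add, AdditiveCategory.comp_add, add_comm]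
  linear := coderelictionOf_ε hd
  chain A := by
    refine (chain_iff _ A).2 ?_
    have h := hd.chain A
    -- Once `d` is known to be multiplication by its codereliction, at `A` and at `!A`, the two
    -- chain rules are the same equation.
    rw [← deriving_eq_mulRight hd A, ← coact_mulRight, ← deriving_eq_mulRight hd (M.obj A), h,
      coact, Category.assoc, Category.assoc]
    rfl

end Deriving

end DerivingTransformation

end BialgebraModality

namespace BiprodCompletion

/-! ### Finite biproducts of the completion -/

section Biproducts

open Limits

/-- A bicone over a finite family whose idempotents sum to the identity is a biproduct. -/
theorem nonempty_isBilimit_of_total {D : Type u} [Category.{v} D] [AdditiveCategory D] {J : Type}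
    [Fintype J] [DecidableEq J] {f : J → D} (b : Bicone f) (h : ∑ j, b.π j ≫ b.ι j = 𝟙 b.pt) :
    Nonempty b.IsBilimit := by
  have hι : ∀ j j', j ≠ j' → b.ι j ≫ b.π j' = 0 := fun j j' hj => by rw [b.ι_π, dif_neg hj]
  have hι' : ∀ j, b.ι j ≫ b.π j = 𝟙 _ := fun j => by rw [b.ι_π, dif_pos rfl]; rfl
  have hl : ∀ {X : D} (m : X ⟶ b.pt), m = ∑ j, (m ≫ b.π j) ≫ b.ι j := fun m => by
    simp only [Category.assoc]
    rw [← comp_sum', h, Category.comp_id]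
  have hr : ∀ {X : D} (m : b.pt ⟶ X), m = ∑ j, b.π j ≫ b.ι j ≫ m := fun m => by
    simp only [← Category.assoc]
    rw [← sum_comp', h, Category.id_comp]
  refine ⟨⟨Fan.IsLimit.mk _ (fun s => ∑ j, s.proj j ≫ b.ι j) ?_ ?_,
    Cofan.IsColimit.mk _ (fun s => ∑ j, b.π j ≫ s.inj j) ?_ ?_⟩⟩
  · intro s j
    change (∑ i, s.proj i ≫ b.ι i) ≫ b.π j = s.proj j
    rw [sum_comp', Finset.sum_eq_single j]
    · rw [Category.assoc, hι', Category.comp_id]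
    · intro i _ hi
      rw [Category.assoc, hι _ _ hi, AdditiveCategory.comp_zero]
    · simp
  · intro s m hm
    exact (hl m).trans (Finset.sum_congr rfl fun j _ => congrArg (· ≫ b.ι j) (hm j))
  · intro s j
    change b.ι j ≫ (∑ i, b.π i ≫ s.inj i) = s.inj j
    rw [comp_sum', Finset.sum_eq_single j]
    · rw [← Category.assoc, hι', Category.id_comp]
    · intro i _ hi
      rw [← Category.assoc, hι _ _ hi.symm, AdditiveCategory.zero_comp]
    · simp
  · intro s m hm
    exact (hr m).trans (Finset.sum_congr rfl fun j _ => congrArg (b.π j ≫ ·) (hm j))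

/-- A binary bicone whose two idempotents sum to the identity is a biproduct. -/
theorem nonempty_isBinaryBilimit_of_total {D : Type u} [Category.{v} D] [AdditiveCategory D]
    {A B : D} (b : BinaryBicone A B) (h : b.fst ≫ b.inl + b.snd ≫ b.inr = 𝟙 b.pt) :
    Nonempty b.IsBilimit := by
  have hl : ∀ {T : D} (m : T ⟶ b.pt), m = (m ≫ b.fst) ≫ b.inl + (m ≫ b.snd) ≫ b.inr :=
    fun m => by
      rw [Category.assoc, Category.assoc, ← AdditiveCategory.comp_add, h, Category.comp_id]
  have hr : ∀ {T : D} (m : b.pt ⟶ T), m = b.fst ≫ b.inl ≫ m + b.snd ≫ b.inr ≫ m :=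
    fun m => by
      rw [← Category.assoc, ← Category.assoc, ← AdditiveCategory.add_comp, h, Category.id_comp]
  refine ⟨⟨BinaryFan.IsLimit.mk _ (fun {T} (f : T ⟶ A) g => f ≫ b.inl + g ≫ b.inr) ?_ ?_ ?_,
    BinaryCofan.IsColimit.mk _ (fun {T} (f : A ⟶ T) g => b.fst ≫ f + b.snd ≫ g) ?_ ?_ ?_⟩⟩
  · intro T f g
    change (f ≫ b.inl + g ≫ b.inr) ≫ b.fst = f
    rw [AdditiveCategory.add_comp, Category.assoc, Category.assoc, b.inl_fst, b.inr_fst,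
      AdditiveCategory.comp_zero, add_zero, Category.comp_id]
  · intro T f g
    change (f ≫ b.inl + g ≫ b.inr) ≫ b.snd = g
    rw [AdditiveCategory.add_comp, Category.assoc, Category.assoc, b.inl_snd, b.inr_snd,
      AdditiveCategory.comp_zero, zero_add, Category.comp_id]
  · rintro T f g m rfl rfl
    exact hl m
  · intro T f g
    change b.inl ≫ (b.fst ≫ f + b.snd ≫ g) = f
    rw [AdditiveCategory.comp_add, ← Category.assoc, ← Category.assoc, b.inl_fst, b.inl_snd,
      AdditiveCategory.zero_comp, add_zero, Category.id_comp]
  · intro T f g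
    change b.inr ≫ (b.fst ≫ f + b.snd ≫ g) = g
    rw [AdditiveCategory.comp_add, ← Category.assoc, ← Category.assoc, b.inr_fst, b.inr_snd,
      AdditiveCategory.zero_comp, zero_add, Category.id_comp]
  · rintro T f g m rfl rfl
    exact hr m

variable {C : Type u} [Category.{v} C] [AdditiveCategory C]

theorem sum_entry {I : Type} [Fintype I] {A B : BiprodCompletion C} (g : I → (A ⟶ B))
    (i : Fin A.len) (j : Fin B.len) :
    Hom.entry (∑ k, g k : A ⟶ B) i j = ∑ k, Hom.entry (g k) i j :=
  map_sum (⟨⟨fun f => Hom.entry f i j, rfl⟩, fun _ _ => rfl⟩ :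
    (A ⟶ B) →+ (A.fam i ⟶ B.fam j)) g Finset.univ

theorem isZero_empty : IsZero (empty C) where
  unique_to _ := ⟨⟨⟨0⟩, fun _ => hom_ext fun i => i.elim0⟩⟩
  unique_from _ := ⟨⟨⟨0⟩, fun _ => hom_ext fun _ j => j.elim0⟩⟩

theorem concat_total (A B : BiprodCompletion C) :
    (concat A B).fst ≫ (concat A B).inl + (concat A B).snd ≫ (concat A B).inr =
      𝟙 (concat A B).pt :=
  hom_ext fun p q => by
    have hne : ∀ (i : Fin A.len) (j : Fin B.len), Fin.castAdd B.len i ≠ Fin.natAdd A.len j :=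
      fun i j h => by
        have := congrArg Fin.val h
        simp at this
        omega
    refine (congrArg₂ (· + ·) (comp_entry (concat A B).fst (concat A B).inl p q)
      (comp_entry (concat A B).snd (concat A B).inr p q)).trans ?_
    refine Fin.addCases (fun i => ?_) (fun i => ?_) p
    · rw [Finset.sum_eq_single i, Finset.sum_eq_zero, add_zero]
      · by_cases h : q = Fin.castAdd B.len i
        · subst h
          simp [concat, id_entry, delta_self]
        · refine Eq.trans ?_ (delta_ne _ (Ne.symm h)).symm
          exact (congrArg (_ ≫ ·) (dif_neg h)).trans (AdditiveCategory.comp_zero _)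
      · intro j _
        exact (congrArg (· ≫ _) (dif_neg (hne i j))).trans (AdditiveCategory.zero_comp _)
      · intro j _ h
        exact (congrArg (· ≫ _) (dif_neg fun h' => h (Fin.castAdd_injective _ _ h').symm)).trans
          (AdditiveCategory.zero_comp _)
      · simp
    · rw [Finset.sum_eq_zero, Finset.sum_eq_single i, zero_add]
      · by_cases h : q = Fin.natAdd A.len i
        · subst h
          simp [concat, id_entry, delta_self]
        · refine Eq.trans ?_ (delta_ne _ (Ne.symm h)).symm
          exact (congrArg (_ ≫ ·) (dif_neg h)).trans (AdditiveCategory.comp_zero _)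
      · intro j _ h
        exact (congrArg (· ≫ _) (dif_neg fun h' => h (Fin.natAdd_injective _ _ h').symm)).trans
          (AdditiveCategory.zero_comp _)
      · simp
      · intro j _
        exact (congrArg (· ≫ _) (dif_neg (hne j i).symm)).trans (AdditiveCategory.zero_comp _)

theorem concat_isBilimit (A B : BiprodCompletion C) : Nonempty (concat A B).IsBilimit :=
  nonempty_isBinaryBilimit_of_total _ (concat_total A B)

section Flatten

variable {n : ℕ} (f : Fin n → BiprodCompletion C)

/-- The entries of a finite family of lists. -/
def flatFam (x : Σ j, Fin (f j).len) : C := (f x.1).fam x.2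

/-- An enumeration of the entries of a finite family of lists. -/
def flatEquiv : Fin (Fintype.card (Σ j, Fin (f j).len)) ≃ Σ j, Fin (f j).len :=
  (Fintype.equivFin _).symm

/-- The list of all entries of a finite family of lists, as a bicone. -/
def flatten : Bicone f where
  -- Any enumeration of the entries serves, since only the existence of finite biproducts is drawn
  -- from this bicone.
  pt := ⟨Fintype.card (Σ j, Fin (f j).len), fun p => flatFam f (flatEquiv f p)⟩
  π j := Hom.mk fun p k => delta (flatFam f) (flatEquiv f p) ⟨j, k⟩
  ι j := Hom.mk fun k p => delta (flatFam f) ⟨j, k⟩ (flatEquiv f p)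
  ι_π j j' := hom_ext fun k k' => by
    refine (sum_delta_comp (flatEquiv f) (flatFam f)
      (fun x => delta (flatFam f) x ⟨j', k'⟩) ⟨j, k⟩).trans ?_
    by_cases h : j = j'
    · subst h
      rw [dif_pos rfl]
      by_cases hk : k = k'
      · subst hk
        exact (delta_self _ _).trans (delta_self (f j).fam k).symm
      · exact (delta_ne _ fun h => hk (by simpa using h)).trans (delta_ne _ hk).symm
    · rw [dif_neg h]
      exact delta_ne _ fun h' => h (congrArg Sigma.fst h')

theorem flatten_total : ∑ j, (flatten f).π j ≫ (flatten f).ι j = 𝟙 (flatten f).pt :=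
  hom_ext fun p q => by
    refine (sum_entry (fun j => (flatten f).π j ≫ (flatten f).ι j) p q).trans ?_
    refine Eq.trans ?_ (delta_comp_equiv (flatEquiv f) (flatFam f) p q).symm
    refine Eq.trans ?_ (sum_delta_comp (Equiv.refl _) (flatFam f)
      (fun x => delta (flatFam f) x (flatEquiv f q)) (flatEquiv f p))
    exact (Fintype.sum_sigma fun x => delta (flatFam f) (flatEquiv f p) x ≫
      delta (flatFam f) x (flatEquiv f q)).symm

end Flatten

theorem hasFiniteBiproducts : HasFiniteBiproducts (BiprodCompletion C) where
  out _ := ⟨fun f => ⟨⟨flatten f, (nonempty_isBilimit_of_total _ (flatten_total f)).some⟩⟩⟩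

end Biproducts

/-! ### Translation between maps of `C` and matrices on lists of length one -/

variable {C : Type u} [Category.{v} C] [MonoidalCategory C] [AdditiveCategory C]
  [AdditiveMonoidal C]

/-- The `p`-th entry of `F`, a column of maps into an object of `C`, is `f`. -/
def EntryIs {A : BiprodCompletion C} (p : Fin A.len) {Y : C} (f : A.fam p ⟶ Y)
    (F : A ⟶ single Y) : Prop := Hom.entry F p (0 : Fin 1) = f

/-- `F` is the `1 × 1` matrix of `f`. -/
def Represents {X Y : C} (f : X ⟶ Y) (F : single X ⟶ single Y) : Prop := singleMap f = F

theorem Represents.of {X Y : C} (f : X ⟶ Y) : Represents f (singleMap f) := rfl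

/-- The transfer principle: both sides of an axiom are represented by maps of `C`, built up by the
lemmas below, and the axiom is then an equation in `C`. -/
theorem Represents.eq {X Y : C} {f g : X ⟶ Y} {F G : single X ⟶ single Y} (hF : Represents f F)
    (hG : Represents g G) (h : f = g) : F = G :=
  hF.symm.trans ((congrArg _ h).trans hG)

theorem represents_of_entry {X Y : C} {f : X ⟶ Y} {F : single X ⟶ single Y}
    (h : ∀ p q : Fin 1, f = Hom.entry F p q) : Represents f F :=
  hom_ext h

theorem single_comp_entry {A B : BiprodCompletion C} {Y : C} (F : A ⟶ single Y)
    (G : single Y ⟶ B) (p : Fin A.len) (q : Fin B.len) :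
    Hom.entry (F ≫ G) p q = Hom.entry F p (0 : Fin 1) ≫ Hom.entry G (0 : Fin 1) q :=
  (comp_entry F G p q).trans (Fin.sum_univ_one _)

theorem delta_single (X : C) (p q : Fin 1) : delta (single X).fam p q = 𝟙 X := by
  obtain rfl : p = q := Subsingleton.elim _ _
  exact delta_self _ _

theorem Represents.id (X : C) : Represents (𝟙 X) (𝟙 (single X)) :=
  represents_of_entry fun p q => (delta_single X p q).symm

theorem Represents.comp {X Y Z : C} {f : X ⟶ Y} {g : Y ⟶ Z} {F : single X ⟶ single Y}
    {G : single Y ⟶ single Z} (hF : Represents f F) (hG : Represents g G) :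
    Represents (f ≫ g) (F ≫ G) := by
  cases hF
  cases hG
  exact represents_of_entry fun p q => (single_comp_entry (singleMap f) (singleMap g) p q).symm

/-- The lists `single X ⊗ single X'` and `single (X ⊗ X')` agree by definition, `1 * 1` being `1`.
The explicit arguments select the second reading. -/
theorem Represents.tensor {X Y X' Y' : C} {f : X ⟶ Y} {g : X' ⟶ Y'} {F : single X ⟶ single Y}
    {G : single X' ⟶ single Y'} (hF : Represents f F) (hG : Represents g G) :
    Represents (X := X ⊗ X') (Y := Y ⊗ Y') (f ⊗ₘ g) (F ⊗ₘ G) := by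
  cases hF
  cases hG
  rfl

theorem Represents.whiskerLeft (X : C) {Y Z : C} {f : Y ⟶ Z} {F : single Y ⟶ single Z}
    (hF : Represents f F) :
    Represents (X := X ⊗ Y) (Y := X ⊗ Z) (X ◁ f) (single X ◁ F) := by
  rw [← id_tensorHom]
  exact (Represents.id X).tensor hF

theorem Represents.whiskerRight {Y Z : C} {f : Y ⟶ Z} {F : single Y ⟶ single Z}
    (hF : Represents f F) (X : C) :
    Represents (X := Y ⊗ X) (Y := Z ⊗ X) (f ▷ X) (F ▷ single X) := by
  rw [← tensorHom_id]
  exact hF.tensor (Represents.id X)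

theorem Represents.associator (X Y Z : C) :
    Represents (X := (X ⊗ Y) ⊗ Z) (Y := X ⊗ (Y ⊗ Z)) (α_ X Y Z).hom
      (α_ (single X) (single Y) (single Z)).hom :=
  represents_of_entry fun p q => by
    -- The structural isomorphisms of the completion carry identity matrix entries, which for lists
    -- of length one are identities.
    have h : (α_ X Y Z).hom ≫ (𝟙 X ⊗ₘ (𝟙 Y ⊗ₘ 𝟙 Z)) = (α_ X Y Z).hom := by simp
    exact ((congrArg ((α_ X Y Z).hom ≫ ·) (congrArg₂ _ (delta_single X _ _)
      (congrArg₂ _ (delta_single Y _ _) (delta_single Z _ _)))).trans h).symm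

theorem Represents.associator_inv (X Y Z : C) :
    Represents (X := X ⊗ (Y ⊗ Z)) (Y := (X ⊗ Y) ⊗ Z) (α_ X Y Z).inv
      (α_ (single X) (single Y) (single Z)).inv :=
  represents_of_entry fun p q => by
    have h : (α_ X Y Z).inv ≫ ((𝟙 X ⊗ₘ 𝟙 Y) ⊗ₘ 𝟙 Z) = (α_ X Y Z).inv := by simp
    exact ((congrArg ((α_ X Y Z).inv ≫ ·)
      (congrArg₂ _ (congrArg₂ _ (delta_single X _ _) (delta_single Y _ _))
        (delta_single Z _ _))).trans h).symm

theorem Represents.leftUnitor (X : C) :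
    Represents (X := 𝟙_ C ⊗ X) (Y := X) (λ_ X).hom (λ_ (single X)).hom :=
  represents_of_entry fun p q => by
    have h : (λ_ X).hom ≫ 𝟙 X = (λ_ X).hom := by simp
    exact ((congrArg ((λ_ X).hom ≫ ·) (delta_single X _ _)).trans h).symm

theorem Represents.leftUnitor_inv (X : C) :
    Represents (X := X) (Y := 𝟙_ C ⊗ X) (λ_ X).inv (λ_ (single X)).inv :=
  represents_of_entry fun p q => by
    have h : (λ_ X).inv ≫ (𝟙 (𝟙_ C) ⊗ₘ 𝟙 X) = (λ_ X).inv := by simp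
    exact ((congrArg ((λ_ X).inv ≫ ·) (congrArg _ (delta_single X _ _))).trans h).symm

theorem Represents.rightUnitor (X : C) :
    Represents (X := X ⊗ 𝟙_ C) (Y := X) (ρ_ X).hom (ρ_ (single X)).hom :=
  represents_of_entry fun p q => by
    have h : (ρ_ X).hom ≫ 𝟙 X = (ρ_ X).hom := by simp
    exact ((congrArg ((ρ_ X).hom ≫ ·) (delta_single X _ _)).trans h).symm

theorem Represents.braiding [SymmetricCategory C] (X Y : C) :
    Represents (X := X ⊗ Y) (Y := Y ⊗ X) (β_ X Y).hom (β_ (single X) (single Y)).hom :=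
  represents_of_entry fun p q => by
    have h : (β_ X Y).hom ≫ (𝟙 Y ⊗ₘ 𝟙 X) = (β_ X Y).hom := by simp
    exact ((congrArg ((β_ X Y).hom ≫ ·)
      (congrArg₂ _ (delta_single Y _ _) (delta_single X _ _))).trans h).symm

theorem Represents.tensorμ [SymmetricCategory C] (X Y Z W : C) :
    Represents (X := (X ⊗ Y) ⊗ (Z ⊗ W)) (Y := (X ⊗ Z) ⊗ (Y ⊗ W)) (tensorμ X Y Z W)
      (tensorμ (single X) (single Y) (single Z) (single W)) :=
  (Represents.associator X Y (Z ⊗ W)).comp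
    (((Represents.associator_inv Y Z W).whiskerLeft X).comp
      ((((Represents.braiding Y Z).whiskerRight W).whiskerLeft X).comp
        (((Represents.associator Z Y W).whiskerLeft X).comp
          (Represents.associator_inv X Z (Y ⊗ W)))))

theorem EntryIs.comp {A : BiprodCompletion C} {p : Fin A.len} {Y Z : C} {f : A.fam p ⟶ Y}
    {g : Y ⟶ Z} {F : A ⟶ single Y} {G : single Y ⟶ single Z} (hF : EntryIs p f F)
    (hG : Represents g G) : EntryIs p (f ≫ g) (F ≫ G) := by
  cases hF
  cases hG
  exact single_comp_entry _ _ _ _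

theorem eq_of_entryIs {A : BiprodCompletion C} {Y : C} {F G : A ⟶ single Y}
    (f g : ∀ p, A.fam p ⟶ Y) (hF : ∀ p, EntryIs p (f p) F) (hG : ∀ p, EntryIs p (g p) G)
    (h : ∀ p, f p = g p) : F = G :=
  hom_ext fun p q => by
    obtain rfl : q = (0 : Fin 1) := Subsingleton.elim (α := Fin 1) _ _
    exact (hF p).trans ((h p).trans (hG p).symm)

theorem EntryIs.tensor {X Y : C} {A : BiprodCompletion C} {Z : C} {f : X ⟶ Y}
    {F : single X ⟶ single Y} (hF : Represents f F) (p : Fin (1 * A.len))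
    {g : A.fam p.modNat ⟶ Z} {G : A ⟶ single Z} (hG : EntryIs p.modNat g G) :
    EntryIs (A := single X ⊗ A) (Y := Y ⊗ Z) p (f ⊗ₘ g) (F ⊗ₘ G) := by
  cases hF
  cases hG
  rfl

/-- The counit ends in a list of arbitrary length, where `Represents` does not apply; its axiom on
products is therefore compared entry by entry. -/
theorem tensor_rightUnitor_entry {X Y : C} {A : BiprodCompletion C} {f : ∀ j, X ⟶ A.fam j}
    {F : single X ⟶ A} (hF : ∀ (i : Fin 1) j, Hom.entry F i j = f j) {g : Y ⟶ 𝟙_ C}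
    {G : single Y ⟶ single (𝟙_ C)} (hG : Represents g G) (p : Fin 1) (j : Fin A.len) :
    Hom.entry ((F ⊗ₘ G : single X ⊗ single Y ⟶ A ⊗ 𝟙_ _) ≫ (ρ_ A).hom) p j =
      (f j ⊗ₘ g) ≫ (ρ_ _).hom := by
  cases hG
  obtain rfl : F = Hom.mk fun _ j => f j := hom_ext hF
  refine Eq.trans ?_ ((sum_unitR fun i => ((f i ⊗ₘ g) ≫ (ρ_ _).hom) ≫
    delta A.fam i j).trans (sum_comp_delta (fun i => (f i ⊗ₘ g) ≫ (ρ_ (A.fam i)).hom) j))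
  refine (comp_entry _ _ _ _).trans (Finset.sum_congr rfl fun q _ => ?_)
  exact (Category.assoc (f q.divNat ⊗ₘ g) (ρ_ _).hom _).symm

theorem tensor_leftUnitor_entry {X Y : C} {A : BiprodCompletion C} {f : ∀ j, X ⟶ A.fam j}
    {F : single X ⟶ A} (hF : ∀ (i : Fin 1) j, Hom.entry F i j = f j) {g : Y ⟶ 𝟙_ C}
    {G : single Y ⟶ single (𝟙_ C)} (hG : Represents g G) (p : Fin 1) (j : Fin A.len) :
    Hom.entry ((G ⊗ₘ F : single Y ⊗ single X ⟶ 𝟙_ _ ⊗ A) ≫ (λ_ A).hom) p j =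
      (g ⊗ₘ f j) ≫ (λ_ _).hom := by
  cases hG
  obtain rfl : F = Hom.mk fun _ j => f j := hom_ext hF
  refine Eq.trans ?_ ((sum_unitL fun i => ((g ⊗ₘ f i) ≫ (λ_ _).hom) ≫
    delta A.fam i j).trans (sum_comp_delta (fun i => (g ⊗ₘ f i) ≫ (λ_ (A.fam i)).hom) j))
  refine (comp_entry _ _ _ _).trans (Finset.sum_congr rfl fun q _ => ?_)
  exact (Category.assoc (g ⊗ₘ f q.modNat) (λ_ _).hom _).symm

theorem EntryIs.rightUnitor_inv_tensor {A : BiprodCompletion C} {Y Z : C} {F : A ⟶ single Y}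
    {f : ∀ i, A.fam i ⟶ Y} (hF : ∀ i, EntryIs i (f i) F) {g : 𝟙_ C ⟶ Z}
    {G : single (𝟙_ C) ⟶ single Z} (hG : Represents g G) (i : Fin A.len) :
    EntryIs (Y := Y ⊗ Z) i ((ρ_ _).inv ≫ (f i ⊗ₘ g))
      ((ρ_ A).inv ≫ (F ⊗ₘ G : A ⊗ 𝟙_ _ ⟶ single Y ⊗ single Z)) := by
  cases hG
  obtain rfl : F = Hom.mk fun i _ => f i := eq_of_entryIs f f hF (fun _ => rfl) fun _ => rfl
  refine Eq.trans ?_ ((sum_unitR fun j => delta A.fam i j ≫ (ρ_ _).inv ≫ (f j ⊗ₘ g)).trans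
    (sum_delta_comp (Equiv.refl _) A.fam (fun j => (ρ_ _).inv ≫ (f j ⊗ₘ g)) i))
  refine (comp_entry _ _ _ _).trans (Finset.sum_congr rfl fun q _ => ?_)
  refine (Category.assoc _ _ _).trans ?_
  rw [rightUnitor_inv_naturality_assoc]
  exact congrArg (fun t => (ρ_ _).inv ≫ t ≫ (f q.divNat ⊗ₘ g)) (tensorHom_id _ _)

theorem EntryIs.leftUnitor_inv_tensor {A : BiprodCompletion C} {Y Z : C} {F : A ⟶ single Y}
    {f : ∀ i, A.fam i ⟶ Y} (hF : ∀ i, EntryIs i (f i) F) {g : 𝟙_ C ⟶ Z}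
    {G : single (𝟙_ C) ⟶ single Z} (hG : Represents g G) (i : Fin A.len) :
    EntryIs (Y := Z ⊗ Y) i ((λ_ _).inv ≫ (g ⊗ₘ f i))
      ((λ_ A).inv ≫ (G ⊗ₘ F : 𝟙_ _ ⊗ A ⟶ single Z ⊗ single Y)) := by
  cases hG
  obtain rfl : F = Hom.mk fun i _ => f i := eq_of_entryIs f f hF (fun _ => rfl) fun _ => rfl
  refine Eq.trans ?_ ((sum_unitL fun j => delta A.fam i j ≫ (λ_ _).inv ≫ (g ⊗ₘ f j)).trans
    (sum_delta_comp (Equiv.refl _) A.fam (fun j => (λ_ _).inv ≫ (g ⊗ₘ f j)) i))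
  refine (comp_entry _ _ _ _).trans (Finset.sum_congr rfl fun q _ => ?_)
  refine (Category.assoc _ _ _).trans ?_
  rw [leftUnitor_inv_naturality_assoc]
  exact congrArg (fun t => (λ_ _).inv ≫ t ≫ (g ⊗ₘ f q.modNat)) (id_tensorHom _ _)

end BiprodCompletion

/-! ### Independence of the Seely isomorphisms from the choice of products -/

namespace CoalgebraModalityData

variable {D : Type u} [Category.{v} D] [MonoidalCategory D] [SymmetricCategory D]
  {M : CoalgebraModalityData D}

theorem IsCoalgebraModality.isIso_map (hM : M.IsCoalgebraModality) {A B : D} (f : A ⟶ B)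
    [IsIso f] : IsIso (M.map f) :=
  inferInstanceAs (IsIso (hM.toComonad.toFunctor.map f))

theorem IsCoalgebraModality.map_comp_Δ_tensor (hM : M.IsCoalgebraModality) {X Y A B : D}
    (f : X ⟶ Y) (p : Y ⟶ A) (q : Y ⟶ B) :
    M.map f ≫ M.Δ Y ≫ (M.map p ⊗ₘ M.map q) = M.Δ X ≫ (M.map (f ≫ p) ⊗ₘ M.map (f ≫ q)) := by
  rw [← Category.assoc, hM.Δ_natural, Category.assoc, tensorHom_comp_tensorHom, hM.map_comp,
    hM.map_comp]

open Limits in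
/-- The Seely maps of all products are isomorphisms if those of a choice of products are. -/
theorem IsCoalgebraModality.isIso_seely (hM : M.IsCoalgebraModality) {A B : D}
    {c c' : BinaryFan A B} (h : IsLimit c) (h' : IsLimit c') [IsIso (M.seely c')] :
    IsIso (M.seely c) := by
  let e := h.conePointUniqueUpToIso h'
  have e₁ : e.hom ≫ c'.fst = c.fst := h.conePointUniqueUpToIso_hom_comp h' ⟨WalkingPair.left⟩
  have e₂ : e.hom ≫ c'.snd = c.snd := h.conePointUniqueUpToIso_hom_comp h' ⟨WalkingPair.right⟩
  have : IsIso (M.map e.hom) := hM.isIso_map e.hom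
  have he : M.map e.hom ≫ M.seely c' = M.seely c :=
    (hM.map_comp_Δ_tensor e.hom c'.fst c'.snd).trans
      (congrArg₂ (fun s t => M.Δ c.pt ≫ (M.map s ⊗ₘ M.map t)) e₁ e₂)
  rw [← he]
  infer_instance

open Limits in
theorem IsCoalgebraModality.isIso_e (hM : M.IsCoalgebraModality) {T T' : D} (h : IsTerminal T)
    (h' : IsTerminal T') [IsIso (M.e T')] : IsIso (M.e T) := by
  have : IsIso (M.map (h.uniqueUpToIso h').hom) := hM.isIso_map _
  rw [← hM.e_natural (h.uniqueUpToIso h').hom]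
  infer_instance

end CoalgebraModalityData

namespace BialgebraModality

open scoped MonObj ComonObj
open BiprodCompletion (tensorFam tensorFamMap iterComul iterMul bang bangE bangU bangΔ bangMul
  bangProj bangInj bangMap bangδ tensor_zero' zero_tensor' tensor_add' add_tensor' delta
  delta_self delta_ne comp_sum' sum_comp'
  modality single singleMap EntryIs Represents represents_of_entry eq_of_entryIs single_comp_entry
  codereliction concat seelyCoherence splitIso tensor_rightUnitor_entry tensor_leftUnitor_entry)

variable {C : Type u} [Category.{v} C] [MonoidalCategory C] [SymmetricCategory C]
  [AdditiveCategory C] [AdditiveMonoidal C] {M : BialgebraModalityData C}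
  [hM : Fact M.IsAdditiveBialgebraModality]

/-! ### The structure maps of the modality as matrices -/

section Represents

variable (A : BiprodCompletion C)

theorem represents_e : Represents ε[bang M A.fam] ((modality M).e A) :=
  represents_of_entry fun _ _ => (bangE_eq A.len A.fam).symm

theorem represents_u : Represents η[bang M A.fam] ((modality M).u A) :=
  represents_of_entry fun _ _ => (bangU_eq A.len A.fam).symm

theorem represents_Δ : Represents (Y := bang M A.fam ⊗ bang M A.fam) Δ[bang M A.fam]
    ((modality M).Δ A) :=
  represents_of_entry fun _ _ => (bangΔ_eq A.len A.fam).symm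

theorem represents_mul : Represents (X := bang M A.fam ⊗ bang M A.fam) μ[bang M A.fam]
    ((modality M).mul A) :=
  represents_of_entry fun _ _ => (bangMul_eq A.len A.fam).symm

theorem represents_map {A B : BiprodCompletion C} (f : A ⟶ B) :
    Represents (bangMap M f.entry) ((modality M).map f) := rfl

/-- As `tensorFam` starts from the unit, the value of the modality on the list `(X)` is `K ⊗ !X` and
not `!X`. This accounts for the unitor in the comultiplication. -/
theorem inj_single (X : C) : inj M (fun _ : Fin 1 => X) 0 = (λ_ (M.obj X)).inv := by
  refine (famInj_last (n := 0) (F := fun _ : Fin 1 => M.obj X)).trans ?_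
  change (λ_ (M.obj X)).inv ≫ 𝟙 (𝟙_ C) ▷ M.obj X = _
  rw [id_whiskerRight, Category.comp_id]

theorem represents_δ : Represents (bangδ M A.fam ≫ inj M (fun _ : Fin 1 => bang M A.fam) 0)
    ((modality M).δ A) := by
  rw [inj_single]
  rfl

theorem ε_entry (p : Fin 1) (i : Fin A.len) :
    ((modality M).ε A).entry p i = projε M A.fam i := by
  rw [projε, proj, ← bangProj_eq]
  rfl

theorem inj_bangMap_single {X Y : C} (f : X ⟶ Y) :
    inj M (fun _ : Fin 1 => X) 0 ≫ bangMap M (G := fun _ : Fin 1 => Y) (fun _ _ => f) =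
      M.map f ≫ inj M (fun _ : Fin 1 => Y) 0 :=
  (inj_bangMap _ 0).trans (Fin.prod_univ_one _)

/-- The injection is the `bangLift` of an identity, and hence a coalgebra map. -/
theorem inj_bangδ_single (X : C) :
    inj M (fun _ : Fin 1 => X) 0 ≫ bangδ M (fun _ : Fin 1 => X) =
      M.δ X ≫ M.map (inj M (fun _ : Fin 1 => X) 0) := by
  have h : bangLift (M := M) (G := fun _ : Fin 1 => X) (fun _ => 𝟙 X) =
      inj M (fun _ : Fin 1 => X) 0 := by
    refine (Fin.prod_univ_one _).trans ?_
    rw [hM.out.map_id, Category.id_comp]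
  rw [← h, bangLift_bangδ]

/-- `!X` as the tensor product of the one-element family `X`. -/
abbrev bang₁ (M : BialgebraModalityData C) (X : C) : C := bang M fun _ : Fin 1 => X

/-- The canonical map `!X ⟶ !(X)`. -/
abbrev inj₁ (M : BialgebraModalityData C) [Fact M.IsAdditiveBialgebraModality] (X : C) :
    M.obj X ⟶ bang₁ M X := inj M (fun _ : Fin 1 => X) 0

theorem represents_Δ_single (X : C) : Represents (Y := bang₁ M X ⊗ bang₁ M X) Δ[bang₁ M X]
    ((modality M).Δ (single X)) := represents_Δ (single X)

theorem represents_mul_single (X : C) : Represents (X := bang₁ M X ⊗ bang₁ M X) μ[bang₁ M X]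
    ((modality M).mul (single X)) := represents_mul (single X)

theorem represents_δ_single (X : C) : Represents (X := bang₁ M X)
    (bangδ M (fun _ : Fin 1 => X) ≫ inj₁ M (bang₁ M X)) ((modality M).δ (single X)) :=
  represents_δ (single X)

theorem represents_ε_single (X : C) : Represents (X := bang₁ M X)
    (projε M (fun _ : Fin 1 => X) 0) ((modality M).ε (single X)) :=
  represents_of_entry fun p q => by
    obtain rfl : q = (0 : Fin 1) := Subsingleton.elim (α := Fin 1) _ _
    exact (ε_entry (single X) p (0 : Fin 1)).symm

theorem represents_map_row {X : C} {B : BiprodCompletion C} {f : ∀ j, X ⟶ B.fam j}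
    {F : single X ⟶ B} (h : ∀ (i : Fin 1) j, F.entry i j = f j) :
    Represents (X := bang₁ M X) (bangMap M fun (_ : Fin 1) j => f j) ((modality M).map F) := by
  obtain rfl : F = BiprodCompletion.Hom.mk fun _ j => f j := BiprodCompletion.hom_ext h
  rfl

theorem represents_map_single {X Y : C} {f : X ⟶ Y} {F : single X ⟶ single Y}
    (h : Represents f F) : Represents (X := bang₁ M X) (Y := bang₁ M Y)
    (bangMap M fun (_ _ : Fin 1) => f) ((modality M).map F) := by
  cases h
  rfl

end Represents

theorem modality_isCoalgebraModality :
    (modality M).toCoalgebraModalityData.IsCoalgebraModality where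
  map_id A := (represents_map (𝟙 A)).eq (Represents.id _) (bangMap_id A.fam)
  map_comp f g := (represents_map (f ≫ g)).eq ((represents_map f).comp (represents_map g))
    (bangMap_comp f.entry g.entry)
  δ_natural {A B} f := ((represents_map f).comp (represents_δ B)).eq
    ((represents_δ A).comp (represents_map_single (represents_map f))) (by
      rw [← Category.assoc, bangMap_bangδ, Category.assoc, Category.assoc]
      rw [inj_bangMap_single])
  ε_natural {A B} f := BiprodCompletion.hom_ext fun p j => by
    refine (single_comp_entry _ _ p j).trans ((congrArg (_ ≫ ·) (ε_entry B 0 j)).trans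
      ((bangMap_projε f.entry j).trans ?_))
    exact Finset.sum_congr rfl fun i _ => congrArg (· ≫ _) (ε_entry A p i).symm
  left_counit A := by
    refine ((represents_δ A).comp (represents_ε_single _)).eq (Represents.id _) ?_
    have h := inj_projε (M := M) (fun _ : Fin 1 => bang M A.fam) 0
    rw [Category.assoc, h, bangδ_ε]
  right_counit A := by
    refine ((represents_δ A).comp (represents_map_row (ε_entry A))).eq (Represents.id _) ?_
    rw [Category.assoc, inj_bangMap]
    exact bangδ_retraction A.fam
  coassoc A := by
    refine ((represents_δ A).comp (represents_δ_single _)).eq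
      ((represents_δ A).comp (represents_map_single (represents_δ A))) ?_
    rw [Category.assoc, Category.assoc, inj_bangMap_single, ← Category.assoc (inj _ _ _),
      inj_bangδ_single, map_comp, Category.assoc, Category.assoc, ← Category.assoc,
      -- After the canonical maps `!X ⟶ !(X)` have been moved to the end, what is left is
      -- coassociativity in `C`.
      ← Category.assoc (bangδ M A.fam), bangδ_δ]
  Δ_natural {A B} f := ((represents_map f).comp (represents_Δ B)).eq
    ((represents_Δ A).comp ((represents_map f).tensor (represents_map f)))
    (IsComonHom.hom_comul (bangMap M f.entry))
  e_natural {A B} f := ((represents_map f).comp (represents_e B)).eq (represents_e A)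
    (IsComonHom.hom_counit (bangMap M f.entry))
  Δ_coassoc A := ((represents_Δ A).comp (((represents_Δ A).whiskerRight _).comp
      (Represents.associator _ _ _))).eq ((represents_Δ A).comp ((represents_Δ A).whiskerLeft _))
    (ComonObj.comul_assoc _).symm
  Δ_left_counit A := ((represents_Δ A).comp (((represents_e A).whiskerRight _).comp
      (Represents.leftUnitor _))).eq (Represents.id _) (by simp)
  Δ_right_counit A := ((represents_Δ A).comp (((represents_e A).whiskerLeft _).comp
      (Represents.rightUnitor _))).eq (Represents.id _) (by simp)
  Δ_cocomm A := ((represents_Δ A).comp (Represents.braiding _ _)).eq (represents_Δ A)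
    (IsCommComonObj.comul_comm _)
  δ_Δ A := ((represents_δ A).comp (represents_Δ_single _)).eq
    ((represents_Δ A).comp ((represents_δ A).tensor (represents_δ A)))
    (IsComonHom.hom_comul (bangδ M A.fam ≫ inj M (fun _ : Fin 1 => bang M A.fam) 0))

theorem modality_isAdditiveBialgebraModality : (modality M).IsAdditiveBialgebraModality where
  toIsCoalgebraModality := modality_isCoalgebraModality
  mul_natural {A B} f := (((represents_map f).tensor (represents_map f)).comp
    (represents_mul B)).eq ((represents_mul A).comp (represents_map f))
    (IsMonHom.mul_hom (bangMap M f.entry)).symm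
  u_natural {A B} f := ((represents_u A).comp (represents_map f)).eq (represents_u B)
    (IsMonHom.one_hom (bangMap M f.entry))
  mul_assoc A := (((represents_mul A).whiskerRight _).comp (represents_mul A)).eq
    ((Represents.associator _ _ _).comp (((represents_mul A).whiskerLeft _).comp
      (represents_mul A))) (MonObj.mul_assoc _)
  u_mul A := (((represents_u A).whiskerRight _).comp (represents_mul A)).eq
    (Represents.leftUnitor _) (MonObj.one_mul _)
  mul_u A := (((represents_u A).whiskerLeft _).comp (represents_mul A)).eq
    (Represents.rightUnitor _) (MonObj.mul_one _)
  mul_comm A := ((Represents.braiding _ _).comp (represents_mul A)).eq (represents_mul A)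
    (IsCommMonObj.mul_comm _)
  mul_e A := ((represents_mul A).comp (represents_e A)).eq
    (((represents_e A).tensor (represents_e A)).comp (Represents.leftUnitor _))
    (IsMonHom.mul_hom ε[bang M A.fam])
  u_Δ A := ((represents_u A).comp (represents_Δ A)).eq
    ((Represents.leftUnitor_inv _).comp ((represents_u A).tensor (represents_u A)))
    (IsMonHom.one_hom Δ[bang M A.fam])
  u_e A := ((represents_u A).comp (represents_e A)).eq (Represents.id _)
    (IsMonHom.one_hom ε[bang M A.fam])
  mul_Δ A := ((represents_mul A).comp (represents_Δ A)).eq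
    (((represents_Δ A).tensor (represents_Δ A)).comp ((Represents.tensorμ _ _ _ _).comp
      ((represents_mul A).tensor (represents_mul A)))) 
    (BimonObj.mul_comul _)
  mul_ε A := BiprodCompletion.hom_ext fun p j => by
    refine (single_comp_entry _ _ p j).trans ((congrArg₂ (· ≫ ·) ?_ (ε_entry A 0 j)).trans
      ((mul_projε A.fam j).trans (congrArg₂ (· + ·) ?_ ?_)))
    · exact bangMul_eq A.len A.fam
    · exact (tensor_rightUnitor_entry (ε_entry A) (represents_e A) p j).symm
    · exact (tensor_leftUnitor_entry (ε_entry A) (represents_e A) p j).symm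
  map_add {A B} f g := (represents_map (f + g)).eq ((represents_Δ A).comp
    (((represents_map f).tensor (represents_map g)).comp (represents_mul B)))
    (bangMap_add f.entry g.entry)
  map_zero A B := (represents_map 0).eq ((represents_e A).comp (represents_u B))
    (bangMap_zero A.fam B.fam)

/-! ### The codereliction of the completion -/

section Primitive

variable {c : ∀ A : C, A ⟶ M.obj A}

/-- Precomposing with the codereliction turns convolution into addition. -/
theorem codereliction_comp_mul (hc : M.IsCodereliction c) {A R : C} [MonObj R]
    (f g : M.obj A ⟶ R) [IsMonHom f] [IsMonHom g] : c A ≫ (f * g) = c A ≫ f + c A ≫ g := by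
  have e₁ : tinl (M.obj A) (M.obj A) ≫ (f ⊗ₘ g) ≫ μ[R] = f := by
    rw [← Category.assoc, tinl_tensorHom, Category.assoc]
    simp [tinl]
  have e₂ : tinr (M.obj A) (M.obj A) ≫ (f ⊗ₘ g) ≫ μ[R] = g := by
    rw [← Category.assoc, tinr_tensorHom, Category.assoc]
    simp [tinr]
  rw [conv_mul, ← Category.assoc, (product_iff _).1 (hc.product A), AdditiveCategory.add_comp,
    Category.assoc, Category.assoc, e₁, e₂]

theorem codereliction_comp_prod (hc : M.IsCodereliction c) {A R : C} [MonObj R]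
    [IsCommMonObj R] {I : Type} (s : Finset I) (f : I → (M.obj A ⟶ R)) [∀ i, IsMonHom (f i)] :
    c A ≫ ∏ i ∈ s, f i = ∑ i ∈ s, c A ≫ f i := by
  classical
  induction s using Finset.induction_on with
  | empty =>
    have h₀ : c A ≫ ε[M.obj A] = 0 := hc.constant A
    rw [Finset.prod_empty, Finset.sum_empty, conv_one, ← Category.assoc, h₀,
      AdditiveCategory.zero_comp]
  | insert i s hi ih =>
    have : IsMonHom (∏ i ∈ s, f i) := conv_prod_isMonHom _ _ fun _ _ => inferInstance
    rw [Finset.prod_insert hi, Finset.sum_insert hi, codereliction_comp_mul hc, ih]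

theorem codereliction_entry (A : BiprodCompletion C) (i : Fin A.len) :
    EntryIs i (c (A.fam i) ≫ inj M A.fam i) (codereliction M c A) :=
  congrArg (c (A.fam i) ≫ ·) (bangInj_eq A.len A.fam i)

theorem represents_codereliction_single (X : C) :
    Represents (Y := bang₁ M X) (c X ≫ inj₁ M X) (codereliction M c (single X)) :=
  represents_of_entry fun p q => by
    obtain rfl : p = (0 : Fin 1) := Subsingleton.elim (α := Fin 1) _ _
    exact (codereliction_entry (single X) (0 : Fin 1)).symm

theorem isCodereliction_codereliction (hc : M.IsCodereliction c) :
    (modality M).IsCodereliction (codereliction M c) where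
  natural {A B} f := BiprodCompletion.hom_ext fun i q => by
    obtain rfl : q = (0 : Fin 1) := Subsingleton.elim (α := Fin 1) _ _
    refine Eq.trans ?_ ((codereliction_entry A i).comp (represents_map f)).symm
    -- On the `i`-th factor the induced map is a convolution product along row `i`; the
    -- codereliction turns it into the sum that defines the matrix product.
    have h : (c (A.fam i) ≫ inj M A.fam i) ≫ bangMap M f.entry =
        ∑ j, f.entry i j ≫ c (B.fam j) ≫ inj M B.fam j := by
      rw [Category.assoc, inj_bangMap, bangLift, codereliction_comp_prod hc]
      refine Finset.sum_congr rfl fun j _ => ?_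
      rw [← Category.assoc, ← hc.natural, Category.assoc]
    refine Eq.trans ?_ h.symm
    exact (BiprodCompletion.comp_entry f (codereliction M c B) i (0 : Fin 1)).trans
      (Finset.sum_congr rfl fun j _ => congrArg (f.entry i j ≫ ·) (codereliction_entry B j))
  constant A := eq_of_entryIs _ (fun _ => 0)
    (fun i => (codereliction_entry A i).comp (represents_e A)) (fun _ => rfl)
    fun i => codereliction_comp_counit hc (inj M A.fam i)
  product A := eq_of_entryIs (Y := bang M A.fam ⊗ bang M A.fam) _
    (fun i => (ρ_ _).inv ≫ ((c (A.fam i) ≫ inj M A.fam i) ⊗ₘ η[bang M A.fam]) +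
      (λ_ _).inv ≫ (η[bang M A.fam] ⊗ₘ (c (A.fam i) ≫ inj M A.fam i)))
    (fun i => (codereliction_entry A i).comp (represents_Δ A))
    (fun i => congrArg₂ (· + ·)
      (EntryIs.rightUnitor_inv_tensor (codereliction_entry A) (represents_u A) i)
      (EntryIs.leftUnitor_inv_tensor (codereliction_entry A) (represents_u A) i))
    fun i => by
      refine (primitive_comp hc (inj M A.fam i)).trans (congrArg₂ (· + ·) ?_ ?_)
      · exact (rightUnitor_inv_tensorHom_one _).symm
      · rw [tinr, tensorHom_def', leftUnitor_inv_naturality_assoc]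
  linear A := BiprodCompletion.hom_ext fun i j => by
    refine (single_comp_entry _ _ i j).trans ((congrArg₂ (· ≫ ·) (codereliction_entry A i)
      (ε_entry A 0 j)).trans ?_)
    refine (Category.assoc _ _ _).trans ?_
    by_cases h : i = j
    · subst h
      refine (congrArg (_ ≫ ·) (inj_projε A.fam i)).trans ((hc.linear _).trans ?_)
      exact (delta_self _ _).symm
    · refine (congrArg (_ ≫ ·) (inj_projε_ne A.fam h)).trans ?_
      exact (AdditiveCategory.comp_zero _).trans (delta_ne _ h).symm
  chain A := eq_of_entryIs (A := single (bang M A.fam) ⊗ A) _ _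
    (fun p => (EntryIs.tensor (Represents.id _) p (codereliction_entry A _)).comp
      ((represents_mul A).comp (represents_δ A)))
    (fun p => (EntryIs.tensor (represents_Δ A) p (codereliction_entry A _)).comp
      ((Represents.associator _ _ _).comp (((represents_mul A).whiskerLeft _).comp
        (((represents_δ A).tensor (represents_codereliction_single _)).comp
          (represents_mul_single _)))))
    fun p => by
      -- The first list has length one, so the row index `p` of the tensor product is an index
      -- `p.modNat` of `A`.
      have h := congrArg (· ≫ inj₁ M (bang M A.fam)) (mulRight_bangδ hc A.fam p.modNat)
      refine Eq.trans ?_ (h.trans ?_)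
      · have e : ∀ {X : C} (x : X ⟶ bang M A.fam),
            (𝟙 (bang M A.fam) ⊗ₘ x) ≫ μ[bang M A.fam] ≫ bangδ M A.fam ≫ inj₁ M (bang M A.fam) =
              (mulRight x ≫ bangδ M A.fam) ≫ inj₁ M (bang M A.fam) := fun x => by
          rw [id_tensorHom, mulRight, Category.assoc, Category.assoc]
        exact e _
      · rw [convAct_comp, Category.assoc]
        exact convAct_mulRight_comp _ _ _

theorem isDerivingTransformation_codereliction (hc : M.IsCodereliction c) :
    (modality M).IsDerivingTransformation ((modality M).derivingOf (codereliction M c)) :=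
  haveI : Fact (modality M).IsAdditiveBialgebraModality :=
    ⟨modality_isAdditiveBialgebraModality⟩
  isDerivingTransformation_derivingOf (isCodereliction_codereliction hc)

end Primitive

/-! ### The coherence isomorphism of a split tensor product -/

section Split

theorem associator_tfst (X Y Z : C) [ComonObj Y] [ComonObj Z] :
    (α_ X Y Z).hom ≫ tfst X (Y ⊗ Z) = tfst (X ⊗ Y) Z ≫ tfst X Y := by
  have h : ε[Y ⊗ Z] = tfst Y Z ≫ ε[Y] := (IsComonHom.hom_counit _).symm
  rw [tfst, h, tfst, MonoidalCategory.whiskerLeft_comp, MonoidalCategory.whiskerLeft_comp]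
  simp [tfst]

theorem associator_tsnd (X Y Z : C) [ComonObj X] :
    (α_ X Y Z).hom ≫ tsnd X (Y ⊗ Z) = tsnd X Y ▷ Z := by
  simp [tsnd]

theorem whiskerRight_tfst {X X' : C} (f : X ⟶ X') (Y : C) [ComonObj Y] :
    f ▷ Y ≫ tfst X' Y = tfst X Y ≫ f := by
  simp [tfst, ← whisker_exchange_assoc]

theorem whiskerRight_tsnd {X X' : C} [ComonObj X] [ComonObj X'] (f : X ⟶ X') [IsComonHom f]
    (Y : C) : f ▷ Y ≫ tsnd X' Y = tsnd X Y := by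
  simp [tsnd, ← comp_whiskerRight_assoc]

/-- A composite of coherence maps preserves comultiplication, so that in the Seely map it can be
moved past `Δ`. -/
instance splitIso_isComonHom (m : ℕ) : (n : ℕ) → (F : Fin (m + n) → C) → [∀ i, ComonObj (F i)] →
    IsComonHom (splitIso m n F).hom
  | 0, F, _ => inferInstanceAs (IsComonHom (ρ_ (tensorFam m F)).inv)
  | n + 1, F, _ =>
    have := splitIso_isComonHom m n fun i => F i.castSucc
    inferInstanceAs (IsComonHom ((splitIso m n fun i => F i.castSucc).hom ▷ F (Fin.last (m + n)) ≫
      (α_ _ _ _).hom))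

/-- Together with its companion for `tsnd`, this fixes the coherence map on all components, which
suffices for comparing comonoid maps. -/
theorem splitIso_tfst_famProj (m : ℕ) : (n : ℕ) → (F : Fin (m + n) → C) →
    [∀ i, ComonObj (F i)] → (i : Fin m) →
    (splitIso m n F).hom ≫ tfst _ _ ≫ famProj m (fun i => F (Fin.castAdd n i)) i =
      famProj (m + n) F (Fin.castAdd n i)
  | 0, F, _, i => by
    have h : (ρ_ (tensorFam m F)).inv ≫ tfst (tensorFam m F) (𝟙_ C) = 𝟙 _ := by
      rw [tfst, unit_counit, MonoidalCategory.whiskerLeft_id, Category.id_comp,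
        Iso.inv_hom_id]
    change (ρ_ (tensorFam m F)).inv ≫ tfst (tensorFam m F) (𝟙_ C) ≫ famProj m F i = famProj m F i
    rw [reassoc_of% h]
  | n + 1, F, _, i => by
    have ih := splitIso_tfst_famProj m n (fun i => F i.castSucc) i
    refine Eq.trans ?_ ((congrArg (famInit F ≫ ·) ih).trans (famProj_castSucc F _).symm)
    change ((splitIso m n fun i => F i.castSucc).hom ▷ F (Fin.last (m + n)) ≫
      (α_ _ _ _).hom) ≫ tfst _ (tensorFam n _ ⊗ _) ≫ _ = _
    rw [Category.assoc, ← Category.assoc (α_ _ _ _).hom, associator_tfst, Category.assoc,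
      ← Category.assoc, whiskerRight_tfst, Category.assoc]
    rfl

theorem splitIso_tsnd_famProj (m : ℕ) : (n : ℕ) → (F : Fin (m + n) → C) →
    [∀ i, ComonObj (F i)] → (j : Fin n) →
    (splitIso m n F).hom ≫ tsnd _ _ ≫ famProj n (fun j => F (Fin.natAdd m j)) j =
      famProj (m + n) F (Fin.natAdd m j)
  | 0, _, _, j => j.elim0
  | n + 1, F, _, j => by
    have h : ∀ {Z : C} (k : tensorFam n (fun j => F (Fin.natAdd m j.castSucc)) ⊗
          F (Fin.last (m + n)) ⟶ Z),
        (splitIso m (n + 1) F).hom ≫ tsnd (tensorFam m fun i => F (Fin.castAdd (n + 1) i))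
          (tensorFam (n + 1) fun j => F (Fin.natAdd m j)) ≫ k =
        ((splitIso m n fun i => F i.castSucc).hom ≫ tsnd _ _) ▷ F (Fin.last (m + n)) ≫ k := by
      intro Z k
      change ((splitIso m n fun i => F i.castSucc).hom ▷ F (Fin.last (m + n)) ≫
        (α_ _ _ _).hom) ≫ tsnd _ (tensorFam n _ ⊗ _) ≫ _ = _
      rw [Category.assoc, ← Category.assoc (α_ _ _ _).hom, associator_tsnd,
        ← comp_whiskerRight_assoc]
    refine Fin.lastCases ?_ (fun j => ?_) j
    · refine (congrArg (fun t => _ ≫ _ ≫ t) (famProj_last _)).trans ((h (tsnd _ _)).trans ?_)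
      exact (whiskerRight_tsnd _ _).trans (famProj_last F).symm
    · have ih := splitIso_tsnd_famProj m n (fun i => F i.castSucc) j
      refine (congrArg (fun t => _ ≫ _ ≫ t) (famProj_castSucc _ j)).trans
        ((h (tfst _ _ ≫ _)).trans ?_)
      refine Eq.trans ?_ ((congrArg (famInit F ≫ ·) ih).trans (famProj_castSucc F _).symm)
      rw [← Category.assoc, whiskerRight_tfst, Category.assoc, Category.assoc]
      rfl

end Split

/-! ### The Seely isomorphisms and the storage structure -/

section Seely

section

variable {m n : ℕ} {H : Fin (m + n) → C} {F : Fin m → C} {G : Fin n → C}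
  (hF : (fun i => H (Fin.castAdd n i)) = F) (hG : (fun j => H (Fin.natAdd m j)) = G)

theorem bangMap_eq_splitIso_tfst {f : ∀ p i, H p ⟶ F i}
    (hf : ∀ i, f (Fin.castAdd n i) i = eqToHom (congrFun hF i))
    (hf₀ : ∀ p i, p ≠ Fin.castAdd n i → f p i = 0) :
    bangMap M f = (splitIso m n fun p => M.obj (H p)).hom ≫ tfst _ _ ≫
      eqToHom (congrArg (bang M) hF) := by
  -- The entries of a concatenation agree with those of its parts only propositionally. Stating the
  -- lemma for an equation of families makes the transport trivial here.
  subst hF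
  rw [eqToHom_refl, Category.comp_id]
  refine fam_hom_ext fun j => ?_
  refine (bangMap_proj f j).trans
    ((Finset.prod_eq_single (Fin.castAdd n j) ?_ (by simp)).trans ?_)
  · intro p _ h
    rw [hf₀ p j h, map_zero, comp_conv_one]
  · rw [hf, eqToHom_refl, hM.out.map_id, Category.comp_id, Category.assoc]
    exact (splitIso_tfst_famProj m n (fun p => M.obj (H p)) j).symm

theorem bangMap_eq_splitIso_tsnd {g : ∀ p j, H p ⟶ G j}
    (hg : ∀ j, g (Fin.natAdd m j) j = eqToHom (congrFun hG j))
    (hg₀ : ∀ p j, p ≠ Fin.natAdd m j → g p j = 0) :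
    bangMap M g = (splitIso m n fun p => M.obj (H p)).hom ≫ tsnd _ _ ≫
      eqToHom (congrArg (bang M) hG) := by
  subst hG
  rw [eqToHom_refl, Category.comp_id]
  refine fam_hom_ext fun j => ?_
  refine (bangMap_proj g j).trans
    ((Finset.prod_eq_single (Fin.natAdd m j) ?_ (by simp)).trans ?_)
  · intro p _ h
    rw [hg₀ p j h, map_zero, comp_conv_one]
  · rw [hg, eqToHom_refl, hM.out.map_id, Category.comp_id, Category.assoc]
    exact (splitIso_tsnd_famProj m n (fun p => M.obj (H p)) j).symm

/-- The Seely map of a concatenation is the coherence isomorphism. -/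
theorem comul_bangMap_eq_splitIso {f : ∀ p i, H p ⟶ F i} {g : ∀ p j, H p ⟶ G j}
    (hf : ∀ i, f (Fin.castAdd n i) i = eqToHom (congrFun hF i))
    (hf₀ : ∀ p i, p ≠ Fin.castAdd n i → f p i = 0)
    (hg : ∀ j, g (Fin.natAdd m j) j = eqToHom (congrFun hG j))
    (hg₀ : ∀ p j, p ≠ Fin.natAdd m j → g p j = 0) :
    Δ[bang M H] ≫ (bangMap M f ⊗ₘ bangMap M g) =
      (splitIso m n fun p => M.obj (H p)).hom ≫
        (eqToHom (congrArg (bang M) hF) ⊗ₘ eqToHom (congrArg (bang M) hG)) := by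
  have h := comul_tfst_tsnd (bang M fun i => H (Fin.castAdd n i))
    (bang M fun j => H (Fin.natAdd m j))
  rw [bangMap_eq_splitIso_tfst hF hf hf₀, bangMap_eq_splitIso_tsnd hG hg hg₀,
    ← tensorHom_comp_tensorHom, ← Category.assoc,
    ← IsComonHom.hom_comul (splitIso m n fun p => M.obj (H p)).hom, Category.assoc,
    ← tensorHom_comp_tensorHom, ← Category.assoc Δ[_ ⊗ _], h, Category.id_comp]

end

variable (A B : BiprodCompletion C)

theorem seely_concat :
    (modality M).seely (concat A B).toCone = seelyCoherence M A B := by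
  have h := comul_bangMap_eq_splitIso (M := M) (H := Fin.append A.fam B.fam)
    (funext fun i => Fin.append_left A.fam B.fam i) (funext fun i => Fin.append_right A.fam B.fam i)
    (f := (concat A B).fst.entry) (g := (concat A B).snd.entry) (fun i => dif_pos rfl)
    (fun p i h => dif_neg h) (fun i => dif_pos rfl) (fun p i h => dif_neg h)
  exact ((represents_Δ (concat A B).pt).comp ((represents_map (concat A B).fst).tensor
    (represents_map (concat A B).snd))).eq (Represents.of _) h

theorem isIso_singleMap {X Y : C} (f : X ⟶ Y) [IsIso f] : IsIso (singleMap f) :=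
  ⟨singleMap (inv f), ((Represents.of f).comp (Represents.of (inv f))).eq (Represents.id X)
    (IsIso.hom_inv_id f), ((Represents.of (inv f)).comp (Represents.of f)).eq (Represents.id Y)
    (IsIso.inv_hom_id f)⟩

theorem isIso_seelyCoherence : IsIso (seelyCoherence M A B) :=
  isIso_singleMap (X := bang M (Fin.append A.fam B.fam)) (Y := bang M A.fam ⊗ bang M B.fam)
    ((splitIso A.len B.len fun p => M.obj (Fin.append A.fam B.fam p)).hom ≫
      (eqToHom (congrArg (bang M) (funext fun i => Fin.append_left A.fam B.fam i)) ⊗ₘ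
        eqToHom (congrArg (bang M) (funext fun i => Fin.append_right A.fam B.fam i))))

theorem e_empty :
    (modality M).e (BiprodCompletion.empty C) = 𝟙 (𝟙_ (BiprodCompletion C)) :=
  Represents.id (𝟙_ C)

theorem modality_isAdditiveMonoidalStorage :
    (modality M).toCoalgebraModalityData.IsAdditiveMonoidalStorage where
  hasFiniteProducts :=
    have := BiprodCompletion.hasFiniteBiproducts (C := C)
    inferInstance
  isCoalgebraModality := modality_isCoalgebraModality
  hasSeelyIsos :=
    { prod := by
        rintro A B c ⟨hc⟩
        have : IsIso ((modality M).seely (concat A B).toCone) := by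
          rw [seely_concat]
          exact isIso_seelyCoherence A B
        -- An arbitrary product cone is compared with concatenation, for which the Seely map is the
        -- coherence isomorphism.
        exact modality_isCoalgebraModality.isIso_seely hc
          (BiprodCompletion.concat_isBilimit A B).some.isLimit
      terminal := by
        rintro T ⟨hT⟩
        have : IsIso ((modality M).e (BiprodCompletion.empty C)) := by
          rw [e_empty]
          exact inferInstanceAs (IsIso (𝟙 (𝟙_ (BiprodCompletion C))))
        exact modality_isCoalgebraModality.isIso_e hT
          BiprodCompletion.isZero_empty.isTerminal }

end Seely

/-! ### Strict monoidal categories -/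

section Strict

theorem rightUnitor_inv_eq_eqToHom (hC : IsStrictMonoidal C) (X : C) :
    (ρ_ X).inv = eqToHom (hC.tensor_unit X).symm := by
  rw [← cancel_mono (ρ_ X).hom, Iso.inv_hom_id, hC.rightUnitor_eq, eqToHom_trans, eqToHom_refl]

theorem splitIso_hom_eq_eqToHom (hC : IsStrictMonoidal C) (m : ℕ) : (n : ℕ) →
    (F : Fin (m + n) → C) → ∃ h, (splitIso m n F).hom = eqToHom h
  | 0, F => ⟨(hC.tensor_unit (tensorFam m F)).symm, rightUnitor_inv_eq_eqToHom hC _⟩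
  | n + 1, F => by
    obtain ⟨h, e⟩ := splitIso_hom_eq_eqToHom hC m n fun i => F i.castSucc
    refine ⟨(congrArg (· ⊗ F (Fin.last (m + n))) h).trans (hC.assoc_obj _ _ _), ?_⟩
    change (splitIso m n fun i => F i.castSucc).hom ▷ F (Fin.last (m + n)) ≫ (α_ _ _ _).hom = _
    rw [e, hC.associator_eq, eqToHom_whiskerRight]
    exact eqToHom_trans _ _

theorem singleMap_eqToHom {X Y : C} (h : X = Y) :
    singleMap (eqToHom h) = eqToHom (congrArg single h) := by
  subst h
  exact Represents.id X

theorem eqToHom_tensor_eqToHom {X Y X' Y' : C} (h : X = Y) (h' : X' = Y') :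
    eqToHom h ⊗ₘ eqToHom h' = eqToHom (congrArg₂ (· ⊗ ·) h h') := by
  subst h
  subst h'
  exact id_tensorHom_id _ _

theorem seelyCoherence_eq_eqToHom (hC : IsStrictMonoidal C) (A B : BiprodCompletion C) :
    ∃ h, seelyCoherence M A B = eqToHom h := by
  obtain ⟨h, e⟩ := splitIso_hom_eq_eqToHom hC A.len B.len
    fun p => M.obj (Fin.append A.fam B.fam p)
  have h₁ := congrArg (bang M) (funext fun i => Fin.append_left A.fam B.fam i)
  have h₂ := congrArg (bang M) (funext fun i => Fin.append_right A.fam B.fam i)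
  refine ⟨congrArg single (h.trans (congrArg₂ (· ⊗ ·) h₁ h₂)), ?_⟩
  refine Eq.trans ?_ (singleMap_eqToHom (h.trans (congrArg₂ (· ⊗ ·) h₁ h₂)))
  refine congrArg singleMap ((congrArg₂ (· ≫ ·) e (eqToHom_tensor_eqToHom h₁ h₂)).trans ?_)
  exact eqToHom_trans _ _

end Strict

end BialgebraModality

end

theorem mainTheorem12 {C : Type u} [Category.{v} C] [MonoidalCategory C] [SymmetricCategory C]
    [AdditiveCategory C] [AdditiveMonoidal C] (M : BialgebraModalityData C)
    (hM : M.IsAdditiveBialgebraModality) :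
    -- the completion has finite biproducts, given by the empty list and by concatenation
    (Limits.HasFiniteBiproducts (BiprodCompletion C) ∧
      Limits.IsZero (BiprodCompletion.empty C) ∧
      ∀ A B : BiprodCompletion C, Nonempty (BiprodCompletion.concat A B).IsBilimit) ∧
    -- it carries an additive bialgebra modality with `!(A₁, …, Aₙ) = (!A₁ ⊗ … ⊗ !Aₙ)`
    ((BiprodCompletion.modality M).IsAdditiveBialgebraModality ∧
      ∀ A : BiprodCompletion C, (BiprodCompletion.modality M).obj A =
        BiprodCompletion.single
          (BiprodCompletion.tensorFam A.len fun i => M.obj (A.fam i))) ∧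
    -- it is an additive monoidal storage category
    (BiprodCompletion.modality M).IsAdditiveMonoidalStorage ∧
    -- its Seely isomorphisms are coherence isomorphisms, and identities if `C` is strict
    ((BiprodCompletion.modality M).e (BiprodCompletion.empty C) = 𝟙 (𝟙_ (BiprodCompletion C)) ∧
      (∀ A B : BiprodCompletion C,
        (BiprodCompletion.modality M).seely (BiprodCompletion.concat A B).toCone =
          BiprodCompletion.seelyCoherence M A B) ∧
      (IsStrictMonoidal C → ∀ A B : BiprodCompletion C,
        ∃ h : (BiprodCompletion.modality M).obj (BiprodCompletion.concat A B).pt =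
            (BiprodCompletion.modality M).obj A ⊗ (BiprodCompletion.modality M).obj B,
          (BiprodCompletion.modality M).seely (BiprodCompletion.concat A B).toCone =
            eqToHom h)) ∧
    -- a codereliction on `C` extends to the completion, which is then a differential category
    (∀ η : ∀ A : C, A ⟶ M.obj A, M.IsCodereliction η →
      (BiprodCompletion.modality M).IsCodereliction (BiprodCompletion.codereliction M η) ∧
      (BiprodCompletion.modality M).IsDerivingTransformation
        ((BiprodCompletion.modality M).derivingOf (BiprodCompletion.codereliction M η))) ∧
    -- if `C` is a differential category, then so is the completion
    (∀ d : ∀ A : C, M.obj A ⊗ A ⟶ M.obj A, M.IsDerivingTransformation d →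
      (BiprodCompletion.modality M).IsDerivingTransformation
        ((BiprodCompletion.modality M).derivingOf
          (BiprodCompletion.codereliction M (M.coderelictionOf d)))) := by
  have : Fact M.IsAdditiveBialgebraModality := ⟨hM⟩
  refine ⟨⟨BiprodCompletion.hasFiniteBiproducts, BiprodCompletion.isZero_empty,
    BiprodCompletion.concat_isBilimit⟩,
    ⟨BialgebraModality.modality_isAdditiveBialgebraModality, fun _ => rfl⟩,
    BialgebraModality.modality_isAdditiveMonoidalStorage,
    ⟨BialgebraModality.e_empty, BialgebraModality.seely_concat, fun hC A B => ?_⟩,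
    fun η hη => ⟨BialgebraModality.isCodereliction_codereliction hη,
      BialgebraModality.isDerivingTransformation_codereliction hη⟩,
    fun d hd => BialgebraModality.isDerivingTransformation_codereliction
      (BialgebraModality.isCodereliction_coderelictionOf hd)⟩
  rw [BialgebraModality.seely_concat]
  exact BialgebraModality.seelyCoherence_eq_eqToHom hC A B
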